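/- Let $M$ be a smooth $n$-manifold and $p\colon Z\to M$ a smooth bundle of $n$-dimensional real tori with structure group $\mathrm{Aut}(\mathbb R^n/\mathbb Z^n)=GL(n,\mathbb Z)$ and zero section $s$. Put $V=s^*T_{Z/M}$, let $\Lambda\subset V$ be the lattice with $Z\cong \mathrm{tot}(V)/\Lambda$, let $\nabla$ be the flat (Gauss–Manin) connection on $V$ for which the local sections of $\Lambda$ are flat, and let $\nabla^\vee$ be the dual connection on $V^\vee$. The connection $\nabla$ splits the tangent sequence $0\to p^*V\to T_Z\to p^*T_M\to 0$ and so gives an orthogonal isomorphism $F\colon T_Z\oplus T_Z^\vee\to p^*(V\oplus T_M\oplus V^\vee\oplus T_M^\vee)$. A generalized almost complex structure on a vector bundle $W$ is a smooth bundle endomorphism of $W\oplus W^\vee$ with square $-1$ that is orthogonal for $\langle v+f,w+g\rangle=-\tfrac12(f(w)+g(v))$. Let $\mathcal J=F^{-1}(p^*\underline{\mathcal J})F$ be a semi-flat generalized almost complex structure on $Z$: here $\underline{\mathcal J}$ is a generalized almost complex structure on $V\oplus T_M$ with $\underline{\mathcal J}(V\oplus V^\vee)=T_M\oplus T_M^\vee$.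 Let $\widehat Z=\mathrm{tot}(V^\vee)/\Lambda^\vee\to M$ be the dual torus bundle, where $\Lambda^\vee$ is the lattice of linear forms that are integral on $\Lambda$, let $\widehat{\underline{\mathcal J}}$ be the endomorphism of $V^\vee\oplus T_M\oplus V\oplus T_M^\vee$ obtained from $\underline{\mathcal J}$ by exchanging the summands $V$ and $V^\vee$, and let $\widehat{\mathcal J}$ be the mirror structure on $\widehat Z$, constructed from $\widehat{\underline{\mathcal J}}$ and $\nabla^\vee$ as $\mathcal J$ is from $\underline{\mathcal J}$ and $\nabla$. Then: 1. $\Delta=\underline{\mathcal J}(V)$ and $\widehat\Delta=\underline{\mathcal J}(V^\vee)$ are almost Dirac structures on $M$, that is, maximally isotropic smooth subbundles of $T_M\oplus T_M^\vee$. 2. The connections on $\Delta$ and $\widehat\Delta$ that correspond to $\nabla$ and $\nabla^\vee$ under the isomorphisms $\underline{\mathcal J}\colon V\to\Delta$ and $\underline{\mathcal J}\colon V^\vee\to\widehat\Delta$ are flat connections. 3. $\widehat{\mathcal J}$ is semi-flat, and mirror symmetry exchanges $\Delta$ and $\widehat\Delta$ together with their connections: $\widehat{\underline{\mathcal J}}(V^\vee)=\widehat\Delta$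 and $\widehat{\underline{\mathcal J}}(V)=\Delta$, and the connections induced from $\nabla^\vee$ and $\nabla$ by $\widehat{\underline{\mathcal J}}$ are those of item 2. 4. If $\mathcal J$ is integrable (the sections of its $+i$-eigenbundle in $(T_Z\oplus T_Z^\vee)\otimes\mathbb C$ are closed under the Courant bracket), then $\Delta$ and $\widehat\Delta$ are integrable (their sections are closed under the Courant bracket). -/

import Mathlib

open Set Filter Topology
open scoped Manifold ContDiff

noncomputable section

namespace TorusMirror

/-! ### Generalized linear algebra on `W ⊕ W^∨` -/

/-- `W ⊕ W^∨`. -/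
abbrev Dbl (W : Type*) [AddCommGroup W] [Module ℝ W] [TopologicalSpace W] : Type _ :=
  W × (W →L[ℝ] ℝ)

/-- The canonical pairing `⟨v + f, w + g⟩ = -(f(w) + g(v)) / 2` on `W ⊕ W^∨`. -/
def pairing {W : Type*} [AddCommGroup W] [Module ℝ W] [TopologicalSpace W] (a b : Dbl W) : ℝ :=
  -(1 / 2) * (a.2 b.1 + b.2 a.1)

section Inclusions

variable (A B : Type*) [AddCommGroup A] [Module ℝ A] [TopologicalSpace A]
  [AddCommGroup B] [Module ℝ B] [TopologicalSpace B]

/-- The inclusion of `A ⊕ A^∨` into `(A ⊕ B) ⊕ (A ⊕ B)^∨`. -/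
def inclFst : Dbl A →ₗ[ℝ] Dbl (A × B) where
  toFun a := ((a.1, 0), a.2.comp (ContinuousLinearMap.fst ℝ A B))
  map_add' _ _ := by ext <;> simp
  map_smul' _ _ := by ext <;> simp

/-- The inclusion of `B ⊕ B^∨` into `(A ⊕ B) ⊕ (A ⊕ B)^∨`. -/
def inclSnd : Dbl B →ₗ[ℝ] Dbl (A × B) where
  toFun b := ((0, b.1), b.2.comp (ContinuousLinearMap.snd ℝ A B))
  map_add' _ _ := by ext <;> simp
  map_smul' _ _ := by ext <;> simp

/-- The projection of `(A ⊕ B) ⊕ (A ⊕ B)^∨` to `A ⊕ A^∨`. -/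
def projFst : Dbl (A × B) →ₗ[ℝ] Dbl A where
  toFun c := (c.1.1, c.2.comp (ContinuousLinearMap.inl ℝ A B))
  map_add' _ _ := by ext <;> simp
  map_smul' _ _ := by ext <;> simp

/-- The projection of `(A ⊕ B) ⊕ (A ⊕ B)^∨` to `B ⊕ B^∨`. -/
def projSnd : Dbl (A × B) →ₗ[ℝ] Dbl B where
  toFun c := (c.1.2, c.2.comp (ContinuousLinearMap.inr ℝ A B))
  map_add' _ _ := by ext <;> simp
  map_smul' _ _ := by ext <;> simp

end Inclusions

/-! ### Local sections

A vector bundle over `N` enters through its fibres `W x` and the predicate `S U w`, saying that the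
family `w` is smooth as a section over the open set `U` (its values outside `U` are irrelevant). -/

/-- Smooth local sections of the dual bundle: the evaluation on every smooth local section of the
bundle is a smooth function. -/
def SmoothDual (E : Type*) [NormedAddCommGroup E] [NormedSpace ℝ E]
    {N : Type*} [TopologicalSpace N] [ChartedSpace E N]
    {W : N → Type*} [∀ x, AddCommGroup (W x)] [∀ x, Module ℝ (W x)] [∀ x, TopologicalSpace (W x)]
    (S : Set N → (∀ x, W x) → Prop) (U : Set N) (γ : ∀ x, W x →L[ℝ] ℝ) : Prop :=
  ∀ U' : Set N, IsOpen U' → U' ⊆ U → ∀ w : ∀ x, W x, S U' w →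
    ContMDiffOn 𝓘(ℝ, E) 𝓘(ℝ, ℝ) ∞ (fun x => γ x (w x)) U'

/-- Smooth local sections of `W ⊕ W^∨`. -/
def SmoothDbl (E : Type*) [NormedAddCommGroup E] [NormedSpace ℝ E]
    {N : Type*} [TopologicalSpace N] [ChartedSpace E N]
    {W : N → Type*} [∀ x, AddCommGroup (W x)] [∀ x, Module ℝ (W x)] [∀ x, TopologicalSpace (W x)]
    (S : Set N → (∀ x, W x) → Prop) (U : Set N) (a : ∀ x, Dbl (W x)) : Prop :=
  S U (fun x => (a x).1) ∧ SmoothDual E S U (fun x => (a x).2)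

/-- A generalized almost complex structure on the vector bundle `W`: a smooth orthogonal bundle
endomorphism of `W ⊕ W^∨` with square `-1`. Smoothness of an endomorphism means that it maps
smooth local sections to smooth local sections. -/
structure IsGenAlmostComplex (E : Type*) [NormedAddCommGroup E] [NormedSpace ℝ E]
    {N : Type*} [TopologicalSpace N] [ChartedSpace E N]
    {W : N → Type*} [∀ x, AddCommGroup (W x)] [∀ x, Module ℝ (W x)] [∀ x, TopologicalSpace (W x)]
    (S : Set N → (∀ x, W x) → Prop) (J : ∀ x, Dbl (W x) →ₗ[ℝ] Dbl (W x)) : Prop where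
  sq : ∀ x a, J x (J x a) = -a
  orth : ∀ x a b, pairing (J x a) (J x b) = pairing a b
  smooth : ∀ U : Set N, IsOpen U → ∀ a : ∀ x, Dbl (W x), SmoothDbl E S U a →
    SmoothDbl E S U (fun x => J x (a x))

/-! ### The Courant bracket on a manifold -/

section Courant

variable {E : Type*} [NormedAddCommGroup E] [NormedSpace ℝ E]
  {N : Type*} [TopologicalSpace N] [ChartedSpace E N]

/-- The fibre `T_x ⊕ T_x^∨`. -/
abbrev TT (E : Type*) [NormedAddCommGroup E] [NormedSpace ℝ E]
    {N : Type*} [TopologicalSpace N] [ChartedSpace E N] (x : N) : Type _ :=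
  Dbl (TangentSpace 𝓘(ℝ, E) x)

/-- Smooth local vector fields. -/
def SmoothVF [IsManifold 𝓘(ℝ, E) ∞ N] (U : Set N) (X : ∀ x : N, TangentSpace 𝓘(ℝ, E) x) : Prop :=
  ContMDiffOn 𝓘(ℝ, E) 𝓘(ℝ, E).tangent ∞ (fun x => (⟨x, X x⟩ : TangentBundle 𝓘(ℝ, E) N)) U

/-- Smooth local sections of `T_N ⊕ T_N^∨`. -/
def SmoothTT [IsManifold 𝓘(ℝ, E) ∞ N] (U : Set N) (a : ∀ x : N, TT E x) : Prop :=
  SmoothDbl E (SmoothVF (E := E) (N := N)) U a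

/-- Lie derivative of a one-form along a vector field, on a vector space:
`(L_X η)(w) = (Dη · X)(w) + η(DX · w)`. -/
def lieForm (X : E → E) (η : E → E →L[ℝ] ℝ) (y : E) : E →L[ℝ] ℝ :=
  fderiv ℝ η y (X y) + (η y).comp (fderiv ℝ X y)

/-- The one-form part `L_X η - L_Y ξ + (1/2) d(ι_Y ξ - ι_X η)` of the Courant bracket
`[X + ξ, Y + η]` on a vector space. -/
def courantForm (X : E → E) (ξ : E → E →L[ℝ] ℝ) (Y : E → E) (η : E → E →L[ℝ] ℝ) (y : E) :
    E →L[ℝ] ℝ :=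
  lieForm X η y - lieForm Y ξ y + (1 / 2 : ℝ) • fderiv ℝ (fun z => ξ z (Y z) - η z (X z)) y

/-- A vector field in the preferred chart at `x₀`. -/
def vfInChart (x₀ : N) (X : ∀ x : N, TangentSpace 𝓘(ℝ, E) x) (y : E) : E :=
  VectorField.mpullback 𝓘(ℝ, E) 𝓘(ℝ, E) (extChartAt 𝓘(ℝ, E) x₀).symm X y

/-- A one-form in the preferred chart at `x₀`. -/
def formInChart (x₀ : N) (ξ : ∀ x : N, TangentSpace 𝓘(ℝ, E) x →L[ℝ] ℝ) (y : E) : E →L[ℝ] ℝ :=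
  (ξ ((extChartAt 𝓘(ℝ, E) x₀).symm y)).comp
    (mfderiv 𝓘(ℝ, E) 𝓘(ℝ, E) (extChartAt 𝓘(ℝ, E) x₀).symm y)

/-- The Courant bracket `[X + ξ, Y + η] = [X, Y] + L_X η - L_Y ξ + (1/2) d(ι_Y ξ - ι_X η)`
on a manifold without boundary; the one-form part is computed in the preferred chart. -/
def courant (a b : ∀ x : N, TT E x) (x : N) : TT E x :=
  (VectorField.mlieBracket 𝓘(ℝ, E) (fun y => (a y).1) (fun y => (b y).1) x,
    (courantForm (vfInChart x fun y => (a y).1) (formInChart x fun y => (a y).2)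
      (vfInChart x fun y => (b y).1) (formInChart x fun y => (b y).2)
      (extChartAt 𝓘(ℝ, E) x x)).comp
    (mfderiv 𝓘(ℝ, E) 𝓘(ℝ, E) (extChartAt 𝓘(ℝ, E) x) x))

variable [IsManifold 𝓘(ℝ, E) ∞ N]

/-- `a + i b` is a smooth section over `U` of the `+i`-eigenbundle of `J` in
`(T_N ⊕ T_N^∨) ⊗ ℂ`. -/
def IsEigenSection (J : ∀ x : N, TT E x →ₗ[ℝ] TT E x) (U : Set N) (a b : ∀ x : N, TT E x) : Prop :=
  SmoothTT U a ∧ SmoothTT U b ∧ ∀ x ∈ U, J x (a x) = -b x ∧ J x (b x) = a x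

/-- Integrability of `J`: the sheaf of sections of the `+i`-eigenbundle is closed under the
complex bilinear extension
`[a + i b, c + i d] = ([a, c] - [b, d]) + i ([a, d] + [b, c])` of the Courant bracket (which is
smooth, so that only the pointwise membership has to be required). -/
def Integrable (J : ∀ x : N, TT E x →ₗ[ℝ] TT E x) : Prop :=
  ∀ U : Set N, IsOpen U → ∀ a b c d : ∀ x : N, TT E x,
    IsEigenSection J U a b → IsEigenSection J U c d →
    ∀ x ∈ U,
      J x (courant a c x - courant b d x) = -(courant a d x + courant b c x) ∧
      J x (courant a d x + courant b c x) = courant a c x - courant b d x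

/-! ### Almost Dirac structures and flat connections on them -/

/-- `a` is a smooth section over `U` of the family of subspaces `L` of `T_N ⊕ T_N^∨`. -/
def IsSection (L : ∀ x : N, Submodule ℝ (TT E x)) (U : Set N) (a : ∀ x : N, TT E x) : Prop :=
  SmoothTT U a ∧ ∀ x ∈ U, a x ∈ L x

/-- Almost Dirac structures: maximally isotropic smooth subbundles of `T_N ⊕ T_N^∨`. -/
structure IsAlmostDirac (L : ∀ x : N, Submodule ℝ (TT E x)) : Prop where
  isotropic : ∀ x, ∀ a ∈ L x, ∀ b ∈ L x, pairing a b = 0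
  maximal : ∀ x, ∀ K : Submodule ℝ (TT E x), (∀ a ∈ K, ∀ b ∈ K, pairing a b = 0) →
    L x ≤ K → K = L x
  subbundle : ∀ x : N, ∃ U : Set N, IsOpen U ∧ x ∈ U ∧ ∃ (r : ℕ) (e : Fin r → ∀ y : N, TT E y),
    (∀ k, SmoothTT U (e k)) ∧
    ∀ y ∈ U, LinearIndependent ℝ (fun k => e k y) ∧ Submodule.span ℝ (range fun k => e k y) = L y

/-- Integrability of an almost Dirac structure: its sheaf of sections is closed under the Courant
bracket (which is smooth, so that only the pointwise membership has to be required). -/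
def DiracIntegrable (L : ∀ x : N, Submodule ℝ (TT E x)) : Prop :=
  ∀ U : Set N, IsOpen U → ∀ a b : ∀ x : N, TT E x, IsSection L U a → IsSection L U b →
    ∀ x ∈ U, courant a b x ∈ L x

/-- `D` is a flat connection on the subbundle `L` of `T_N ⊕ T_N^∨`; here `D a x u` is the covariant
derivative at `x` of the local section `a` in the direction `u`. -/
structure IsFlatConnection (L : ∀ x : N, Submodule ℝ (TT E x))
    (D : (∀ x : N, TT E x) → ∀ x : N, TangentSpace 𝓘(ℝ, E) x → TT E x) : Prop where
  congr : ∀ U : Set N, IsOpen U → ∀ a b, IsSection L U a → IsSection L U b →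
    (∀ x ∈ U, a x = b x) → ∀ x ∈ U, ∀ u, D a x u = D b x u
  isSection : ∀ U : Set N, IsOpen U → ∀ a X, IsSection L U a → SmoothVF U X →
    IsSection L U (fun x => D a x (X x))
  linear : ∀ U : Set N, IsOpen U → ∀ a, IsSection L U a → ∀ x ∈ U, ∀ (s t : ℝ) u v,
    D a x (s • u + t • v) = s • D a x u + t • D a x v
  add : ∀ U : Set N, IsOpen U → ∀ a b, IsSection L U a → IsSection L U b → ∀ x ∈ U, ∀ u,
    D (fun y => a y + b y) x u = D a x u + D b x u
  leibniz : ∀ U : Set N, IsOpen U → ∀ (f : N → ℝ) a, ContMDiffOn 𝓘(ℝ, E) 𝓘(ℝ, ℝ) ∞ f U →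
    IsSection L U a → ∀ x ∈ U, ∀ u,
    D (fun y => f y • a y) x u =
      (show ℝ from mfderiv 𝓘(ℝ, E) 𝓘(ℝ, ℝ) f x u) • a x + f x • D a x u
  flat : ∀ U : Set N, IsOpen U → ∀ a X Y, IsSection L U a → SmoothVF U X → SmoothVF U Y →
    ∀ x ∈ U, D (fun y => D a y (Y y)) x (X x) - D (fun y => D a y (X y)) x (Y x) -
      D a x (VectorField.mlieBracket 𝓘(ℝ, E) X Y x) = 0

end Courant

/-! ### Torus bundles -/

/-- Coordinates on the fibres. -/
abbrev Rn (n : ℕ) : Type := Fin n → ℝ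

/-- The linear form `ξ ↦ ∑ η_k ξ_k`. -/
def dotL {n : ℕ} (η : Rn n) : Rn n →L[ℝ] ℝ := ∑ k, η k • ContinuousLinearMap.proj k

/-- The action of an integral matrix on `ℝ^n`. -/
def intAct {n : ℕ} (A : Matrix (Fin n) (Fin n) ℤ) (ξ : Rn n) : Rn n :=
  (A.map (Int.cast : ℤ → ℝ)).mulVec ξ

/-- A bundle of `n`-dimensional tori `ℝ^n / ℤ^n` over the `n`-manifold `M`, with structure group
`Aut(ℝ^n / ℤ^n) = GL(n, ℤ)`, zero section `zero`, and total space the manifold `Z`.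
The local trivialization `U c × ℝ^n / ℤ^n ≅ proj⁻¹(U c)` around the point `c` is given as the map
`φ c` on `U c × ℝ^n`: a local diffeomorphism onto `proj⁻¹(U c)`, over `U c`, two points of the same
fibre `ℝ^n` having the same image exactly if they differ by an element of `ℤ^n`. -/
structure TorusBundle (n : ℕ) (M : Type*) [TopologicalSpace M]
    [ChartedSpace (EuclideanSpace ℝ (Fin n)) M]
    (EZ : Type*) [NormedAddCommGroup EZ] [NormedSpace ℝ EZ]
    (Z : Type*) [TopologicalSpace Z] [ChartedSpace EZ Z] where
  proj : Z → M
  zero : M → Z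
  U : M → Set M
  φ : M → M × Rn n → Z
  isOpen_U : ∀ c, IsOpen (U c)
  mem_U : ∀ c, c ∈ U c
  proj_φ : ∀ c, ∀ m ∈ U c, ∀ ξ, proj (φ c (m, ξ)) = m
  surj : ∀ c z, proj z ∈ U c → ∃ ξ, φ c (proj z, ξ) = z
  period : ∀ c, ∀ m ∈ U c, ∀ ξ ξ',
    φ c (m, ξ) = φ c (m, ξ') ↔ ∃ k : Fin n → ℤ, ∀ i, ξ' i = ξ i + k i
  localDiffeo : ∀ c, IsLocalDiffeomorphOn ((𝓡 n).prod 𝓘(ℝ, Rn n)) 𝓘(ℝ, EZ) ∞ (φ c) (U c ×ˢ univ)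
  φ_zero : ∀ c, ∀ m ∈ U c, φ c (m, 0) = zero m
  /-- the transition functions are locally constant with values in `GL(n, ℤ)` -/
  trans : ∀ c c', ∀ m ∈ U c ∩ U c', ∃ A : Matrix.GeneralLinearGroup (Fin n) ℤ,
    ∀ᶠ m' in 𝓝 m, ∀ ξ, φ c' (m', ξ) = φ c (m', intAct A.1 ξ)

namespace TorusBundle

variable {n : ℕ} {M : Type*} [TopologicalSpace M] [ChartedSpace (EuclideanSpace ℝ (Fin n)) M]
  {EZ : Type*} [NormedAddCommGroup EZ] [NormedSpace ℝ EZ]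
  {Z : Type*} [TopologicalSpace Z] [ChartedSpace EZ Z]
  (T : TorusBundle n M EZ Z)

/-- The differential of the projection. -/
def dproj (z : Z) : TangentSpace 𝓘(ℝ, EZ) z →L[ℝ] TangentSpace (𝓡 n) (T.proj z) :=
  mfderiv 𝓘(ℝ, EZ) (𝓡 n) T.proj z

/-- The differential of the local trivialization around `c` at `(m, ξ)`. -/
def dφ (c m : M) (ξ : Rn n) : EuclideanSpace ℝ (Fin n) × Rn n →L[ℝ] EZ :=
  mfderiv ((𝓡 n).prod 𝓘(ℝ, Rn n)) 𝓘(ℝ, EZ) (T.φ c) (m, ξ)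

/-- The fibre at `m` of `V = s^* T_{Z/M}`, for `s` the zero section: the vertical tangent space of
`Z` at `s(m)`. -/
abbrev V (m : M) : Submodule ℝ (TangentSpace 𝓘(ℝ, EZ) (T.zero m)) :=
  LinearMap.ker (T.dproj (T.zero m)).toLinearMap

/-- The linear coordinates on `V` (over `U c`) given by the local trivialization around `c`. -/
def coord (c m : M) : T.V m →L[ℝ] Rn n :=
  (ContinuousLinearMap.snd ℝ (EuclideanSpace ℝ (Fin n)) (Rn n)).comp
    ((T.dφ c m 0).inverse.comp (T.V m).subtypeL)

theorem dφ_equiv (c m : M) (hm : m ∈ T.U c) (ξ : Rn n) :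
    ∃ e : (EuclideanSpace ℝ (Fin n) × Rn n) ≃L[ℝ] EZ, T.dφ c m ξ = e := by
  have h := T.localDiffeo c ⟨(m, ξ), hm, mem_univ _⟩
  exact ⟨h.mfderivToContinuousLinearEquiv (by simp), rfl⟩

theorem mdifferentiableAt_φ (c m : M) (hm : m ∈ T.U c) (ξ : Rn n) :
    MDifferentiableAt ((𝓡 n).prod 𝓘(ℝ, Rn n)) 𝓘(ℝ, EZ) (T.φ c) (m, ξ) :=
  IsLocalDiffeomorphAt.mdifferentiableAt (T.localDiffeo c ⟨(m, ξ), hm, mem_univ _⟩) (by simp)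

theorem mdifferentiableAt_proj (c m : M) (hm : m ∈ T.U c) (ξ : Rn n) :
    MDifferentiableAt 𝓘(ℝ, EZ) (𝓡 n) T.proj (T.φ c (m, ξ)) := by
  have h := T.localDiffeo c ⟨(m, ξ), hm, mem_univ _⟩
  have h1 : MDifferentiableAt 𝓘(ℝ, EZ) ((𝓡 n).prod 𝓘(ℝ, Rn n)) h.localInverse
      (T.φ c (m, ξ)) := h.localInverse_mdifferentiableAt (by simp)
  have h0 : h.localInverse (T.φ c (m, ξ)) = (m, ξ) :=
    h.localInverse_left_inv h.localInverse_mem_target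
  have h2 : MDifferentiableAt 𝓘(ℝ, EZ) (𝓡 n) (fun z => (h.localInverse z).1)
      (T.φ c (m, ξ)) := mdifferentiableAt_fst.comp _ h1
  refine h2.congr_of_eventuallyEq ?_
  have hc : ∀ᶠ z in 𝓝 (T.φ c (m, ξ)), (h.localInverse z).1 ∈ T.U c := by
    have : ContinuousAt (fun z => (h.localInverse z).1) (T.φ c (m, ξ)) := h2.continuousAt
    refine this.eventually ((T.isOpen_U c).mem_nhds ?_)
    simpa only [h0] using hm
  filter_upwards [hc, h.localInverse_eventuallyEq_right] with z hz hz'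
  have : T.φ c (h.localInverse z) = z := hz'
  conv_lhs => rw [← this]
  exact T.proj_φ c _ hz _

theorem dproj_dφ (c m : M) (hm : m ∈ T.U c) (ξ : Rn n) (w : EuclideanSpace ℝ (Fin n) × Rn n) :
    T.dproj (T.φ c (m, ξ)) (T.dφ c m ξ w) = w.1 := by
  have h1 := (T.mdifferentiableAt_proj c m hm ξ).hasMFDerivAt.comp (m, ξ)
    (T.mdifferentiableAt_φ c m hm ξ).hasMFDerivAt
  have h2 := hasMFDerivAt_fst (I := 𝓡 n) (I' := 𝓘(ℝ, Rn n)) (x := ((m, ξ) : M × Rn n))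
  have h3 : T.proj ∘ T.φ c =ᶠ[𝓝 (m, ξ)] Prod.fst := by
    have : ∀ᶠ q : M × Rn n in 𝓝 (m, ξ), q.1 ∈ T.U c :=
      continuousAt_fst.eventually ((T.isOpen_U c).mem_nhds hm)
    filter_upwards [this] with q hq using T.proj_φ c q.1 hq q.2
  have h4 := hasMFDerivAt_unique h1 (h2.congr_of_eventuallyEq h3)
  exact DFunLike.congr_fun h4 w

theorem dproj_zero_dφ (c m : M) (hm : m ∈ T.U c) (w : EuclideanSpace ℝ (Fin n) × Rn n) :
    T.dproj (T.zero m) (T.dφ c m 0 w) = w.1 := by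
  have h := T.dproj_dφ c m hm 0 w
  rw [T.φ_zero c m hm] at h
  exact h

/-- `coord c m` is an isomorphism for `m ∈ U c`; its inverse maps `η` to the derivative of the
local trivialization at `(m, 0)` in the direction `(0, η)`. -/
def coordEquiv (c m : M) (hm : m ∈ T.U c) : T.V m ≃L[ℝ] Rn n :=
  ContinuousLinearEquiv.equivOfInverse (T.coord c m)
    (((T.dφ c m 0).comp (ContinuousLinearMap.inr ℝ (EuclideanSpace ℝ (Fin n)) (Rn n))).codRestrict
      (T.V m) (fun η => T.dproj_zero_dφ c m hm (0, η)))
    (by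
      obtain ⟨e, he⟩ := T.dφ_equiv c m hm 0
      intro v
      apply Subtype.ext
      let w : EZ := v.1
      have hw : T.dproj (T.zero m) w = 0 := v.2
      have h0 : (e.symm w).1 = 0 := by
        have h := T.dproj_zero_dφ c m hm (e.symm w)
        have h2 : T.dφ c m 0 (e.symm w) = w := by
          rw [he]
          exact e.apply_symm_apply w
        rw [h2] at h
        exact h.symm.trans hw
      have h1 : ((0 : EuclideanSpace ℝ (Fin n)), (e.symm w).2) = e.symm w :=
        Prod.ext h0.symm rfl
      change T.dφ c m 0 (0, ((T.dφ c m 0).inverse w).2) = w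
      rw [he, ContinuousLinearMap.inverse_equiv]
      change e (0, (e.symm w).2) = w
      rw [h1, ContinuousLinearEquiv.apply_symm_apply])
    (by
      obtain ⟨e, he⟩ := T.dφ_equiv c m hm 0
      intro η
      change ((T.dφ c m 0).inverse (T.dφ c m 0 (0, η))).2 = η
      rw [he, ContinuousLinearMap.inverse_equiv]
      change (e.symm (e (0, η))).2 = η
      rw [ContinuousLinearEquiv.symm_apply_apply])

/-! ### The lattice and the dual torus bundle -/

theorem coord_change {c c' m : M} (hm : m ∈ T.U c) (hm' : m ∈ T.U c')
    (A : Matrix (Fin n) (Fin n) ℤ)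
    (h : ∀ ξ, T.φ c' (m, ξ) = T.φ c (m, intAct A ξ)) (v : T.V m) :
    T.coord c m v = intAct A (T.coord c' m v) := by
  have key : ∀ η, T.dφ c' m 0 (0, η) = T.dφ c m 0 (0, intAct A η) := by
    intro η
    let L : Rn n →L[ℝ] Rn n :=
      LinearMap.toContinuousLinearMap (Matrix.toLin' (A.map (Int.cast : ℤ → ℝ)))
    have hL : ∀ ξ, L ξ = intAct A ξ := fun ξ => rfl
    have hp : ∀ (b : M) (hb : m ∈ T.U b),
        HasMFDerivAt 𝓘(ℝ, Rn n) 𝓘(ℝ, EZ) (fun ξ => T.φ b (m, ξ)) (0 : Rn n)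
          ((T.dφ b m 0).comp
            (ContinuousLinearMap.inr ℝ (EuclideanSpace ℝ (Fin n)) (Rn n))) := by
      intro b hb
      have h1 := (T.mdifferentiableAt_φ b m hb 0).hasMFDerivAt
      have h2 := (hasMFDerivAt_const (I := 𝓘(ℝ, Rn n)) (I' := 𝓡 n) m (0 : Rn n)).prodMk
        (hasMFDerivAt_id (I := 𝓘(ℝ, Rn n)) (0 : Rn n))
      have h3 := HasMFDerivAt.comp (0 : Rn n) h1 h2
      exact h3
    have h1 := hp c' hm'
    have h2 : HasMFDerivAt 𝓘(ℝ, Rn n) 𝓘(ℝ, Rn n) L (0 : Rn n) L :=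
      L.hasFDerivAt.hasMFDerivAt
    have h3 := hp c hm
    have h3' : HasMFDerivAt 𝓘(ℝ, Rn n) 𝓘(ℝ, EZ) (fun ξ => T.φ c (m, ξ)) (L 0)
          ((T.dφ c m 0).comp
            (ContinuousLinearMap.inr ℝ (EuclideanSpace ℝ (Fin n)) (Rn n))) := by
      have h0 : L 0 = 0 := map_zero L
      rw [h0]; exact h3
    have h4 := HasMFDerivAt.comp (0 : Rn n) h3' h2
    have h5 : ((fun ξ => T.φ c (m, ξ)) ∘ L) = fun ξ => T.φ c' (m, ξ) := by
      funext ξ; exact (h ξ).symm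
    rw [h5] at h4
    exact DFunLike.congr_fun (hasMFDerivAt_unique h1 h4) η
  have h1 : ((T.coordEquiv c' m hm').symm (T.coord c' m v)) = v :=
    (T.coordEquiv c' m hm').symm_apply_apply v
  have h2 : ((T.coordEquiv c m hm).symm (intAct A (T.coord c' m v))) = v := by
    refine Eq.trans (Subtype.ext ?_) h1
    exact (key (T.coord c' m v)).symm
  have h3 := congrArg (T.coordEquiv c m hm) h2
  rw [ContinuousLinearEquiv.apply_symm_apply] at h3
  exact h3.symm

/-- The exponential map of the fibre torus at `m`, i.e. the restriction to `V_m` of the quotient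
map `tot(V) → Z`. -/
def fibExp (m : M) (v : T.V m) : Z := T.φ m (m, T.coord m m v)

theorem fibExp_eq (c m : M) (hm : m ∈ T.U c) (v : T.V m) :
    T.fibExp m v = T.φ c (m, T.coord c m v) := by
  obtain ⟨A, hA⟩ := T.trans c m m ⟨hm, T.mem_U m⟩
  have h := hA.self_of_nhds
  rw [fibExp, h, T.coord_change hm (T.mem_U m) A.1 h]

theorem fibExp_eq_zero_iff (c m : M) (hm : m ∈ T.U c) (v : T.V m) :
    T.fibExp m v = T.zero m ↔ ∃ k : Fin n → ℤ, ∀ i, T.coord c m v i = k i := by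
  rw [T.fibExp_eq c m hm, ← T.φ_zero c m hm, eq_comm, T.period c m hm]
  simp

/-- The period lattice `Λ_m = ker (V_m → Z_m)`. -/
def lattice (m : M) : AddSubgroup (T.V m) where
  carrier := {v | T.fibExp m v = T.zero m}
  zero_mem' := by
    rw [mem_ofPred_eq, T.fibExp_eq_zero_iff m m (T.mem_U m)]
    exact ⟨0, fun i => by simp⟩
  add_mem' := by
    intro v w hv hw
    rw [mem_ofPred_eq, T.fibExp_eq_zero_iff m m (T.mem_U m)] at *
    obtain ⟨k, hk⟩ := hv
    obtain ⟨l, hl⟩ := hw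
    exact ⟨k + l, fun i => by simp [hk, hl]⟩
  neg_mem' := by
    intro v hv
    rw [mem_ofPred_eq, T.fibExp_eq_zero_iff m m (T.mem_U m)] at *
    obtain ⟨k, hk⟩ := hv
    exact ⟨-k, fun i => by simp [hk]⟩

theorem mem_lattice_iff (c m : M) (hm : m ∈ T.U c) (v : T.V m) :
    v ∈ T.lattice m ↔ ∃ k : Fin n → ℤ, ∀ i, T.coord c m v i = k i :=
  T.fibExp_eq_zero_iff c m hm v

/-- The dual lattice `Λ_m^∨`: the linear forms on `V_m` that are integral on `Λ_m`. -/
def dualLattice (m : M) : AddSubgroup (T.V m →L[ℝ] ℝ) where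
  carrier := {α | ∀ v ∈ T.lattice m, ∃ k : ℤ, α v = k}
  zero_mem' := fun v _ => ⟨0, by simp⟩
  add_mem' := by
    intro α β hα hβ v hv
    obtain ⟨k, hk⟩ := hα v hv
    obtain ⟨l, hl⟩ := hβ v hv
    exact ⟨k + l, by simp [hk, hl]⟩
  neg_mem' := by
    intro α hα v hv
    obtain ⟨k, hk⟩ := hα v hv
    exact ⟨-k, by simp [hk]⟩

/-- The total space `tot(V^∨) / Λ^∨` of the dual torus bundle. -/
def DualTotal : Type _ := Σ m : M, (T.V m →L[ℝ] ℝ) ⧸ T.dualLattice m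

/-- The class of a linear form on `V_m`. -/
def dualMk (m : M) (α : T.V m →L[ℝ] ℝ) : T.DualTotal := ⟨m, QuotientAddGroup.mk α⟩

/-- Local trivializations of the dual torus bundle, by the coordinates on `V^∨` dual to the
coordinates on `V`. -/
def dualφ (c : M) (q : M × Rn n) : T.DualTotal :=
  T.dualMk q.1 ((dotL q.2).comp (T.coord c q.1))

theorem dotL_apply (η ξ : Rn n) : dotL η ξ = η ⬝ᵥ ξ := by
  simp [dotL, dotProduct]

theorem dualφ_eq_iff (c m : M) (hm : m ∈ T.U c) (η η' : Rn n) :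
    T.dualφ c (m, η) = T.dualφ c (m, η') ↔ ∃ k : Fin n → ℤ, ∀ i, η' i = η i + k i := by
  have h1 : T.dualφ c (m, η) = T.dualφ c (m, η') ↔
      -((dotL η).comp (T.coord c m)) + (dotL η').comp (T.coord c m) ∈ T.dualLattice m := by
    rw [← QuotientAddGroup.eq]
    constructor
    · intro h
      have h' := (Sigma.mk.inj_iff.1 h).2
      exact eq_of_heq h'
    · intro h
      exact Sigma.ext rfl (heq_of_eq h)
  rw [h1]
  have h2 : ∀ v, (-((dotL η).comp (T.coord c m)) + (dotL η').comp (T.coord c m)) v =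
      (η' - η) ⬝ᵥ T.coord c m v := by
    intro v
    simp [dotL_apply, sub_dotProduct]
    ring
  constructor
  · intro h
    have h3 : ∀ i, ∃ k : ℤ, η' i = η i + k := by
      intro i
      obtain ⟨k, hk⟩ := h ((T.coordEquiv c m hm).symm (Pi.single i 1))
        ((T.mem_lattice_iff c m hm _).2 ⟨Pi.single i 1, fun j => by
          have : T.coord c m ((T.coordEquiv c m hm).symm (Pi.single i 1)) = Pi.single i 1 :=
            (T.coordEquiv c m hm).apply_symm_apply _
          rw [this]
          by_cases hj : j = i
          · subst hj; simp
          · simp [hj]⟩)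
      rw [h2] at hk
      have : T.coord c m ((T.coordEquiv c m hm).symm (Pi.single i 1)) = Pi.single i 1 :=
        (T.coordEquiv c m hm).apply_symm_apply _
      rw [this] at hk
      simp at hk
      exact ⟨k, by linarith⟩
    choose k hk using h3
    exact ⟨k, hk⟩
  · rintro ⟨k, hk⟩ v hv
    obtain ⟨l, hl⟩ := (T.mem_lattice_iff c m hm v).1 hv
    refine ⟨∑ i, k i * l i, ?_⟩
    rw [h2]
    simp [dotProduct, hk, hl]

theorem dualφ_surj (c : M) (m : M) (hm : m ∈ T.U c) (z : T.DualTotal) (hz : z.1 = m) :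
    ∃ η, T.dualφ c (m, η) = z := by
  subst hz
  obtain ⟨m, a⟩ := z
  obtain ⟨α, rfl⟩ := QuotientAddGroup.mk_surjective a
  refine ⟨fun k => α ((T.coordEquiv c m hm).symm (Pi.single k 1)), ?_⟩
  have : (dotL fun k => α ((T.coordEquiv c m hm).symm (Pi.single k 1))).comp (T.coord c m) = α := by
    ext v
    have h1 : v = (T.coordEquiv c m hm).symm (T.coord c m v) :=
      ((T.coordEquiv c m hm).symm_apply_apply v).symm
    have h2 : T.coord c m v = ∑ k, T.coord c m v k • (Pi.single k 1 : Rn n) := by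
      ext i
      simp [Finset.sum_apply, Pi.single_apply]
    conv_rhs => rw [h1, h2]
    simp [dotL_apply, dotProduct, mul_comm]
  simp only [dualφ, dualMk]
  rw [this]

theorem dualφ_trans (c c' : M) (m : M) (hm : m ∈ T.U c ∩ T.U c') :
    ∃ B : Matrix.GeneralLinearGroup (Fin n) ℤ,
      ∀ᶠ m' in 𝓝 m, ∀ ξ, T.dualφ c' (m', ξ) = T.dualφ c (m', intAct B.1 ξ) := by
  obtain ⟨A, hA⟩ := T.trans c c' m hm
  refine ⟨⟨(A⁻¹).1.transpose, A.1.transpose, ?_, ?_⟩, ?_⟩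
  · rw [← Matrix.transpose_mul, Units.mul_inv, Matrix.transpose_one]
  · rw [← Matrix.transpose_mul, Units.inv_mul, Matrix.transpose_one]
  filter_upwards [hA, (T.isOpen_U c).mem_nhds hm.1, (T.isOpen_U c').mem_nhds hm.2]
    with m' h h1 h2 ξ
  have : (dotL ξ).comp (T.coord c' m') =
      (dotL (intAct (A⁻¹).1.transpose ξ)).comp (T.coord c m') := by
    ext v
    simp only [ContinuousLinearMap.comp_apply, dotL_apply, T.coord_change h1 h2 A.1 h v]
    have h3 : ((A⁻¹).1.map (Int.cast : ℤ → ℝ)) * (A.1.map (Int.cast : ℤ → ℝ)) = 1 := by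
      have h4 : ((A⁻¹).1 * A.1).map (Int.castRingHom ℝ) = 1 := by
        rw [Units.inv_mul]
        exact Matrix.map_one _ (map_zero _) (map_one _)
      rw [Matrix.map_mul] at h4
      exact h4
    rw [intAct, intAct, Matrix.transpose_map, Matrix.mulVec_transpose, Matrix.dotProduct_mulVec,
      Matrix.vecMul_vecMul, h3, Matrix.vecMul_one]
  simp only [dualφ]
  rw [this]

/-! ### The smooth structure of the dual torus bundle

The charts are the local trivializations over charts of `M`, restricted to boxes in `ℝ^n` on which
the projection to `ℝ^n / ℤ^n` is injective. -/

/-- The model space of the total space of the dual torus bundle. -/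
abbrev DualModel (n : ℕ) : Type := EuclideanSpace ℝ (Fin n) × Rn n

/-- Domain of the parametrization belonging to the trivialization around `c`, the preferred chart
of `M` at `m₀`, and the box around `η₀`. -/
def parDomain (c m₀ : M) (η₀ : Rn n) : Set (DualModel n) :=
  {q | q.1 ∈ (chartAt (EuclideanSpace ℝ (Fin n)) m₀).target ∧
    (chartAt (EuclideanSpace ℝ (Fin n)) m₀).symm q.1 ∈ T.U c ∧ q.2 ∈ Metric.ball η₀ (1 / 2)}

/-- The parametrization. -/
def par (c m₀ : M) (q : DualModel n) : T.DualTotal :=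
  T.dualφ c ((chartAt (EuclideanSpace ℝ (Fin n)) m₀).symm q.1, q.2)

theorem isOpen_parDomain (c m₀ : M) (η₀ : Rn n) : IsOpen (T.parDomain c m₀ η₀) := by
  have h1 : IsOpen ((chartAt (EuclideanSpace ℝ (Fin n)) m₀).target ∩
      (chartAt (EuclideanSpace ℝ (Fin n)) m₀).symm ⁻¹' T.U c) :=
    (chartAt (EuclideanSpace ℝ (Fin n)) m₀).isOpen_inter_preimage_symm (T.isOpen_U c)
  have h2 := h1.prod (Metric.isOpen_ball (x := η₀) (ε := 1 / 2))
  convert h2 using 1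
  ext q
  simp [parDomain, and_assoc]

theorem injOn_par (c m₀ : M) (η₀ : Rn n) : InjOn (T.par c m₀) (T.parDomain c m₀ η₀) := by
  rintro ⟨x, η⟩ ⟨hx, hU, hη⟩ ⟨x', η'⟩ ⟨hx', hU', hη'⟩ h
  simp only at hx hU hη hx' hU' hη'
  have h1 : x = x' := by
    have : (chartAt (EuclideanSpace ℝ (Fin n)) m₀).symm x =
        (chartAt (EuclideanSpace ℝ (Fin n)) m₀).symm x' := congrArg Sigma.fst h
    exact (chartAt (EuclideanSpace ℝ (Fin n)) m₀).symm.injOn hx hx' this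
  subst h1
  obtain ⟨k, hk⟩ := (T.dualφ_eq_iff c _ hU η η').1 h
  have h2 : η = η' := by
    ext i
    have h3 : dist (η i) (η₀ i) < 1 / 2 := (dist_le_pi_dist η η₀ i).trans_lt hη
    have h4 : dist (η' i) (η₀ i) < 1 / 2 := (dist_le_pi_dist η' η₀ i).trans_lt hη'
    have h5 : |((k i : ℤ) : ℝ)| < 1 := by
      have h6 : ((k i : ℤ) : ℝ) = η' i - η i := by rw [hk i]; ring
      rw [h6, ← Real.dist_eq]
      calc dist (η' i) (η i) ≤ dist (η' i) (η₀ i) + dist (η i) (η₀ i) :=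
            dist_triangle_right _ _ _
        _ < 1 := by linarith
    have h7 : k i = 0 := by
      rw [← Int.cast_abs] at h5
      exact Int.abs_lt_one_iff.1 (by exact_mod_cast h5)
    rw [hk i, h7]; simp
  rw [h2]

/-- The charts of the dual torus bundle. -/
def dualChart (c m₀ : M) (η₀ : Rn n) : PartialEquiv T.DualTotal (DualModel n) :=
  ((T.injOn_par c m₀ η₀).toPartialEquiv).symm

theorem par_transition [IsManifold (𝓡 n) ∞ M] (c m₀ : M) (η₀ : Rn n) (c' m₀' : M) (η₀' : Rn n)
    (q : DualModel n) (hq : q ∈ T.parDomain c m₀ η₀)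
    (hq' : T.par c m₀ q ∈ T.par c' m₀' '' T.parDomain c' m₀' η₀') :
    ∃ g : DualModel n → DualModel n, ContDiffAt ℝ ∞ g q ∧
      ∀ᶠ p in 𝓝 q, g p ∈ T.parDomain c' m₀' η₀' ∧ T.par c m₀ p = T.par c' m₀' (g p) := by
  obtain ⟨q₁, hq₁, hqq⟩ := hq'
  have hfst : (chartAt (EuclideanSpace ℝ (Fin n)) m₀').symm q₁.1 =
      (chartAt (EuclideanSpace ℝ (Fin n)) m₀).symm q.1 := congrArg Sigma.fst hqq
  set m := (chartAt (EuclideanSpace ℝ (Fin n)) m₀).symm q.1 with hm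
  have hmc : m ∈ T.U c := hq.2.1
  have hmc' : m ∈ T.U c' := by rw [← hfst]; exact hq₁.2.1
  have hms' : m ∈ (chartAt (EuclideanSpace ℝ (Fin n)) m₀').source := by
    rw [← hfst]; exact (chartAt (EuclideanSpace ℝ (Fin n)) m₀').map_target hq₁.1
  have hq₁1 : q₁.1 = chartAt (EuclideanSpace ℝ (Fin n)) m₀' m := by
    rw [← hfst, (chartAt (EuclideanSpace ℝ (Fin n)) m₀').right_inv hq₁.1]
  obtain ⟨B, hB⟩ := T.dualφ_trans c' c m ⟨hmc', hmc⟩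
  have h1 : T.dualφ c' (m, intAct B.1 q.2) = T.dualφ c' (m, q₁.2) := by
    rw [← hB.self_of_nhds q.2]
    have : T.dualφ c' ((chartAt (EuclideanSpace ℝ (Fin n)) m₀').symm q₁.1, q₁.2) =
      T.dualφ c (m, q.2) := hqq
    rw [hfst] at this
    exact this.symm
  obtain ⟨k, hk⟩ := (T.dualφ_eq_iff c' m hmc' _ _).1 h1
  let g : DualModel n → DualModel n := fun p =>
    (chartAt (EuclideanSpace ℝ (Fin n)) m₀' ((chartAt (EuclideanSpace ℝ (Fin n)) m₀).symm p.1),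
      intAct B.1 p.2 + fun i => (k i : ℝ))
  have hgq : g q = q₁ := by
    refine Prod.ext hq₁1.symm ?_
    ext i
    exact (hk i).symm
  have hsymm : ContMDiffAt (𝓡 n) (𝓡 n) ∞ (chartAt (EuclideanSpace ℝ (Fin n)) m₀).symm q.1 :=
    contMDiffOn_chart_symm.contMDiffAt
      ((chartAt (EuclideanSpace ℝ (Fin n)) m₀).open_target.mem_nhds hq.1)
  have hg : ContDiffAt ℝ ∞ g q := by
    refine ContDiffAt.prodMk ?_ ?_
    · have h3 : ContMDiffAt (𝓡 n) (𝓡 n) ∞ (chartAt (EuclideanSpace ℝ (Fin n)) m₀') m :=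
        contMDiffOn_chart.contMDiffAt
          ((chartAt (EuclideanSpace ℝ (Fin n)) m₀').open_source.mem_nhds hms')
      have h4 := ContMDiffAt.comp q.1 h3 hsymm
      exact h4.contDiffAt.comp q contDiffAt_fst
    · refine ContDiffAt.add ?_ contDiffAt_const
      let L : Rn n →L[ℝ] Rn n :=
        LinearMap.toContinuousLinearMap (Matrix.toLin' (B.1.map (Int.cast : ℤ → ℝ)))
      exact L.contDiff.contDiffAt.comp q contDiffAt_snd
  refine ⟨g, hg, ?_⟩
  have hc1 : ContinuousAt (fun p : DualModel n =>
      (chartAt (EuclideanSpace ℝ (Fin n)) m₀).symm p.1) q :=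
    ContinuousAt.comp (f := Prod.fst) hsymm.continuousAt continuousAt_fst
  have e1 := hc1.eventually
    ((chartAt (EuclideanSpace ℝ (Fin n)) m₀').open_source.mem_nhds hms')
  have e2 := hc1.eventually hB
  have e3 : ∀ᶠ p in 𝓝 q, g p ∈ T.parDomain c' m₀' η₀' := by
    refine hg.continuousAt.eventually ((T.isOpen_parDomain c' m₀' η₀').mem_nhds ?_)
    rw [hgq]; exact hq₁
  filter_upwards [e1, e2, e3] with p p1 p2 p3
  refine ⟨p3, ?_⟩
  have p4 : T.par c m₀ p = T.dualφ c' ((chartAt (EuclideanSpace ℝ (Fin n)) m₀).symm p.1,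
    intAct B.1 p.2) := p2 p.2
  have p5 : T.par c' m₀' (g p) = T.dualφ c' ((chartAt (EuclideanSpace ℝ (Fin n)) m₀).symm p.1,
      intAct B.1 p.2 + fun i => (k i : ℝ)) := by
    simp only [par, g]
    rw [(chartAt (EuclideanSpace ℝ (Fin n)) m₀').left_inv p1]
  rw [p4, p5, T.dualφ_eq_iff c' _ (by
    have := p3.2.1
    simp only [g] at this
    rwa [(chartAt (EuclideanSpace ℝ (Fin n)) m₀').left_inv p1] at this)]
  exact ⟨k, fun i => rfl⟩

theorem dualChart_transition [IsManifold (𝓡 n) ∞ M] (c m₀ : M) (η₀ : Rn n)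
    (c' m₀' : M) (η₀' : Rn n) (q : DualModel n)
    (hq : q ∈ ((T.dualChart c m₀ η₀).symm.trans (T.dualChart c' m₀' η₀')).source) :
    ((T.dualChart c m₀ η₀).symm.trans (T.dualChart c' m₀' η₀')).source ∈ 𝓝 q ∧
    ContDiffAt ℝ ∞ ((T.dualChart c m₀ η₀).symm.trans (T.dualChart c' m₀' η₀')) q := by
  have hs : ∀ p, p ∈ ((T.dualChart c m₀ η₀).symm.trans (T.dualChart c' m₀' η₀')).source ↔
      p ∈ T.parDomain c m₀ η₀ ∧ T.par c m₀ p ∈ T.par c' m₀' '' T.parDomain c' m₀' η₀' :=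
    fun p => Iff.rfl
  obtain ⟨h1, h2⟩ := (hs q).1 hq
  obtain ⟨g, hg, hev⟩ := T.par_transition c m₀ η₀ c' m₀' η₀' q h1 h2
  constructor
  · filter_upwards [hev, (T.isOpen_parDomain c m₀ η₀).mem_nhds h1] with p hp hp'
    exact (hs p).2 ⟨hp', hp.2 ▸ mem_image_of_mem _ hp.1⟩
  · refine hg.congr_of_eventuallyEq ?_
    filter_upwards [hev] with p hp
    have : ((T.dualChart c m₀ η₀).symm.trans (T.dualChart c' m₀' η₀')) p =
        (T.dualChart c' m₀' η₀') (T.par c m₀ p) := rfl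
    rw [this, hp.2]
    exact (T.dualChart c' m₀' η₀').right_inv (x := g p) hp.1

/-- The atlas of the dual torus bundle. -/
def dualCore [IsManifold (𝓡 n) ∞ M] : ChartedSpaceCore (DualModel n) T.DualTotal where
  atlas := {e | ∃ c m₀ η₀, e = T.dualChart c m₀ η₀}
  chartAt z := T.dualChart z.1 z.1 (T.dualφ_surj z.1 z.1 (T.mem_U _) z rfl).choose
  mem_chart_source z := by
    have h := (T.dualφ_surj z.1 z.1 (T.mem_U _) z rfl).choose_spec
    set η := (T.dualφ_surj z.1 z.1 (T.mem_U _) z rfl).choose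
    have hl : (chartAt (EuclideanSpace ℝ (Fin n)) z.1).symm
        (chartAt (EuclideanSpace ℝ (Fin n)) z.1 z.1) = z.1 :=
      (chartAt (EuclideanSpace ℝ (Fin n)) z.1).left_inv (mem_chart_source _ _)
    refine (mem_image _ _ _).2 ⟨(chartAt (EuclideanSpace ℝ (Fin n)) z.1 z.1, η), ⟨?_, ?_, ?_⟩, ?_⟩
    · exact mem_chart_target _ _
    · simpa only [hl] using T.mem_U z.1
    · exact Metric.mem_ball_self (by norm_num)
    · simpa only [par, hl] using h
  chart_mem_atlas z := ⟨_, _, _, rfl⟩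
  open_source := by
    rintro _ _ ⟨c, m₀, η₀, rfl⟩ ⟨c', m₀', η₀', rfl⟩
    exact isOpen_iff_mem_nhds.2 fun q hq =>
      (T.dualChart_transition c m₀ η₀ c' m₀' η₀' q hq).1
  continuousOn_toFun := by
    rintro _ _ ⟨c, m₀, η₀, rfl⟩ ⟨c', m₀', η₀', rfl⟩
    exact fun q hq =>
      (T.dualChart_transition c m₀ η₀ c' m₀' η₀' q hq).2.continuousAt.continuousWithinAt

instance [IsManifold (𝓡 n) ∞ M] : TopologicalSpace T.DualTotal := T.dualCore.toTopologicalSpace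

instance [IsManifold (𝓡 n) ∞ M] : ChartedSpace (DualModel n) T.DualTotal :=
  T.dualCore.toChartedSpace

instance [IsManifold (𝓡 n) ∞ M] : IsManifold 𝓘(ℝ, DualModel n) ∞ T.DualTotal := by
  refine isManifold_of_contDiffOn _ _ _ ?_
  intro e e' he he'
  have h : ∀ f : OpenPartialHomeomorph T.DualTotal (DualModel n),
      f ∈ atlas (DualModel n) T.DualTotal →
      ∃ c m₀ η₀, f.toPartialEquiv = T.dualChart c m₀ η₀ := by
    intro f hf
    obtain ⟨g, hg⟩ := mem_iUnion.1 hf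
    obtain ⟨⟨c, m₀, η₀, rfl⟩, hg⟩ := mem_iUnion.1 hg
    exact ⟨c, m₀, η₀, by rw [mem_singleton_iff.1 hg]; rfl⟩
  obtain ⟨c, m₀, η₀, hf⟩ := h e he
  obtain ⟨c', m₀', η₀', hf'⟩ := h e' he'
  have key : (e.symm ≫ₕ e').toPartialEquiv =
      (T.dualChart c m₀ η₀).symm.trans (T.dualChart c' m₀' η₀') := by
    rw [← hf, ← hf']; rfl
  intro q hq
  have hq1 : q ∈ (e.symm ≫ₕ e').toPartialEquiv.source := hq.1
  rw [key] at hq1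
  have hd := (T.dualChart_transition c m₀ η₀ c' m₀' η₀' q hq1).2
  rw [← key] at hd
  exact hd.contDiffWithinAt

theorem dualChart_mem_atlas [IsManifold (𝓡 n) ∞ M] (c m₀ : M) (η₀ : Rn n) :
    ∃ e ∈ atlas (DualModel n) T.DualTotal, e.toPartialEquiv = T.dualChart c m₀ η₀ :=
  ⟨T.dualCore.openPartialHomeomorph _ ⟨c, m₀, η₀, rfl⟩,
    mem_iUnion.2 ⟨_, mem_iUnion.2 ⟨⟨c, m₀, η₀, rfl⟩, mem_singleton _⟩⟩, rfl⟩

theorem localDiffeo_dualφ [IsManifold (𝓡 n) ∞ M] (c : M) :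
    IsLocalDiffeomorphOn ((𝓡 n).prod 𝓘(ℝ, Rn n)) 𝓘(ℝ, DualModel n) ∞ (T.dualφ c)
      (T.U c ×ˢ univ) := by
  rintro ⟨⟨m, η⟩, hm, -⟩
  obtain ⟨e, he, hee⟩ := T.dualChart_mem_atlas c m η
  let κ := chartAt (EuclideanSpace ℝ (Fin n)) m
  let W : Set (M × Rn n) := (κ.source ∩ T.U c) ×ˢ Metric.ball η (1 / 2)
  have hW : IsOpen W := (κ.open_source.inter (T.isOpen_U c)).prod Metric.isOpen_ball
  have htgt : e.target = T.parDomain c m η := by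
    rw [hee]; rfl
  have hsymm : ∀ q, e.symm q = T.par c m q := by
    intro q
    change e.toPartialEquiv.symm q = _
    rw [hee]; rfl
  have hmaps : ∀ p ∈ W, (κ p.1, p.2) ∈ e.target := by
    rintro ⟨x, ξ⟩ ⟨⟨hx, hU⟩, hξ⟩
    rw [htgt]
    refine ⟨κ.map_source hx, ?_, hξ⟩
    change κ.symm (κ x) ∈ T.U c
    rw [κ.left_inv hx]; exact hU
  have heq : ∀ p ∈ W, T.dualφ c p = e.symm (κ p.1, p.2) := by
    rintro ⟨x, ξ⟩ ⟨⟨hx, hU⟩, hξ⟩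
    rw [hsymm]
    change _ = T.dualφ c (κ.symm (κ x), ξ)
    rw [κ.left_inv hx]
  have hmaps' : ∀ z ∈ e.source, (κ.symm (e z).1, (e z).2) ∈ W := by
    intro z hz
    have h1 := e.map_source hz
    rw [htgt] at h1
    exact ⟨⟨κ.map_target h1.1, h1.2.1⟩, h1.2.2⟩
  let Φ : PartialDiffeomorph ((𝓡 n).prod 𝓘(ℝ, Rn n)) 𝓘(ℝ, DualModel n) (M × Rn n)
      T.DualTotal ∞ :=
    { toFun := T.dualφ c
      invFun := fun z => (κ.symm (e z).1, (e z).2)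
      source := W
      target := e.source
      map_source' := fun p hp => by rw [heq p hp]; exact e.map_target (hmaps p hp)
      map_target' := hmaps'
      left_inv' := fun p hp => by
        rw [heq p hp, e.right_inv (hmaps p hp)]
        exact Prod.ext (κ.left_inv hp.1.1) rfl
      right_inv' := fun z hz => by
        rw [heq _ (hmaps' z hz)]
        have h1 := e.map_source hz
        rw [htgt] at h1
        have h2 : (κ (κ.symm (e z).1), (e z).2) = e z := Prod.ext (κ.right_inv h1.1) rfl
        simp only [h2]
        exact e.left_inv hz
      open_source := hW
      open_target := e.open_source
      contMDiffOn_toFun := by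
        have h1 : ContMDiffOn 𝓘(ℝ, DualModel n) 𝓘(ℝ, DualModel n) ∞ e.symm e.target :=
          contMDiffOn_symm_of_mem_maximalAtlas (StructureGroupoid.subset_maximalAtlas _ he)
        have h2 : ContMDiffOn ((𝓡 n).prod 𝓘(ℝ, Rn n)) 𝓘(ℝ, DualModel n) ∞
            (fun p : M × Rn n => (κ p.1, p.2)) W := by
          have h3 : ContMDiffOn (𝓡 n) (𝓡 n) ∞ κ κ.source := contMDiffOn_chart
          exact (h3.comp contMDiffOn_fst fun p hp => hp.1.1).prodMk_space contMDiffOn_snd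
        exact (h1.comp h2 hmaps).congr heq
      contMDiffOn_invFun := by
        have h1 : ContMDiffOn 𝓘(ℝ, DualModel n) 𝓘(ℝ, DualModel n) ∞ e e.source :=
          contMDiffOn_of_mem_maximalAtlas (StructureGroupoid.subset_maximalAtlas _ he)
        have h3 : ContMDiffOn (𝓡 n) (𝓡 n) ∞ κ.symm κ.target := contMDiffOn_chart_symm
        have h4 : ContMDiffOn 𝓘(ℝ, DualModel n) (𝓡 n) ∞ (fun z => (e z).1) e.source :=
          (contDiff_fst.contMDiff.contMDiffOn (s := univ)).comp h1 fun _ _ => mem_univ _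
        have h5 : ContMDiffOn 𝓘(ℝ, DualModel n) 𝓘(ℝ, Rn n) ∞ (fun z => (e z).2) e.source :=
          (contDiff_snd.contMDiff.contMDiffOn (s := univ)).comp h1 fun _ _ => mem_univ _
        refine (h3.comp h4 fun z hz => ?_).prodMk h5
        have h6 := e.map_source hz
        rw [htgt] at h6
        exact h6.1 }
  exact Φ.isLocalDiffeomorphAt _ _ _
    ⟨⟨mem_chart_source _ _, hm⟩, Metric.mem_ball_self (by norm_num)⟩

/-- The dual torus bundle `tot(V^∨) / Λ^∨ → M`. -/
def dual [IsManifold (𝓡 n) ∞ M] : TorusBundle n M (DualModel n) T.DualTotal where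
  proj z := z.1
  zero m := T.dualMk m 0
  U := T.U
  φ := T.dualφ
  isOpen_U := T.isOpen_U
  mem_U := T.mem_U
  proj_φ _ _ _ _ := rfl
  surj c z hz := T.dualφ_surj c z.1 hz z rfl
  period := T.dualφ_eq_iff
  localDiffeo := T.localDiffeo_dualφ
  φ_zero c m hm := by
    have : (dotL (0 : Rn n)).comp (T.coord c m) = 0 := by
      ext v; simp [dotL_apply]
    simp only [dualφ]
    rw [this]
  trans := T.dualφ_trans

/-! ### The flat connection on `V` and the splitting of the tangent sequence of `Z` -/

/-- The flat (Gauss–Manin) connection `∇` on `V`, the one for which the local sections of the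
period lattice are flat: covariant derivative of the section `σ` at `m` in the direction `u`,
computed in the coordinates on `V` given by the local trivialization around `m`. -/
def nabla (σ : ∀ m, T.V m) (m : M) (u : TangentSpace (𝓡 n) m) : T.V m :=
  (T.coordEquiv m m (T.mem_U m)).symm
    (mfderiv (𝓡 n) 𝓘(ℝ, Rn n) (fun m' => T.coord m m' (σ m')) m u)

/-- The coordinates on `V^∨` dual to the coordinates `coord c` on `V`. -/
def coordDual (c m : M) (α : T.V m →L[ℝ] ℝ) : Rn n :=
  fun k => α ((T.coord c m).inverse (Pi.single k 1))

/-- The dual connection `∇^∨` on `V^∨`. -/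
def nablaDual (α : ∀ m, T.V m →L[ℝ] ℝ) (m : M) (u : TangentSpace (𝓡 n) m) : T.V m →L[ℝ] ℝ :=
  (dotL (mfderiv (𝓡 n) 𝓘(ℝ, Rn n) (fun m' => T.coordDual m m' (α m')) m u)).comp (T.coord m m)

/-- A coordinate vector of `z` in the local trivialization around `proj z`. -/
def fib (z : Z) : Rn n := (T.surj (T.proj z) z (T.mem_U _)).choose

theorem φ_fib (z : Z) : T.φ (T.proj z) (T.proj z, T.fib z) = z :=
  (T.surj (T.proj z) z (T.mem_U _)).choose_spec

/-- The differential at a preimage of `z` of the local trivialization around `proj z`. -/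
def dTriv (z : Z) : EuclideanSpace ℝ (Fin n) × Rn n →L[ℝ] EZ :=
  T.dφ (T.proj z) (T.proj z) (T.fib z)

/-- The map `j : p^* V → T_Z` given by the translations of the fibres. -/
def j (z : Z) : T.V (T.proj z) →L[ℝ] TangentSpace 𝓘(ℝ, EZ) z :=
  ((T.dTriv z).comp (ContinuousLinearMap.inr ℝ (EuclideanSpace ℝ (Fin n)) (Rn n))).comp
    (T.coord (T.proj z) (T.proj z))

/-- The horizontal lift `α : p^* T_M → T_Z`: the derivative of the local section of `Z` through `z`
that is constant in the local trivialization. -/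
def horLift (z : Z) : TangentSpace (𝓡 n) (T.proj z) →L[ℝ] TangentSpace 𝓘(ℝ, EZ) z :=
  (T.dTriv z).comp (ContinuousLinearMap.inl ℝ (EuclideanSpace ℝ (Fin n)) (Rn n))

/-- The vertical projection `D : T_Z → p^* V` defined by the connection. -/
def D (z : Z) : TangentSpace 𝓘(ℝ, EZ) z →L[ℝ] T.V (T.proj z) :=
  (T.coordEquiv (T.proj z) (T.proj z) (T.mem_U _)).symm.toContinuousLinearMap.comp
    ((ContinuousLinearMap.snd ℝ (EuclideanSpace ℝ (Fin n)) (Rn n)).comp (T.dTriv z).inverse)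

/-- The fibre of `V ⊕ T_M` at `m`. -/
abbrev VT (m : M) : Type _ := T.V m × TangentSpace (𝓡 n) m

/-- The isomorphism `F : T_Z ⊕ T_Z^∨ → p^*(V ⊕ T_M ⊕ V^∨ ⊕ T_M^∨)`, with components `D`, `dp`, `j^∨`
and `α^∨`. -/
def F (z : Z) : TT EZ z →ₗ[ℝ] Dbl (T.VT (T.proj z)) where
  toFun a := ((T.D z a.1, T.dproj z a.1), a.2.comp ((T.j z).coprod (T.horLift z)))
  map_add' _ _ := by ext <;> simp
  map_smul' _ _ := by ext <;> simp

/-- The inverse of `F`, with components `j + α` and `D^∨ + dp^∨`. -/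
def Finv (z : Z) : Dbl (T.VT (T.proj z)) →ₗ[ℝ] TT EZ z where
  toFun a := (T.j z a.1.1 + T.horLift z a.1.2, a.2.comp ((T.D z).prod (T.dproj z)))
  map_add' _ _ := by
    ext
    · simp; abel
    · simp
  map_smul' _ _ := by ext <;> simp

/-! ### Semi-flat generalized almost complex structures and their mirrors -/

/-- The endomorphism `F⁻¹ (p^* J̲) F` of `T_Z ⊕ T_Z^∨`. -/
def lift (Jb : ∀ m, Dbl (T.VT m) →ₗ[ℝ] Dbl (T.VT m)) (z : Z) : TT EZ z →ₗ[ℝ] TT EZ z :=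
  (T.Finv z).comp ((Jb (T.proj z)).comp (T.F z))

/-- Smooth local sections of `V ⊕ T_M`. A section of `V = s^* T_{Z/M}` is smooth if it is smooth as
a map to the tangent bundle of `Z`. -/
def SmoothVT [IsManifold (𝓡 n) ∞ M] [IsManifold 𝓘(ℝ, EZ) ∞ Z] (U : Set M)
    (σ : ∀ m, T.VT m) : Prop :=
  ContMDiffOn (𝓡 n) 𝓘(ℝ, EZ).tangent ∞
    (fun m => (⟨T.zero m, ((σ m).1 : TangentSpace 𝓘(ℝ, EZ) (T.zero m))⟩ :
      TangentBundle 𝓘(ℝ, EZ) Z)) U ∧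
  SmoothVF U (fun m => (σ m).2)

/-- `J` is the semi-flat generalized almost complex structure on `Z` coming from the generalized
almost complex structure `J̲` on `V ⊕ T_M`, where `J̲ (V ⊕ V^∨) = T_M ⊕ T_M^∨`. -/
structure IsSemiFlat [IsManifold (𝓡 n) ∞ M] [IsManifold 𝓘(ℝ, EZ) ∞ Z]
    (J : ∀ z : Z, TT EZ z →ₗ[ℝ] TT EZ z)
    (Jb : ∀ m, Dbl (T.VT m) →ₗ[ℝ] Dbl (T.VT m)) : Prop where
  genAlmostComplex : IsGenAlmostComplex (EuclideanSpace ℝ (Fin n)) T.SmoothVT Jb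
  adapted : ∀ m, (LinearMap.range (inclFst (T.V m) (TangentSpace (𝓡 n) m))).map (Jb m) =
    LinearMap.range (inclSnd (T.V m) (TangentSpace (𝓡 n) m))
  eq_lift : ∀ z, J z = T.lift Jb z

/-- The almost Dirac structure `Δ = J̲ (V) ⊆ J̲ (V ⊕ V^∨) = T_M ⊕ T_M^∨`, as a family of subspaces
of `T_M ⊕ T_M^∨`. -/
def Delta (Jb : ∀ m, Dbl (T.VT m) →ₗ[ℝ] Dbl (T.VT m)) (m : M) :
    Submodule ℝ (TT (EuclideanSpace ℝ (Fin n)) m) :=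
  ((LinearMap.range ((inclFst (T.V m) (TangentSpace (𝓡 n) m)).comp
    (LinearMap.inl ℝ (T.V m) (T.V m →L[ℝ] ℝ)))).map (Jb m)).comap
      (inclSnd (T.V m) (TangentSpace (𝓡 n) m))

/-- The almost Dirac structure `Δ^ = J̲ (V^∨) ⊆ J̲ (V ⊕ V^∨) = T_M ⊕ T_M^∨`, as a family of
subspaces of `T_M ⊕ T_M^∨`. -/
def DeltaHat (Jb : ∀ m, Dbl (T.VT m) →ₗ[ℝ] Dbl (T.VT m)) (m : M) :
    Submodule ℝ (TT (EuclideanSpace ℝ (Fin n)) m) :=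
  ((LinearMap.range ((inclFst (T.V m) (TangentSpace (𝓡 n) m)).comp
    (LinearMap.inr ℝ (T.V m) (T.V m →L[ℝ] ℝ)))).map (Jb m)).comap
      (inclSnd (T.V m) (TangentSpace (𝓡 n) m))

/-- The connection on `Δ` which corresponds to `∇` under `J̲ : V ≅ Δ` (recall `J̲⁻¹ = -J̲`). -/
def connDelta (Jb : ∀ m, Dbl (T.VT m) →ₗ[ℝ] Dbl (T.VT m))
    (a : ∀ m : M, TT (EuclideanSpace ℝ (Fin n)) m) (m : M) (u : TangentSpace (𝓡 n) m) :
    TT (EuclideanSpace ℝ (Fin n)) m :=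
  projSnd _ _ (Jb m (inclFst _ _
    (T.nabla (fun m' => (projFst _ _ (-(Jb m' (inclSnd _ _ (a m'))))).1) m u, 0)))

/-- The connection on `Δ^` which corresponds to `∇^∨` under `J̲ : V^∨ ≅ Δ^`. -/
def connDeltaHat (Jb : ∀ m, Dbl (T.VT m) →ₗ[ℝ] Dbl (T.VT m))
    (a : ∀ m : M, TT (EuclideanSpace ℝ (Fin n)) m) (m : M) (u : TangentSpace (𝓡 n) m) :
    TT (EuclideanSpace ℝ (Fin n)) m :=
  projSnd _ _ (Jb m (inclFst _ _
    (0, T.nablaDual (fun m' => (projFst _ _ (-(Jb m' (inclSnd _ _ (a m'))))).2) m u)))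

end TorusBundle

/-- Let `A` and `B` be in duality via coordinates: `⟨b, a⟩ = f(b) · e(a)`. Then this is the
duality transformation `A ⊕ P ⊕ A^∨ ⊕ P^∨ → B ⊕ P ⊕ B^∨ ⊕ P^∨` with `B = A^∨`, `B^∨ = A`, that
exchanges the components in `A` and `A^∨`. The inverse is `shuffle f e`. -/
def shuffle {n : ℕ} {A B P : Type*} [AddCommGroup A] [Module ℝ A] [TopologicalSpace A]
    [AddCommGroup B] [Module ℝ B] [TopologicalSpace B]
    [AddCommGroup P] [Module ℝ P] [TopologicalSpace P]
    (e : A ≃L[ℝ] Rn n) (f : B ≃L[ℝ] Rn n) : Dbl (A × P) →ₗ[ℝ] Dbl (B × P) where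
  toFun a := ((f.symm fun k => a.2 (e.symm (Pi.single k 1), 0), a.1.2),
    ((dotL (e a.1.1)).comp f.toContinuousLinearMap).coprod
      (a.2.comp (ContinuousLinearMap.inr ℝ A P)))
  map_add' a b := by
    refine Prod.ext (Prod.ext ?_ rfl) ?_
    · exact (map_add f.symm _ _)
    · ext x
      · simp [TorusBundle.dotL_apply, add_dotProduct]
      · simp
  map_smul' r a := by
    refine Prod.ext (Prod.ext ?_ rfl) ?_
    · exact (map_smul f.symm _ _)
    · ext x
      · simp [TorusBundle.dotL_apply, smul_dotProduct]
      · simp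

namespace TorusBundle

variable {n : ℕ} {M : Type*} [TopologicalSpace M] [ChartedSpace (EuclideanSpace ℝ (Fin n)) M]
  [IsManifold (𝓡 n) ∞ M]
  {EZ : Type*} [NormedAddCommGroup EZ] [NormedSpace ℝ EZ]
  {Z : Type*} [TopologicalSpace Z] [ChartedSpace EZ Z]
  (T : TorusBundle n M EZ Z)

/-- The generalized almost complex structure on `V^∨ ⊕ T_M` obtained from `J̲` by the duality
transformation along the fibres. Here `V^∨` is the bundle of vertical tangent spaces of the dual
torus bundle along its zero section; it is identified with the dual of `V` through the quotient map
`V^∨ → V^∨ / Λ^∨`, that is, by the coordinates of the corresponding local trivializations, which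
are dual to each other. -/
def mirrorBase (Jb : ∀ m, Dbl (T.VT m) →ₗ[ℝ] Dbl (T.VT m)) (m : M) :
    Dbl (T.dual.VT m) →ₗ[ℝ] Dbl (T.dual.VT m) :=
  (shuffle (T.coordEquiv m m (T.mem_U m)) (T.dual.coordEquiv m m (T.dual.mem_U m))).comp
    ((Jb m).comp
      (shuffle (T.dual.coordEquiv m m (T.dual.mem_U m)) (T.coordEquiv m m (T.mem_U m))))

/-- The mirror structure on the dual torus bundle. -/
def mirror (Jb : ∀ m, Dbl (T.VT m) →ₗ[ℝ] Dbl (T.VT m)) (z : T.DualTotal) :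
    TT (DualModel n) z →ₗ[ℝ] TT (DualModel n) z :=
  T.dual.lift (T.mirrorBase Jb) z

end TorusBundle

end TorusMirror

end

set_option linter.unusedSectionVars false

noncomputable section

namespace TorusMirror

/-! ### Smoothness of derivatives along smooth families of tangent vectors -/

section Derivatives

variable {E E' EP H H' HP : Type*}
  [NormedAddCommGroup E] [NormedSpace ℝ E] [NormedAddCommGroup E'] [NormedSpace ℝ E']
  [NormedAddCommGroup EP] [NormedSpace ℝ EP]
  [TopologicalSpace H] [TopologicalSpace H'] [TopologicalSpace HP]
  {I : ModelWithCorners ℝ E H} {I' : ModelWithCorners ℝ E' H'} {IP : ModelWithCorners ℝ EP HP}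
  {N N' P : Type*} [TopologicalSpace N] [ChartedSpace H N] [IsManifold I ∞ N]
  [TopologicalSpace N'] [ChartedSpace H' N'] [IsManifold I' ∞ N']
  [TopologicalSpace P] [ChartedSpace HP P]
  {f : N → N'} {g : P → N} {v : ∀ p, TangentSpace I (g p)} {p₀ : P}

/-! Linear algebra. Since `Jb` carries `V ⊕ V^∨` onto `T_M ⊕ T_M^∨`, it restricts to an isometry
`toTM` between them, and `J² = -1` makes `-Jb` the inverse `ofTM`. The summands `V` and `V^∨` are
maximally isotropic in `V ⊕ V^∨`, hence so are their images; a local frame of `V` gives a smooth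
frame of `Δ` (`isAlmostDirac_Delta`). In the coordinates on `V` given by any trivialization the
Gauss–Manin connection is componentwise differentiation, because the transition matrices are locally
constant (`coord_nabla`). Flatness is therefore `X (Y f) - Y (X f) = [X, Y] f`, transported by
`toTM` (`isFlatConnection_Delta`).

Duality. The transition matrices of the dual bundle are the inverse transposes, so the coordinates
on the two bundles pair independently of the trivialization (`inDuality_dual`). The exchange of `V`
and `V^∨` is then a smooth isometry fixing `T_M ⊕ T_M^∨`, and conjugation by it preserves
semi-flatness while swapping `Δ` with `Δ^` and `∇` with `∇^∨`. The first two items for `Δ^` are the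
corresponding items for the `Δ` of the mirror.

Integrability. Let `A` be the lift to `Z` of a section `a` of `T_M ⊕ T_M^∨`, and `A'` the lift of
`ofTM a`. Then `A + i A'` is a section of the `+i`-eigenbundle, and closure under the bracket gives
`J ([A, B'] + [A', B]) = [A, B] - [A', B']`. The tool is naturality: sections related by a smooth
map have related Courant brackets (`courant_related`). For sections of `Δ`, the lift `A'` is a
vertical field without one-form part, related to `0` by the projection `p`, while `A` is related to
`a`. Hence `[A, B'] + [A', B]` lies in `V` and the right side is related to `[a, b]`, so that `[a,
b]` lies in `J (V) = Δ`. For sections of `Δ^`, the lift `A'` is a one-form that kills horizontal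
vectors and is not in general a pullback from `M`. In place of `p` one uses the local section of `Z`
through the given point that is constant in a trivialization: it is tangent to the horizontal
distribution, relates `a` to `A`, and relates `0` to `A'`. So the mixed brackets lie in `V^∨`, and
`[a, b]` lies in `J (V^∨) = Δ^`. -/

theorem contMDiffAt_base
    (hv : ContMDiffAt IP I.tangent ∞ (fun p => (⟨g p, v p⟩ : TangentBundle I N)) p₀) :
    ContMDiffAt IP I ∞ g p₀ :=
  (Bundle.contMDiffAt_totalSpace.1 hv).1

/-- The vectors form a family along an arbitrary map `g`. This covers at once vector fields,
vertical vectors along the zero section, and vectors at points that move with parameters. -/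
theorem contMDiffAt_tangentMap (hf : ContMDiffAt I I' ∞ f (g p₀))
    (hv : ContMDiffAt IP I.tangent ∞ (fun p => (⟨g p, v p⟩ : TangentBundle I N)) p₀) :
    ContMDiffAt IP I'.tangent ∞
      (fun p => (⟨f (g p), mfderiv I I' f (g p) (v p)⟩ : TangentBundle I' N')) p₀ := by
  have hg := contMDiffAt_base hv
  have h1 := hf.mfderiv_const (m := ∞) (by simp)
  exact ContMDiffAt.clm_apply_of_inCoordinates
    (ϕ := fun p => mfderiv I I' f (g p)) (h1.comp p₀ hg) hv (hf.comp p₀ hg)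

theorem contMDiffAt_vectorSpace {g : P → E} {v : P → E} :
    ContMDiffAt IP 𝓘(ℝ, E).tangent ∞ (fun p => (⟨g p, v p⟩ : TangentBundle 𝓘(ℝ, E) E)) p₀ ↔
      ContMDiffAt IP 𝓘(ℝ, E) ∞ g p₀ ∧ ContMDiffAt IP 𝓘(ℝ, E) ∞ v p₀ := by
  rw [Bundle.contMDiffAt_totalSpace]
  simp

theorem contMDiffAt_mfderiv_apply {f : N → E'} (hf : ContMDiffAt I 𝓘(ℝ, E') ∞ f (g p₀))
    (hv : ContMDiffAt IP I.tangent ∞ (fun p => (⟨g p, v p⟩ : TangentBundle I N)) p₀) :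
    ContMDiffAt IP 𝓘(ℝ, E') ∞ (fun p => (show E' from mfderiv I 𝓘(ℝ, E') f (g p) (v p))) p₀ :=
  (contMDiffAt_vectorSpace.1 (contMDiffAt_tangentMap hf hv)).2

/-- The order is first lowered to 1: for order `∞` at a point, the neighbourhoods on which `C^k`
holds may shrink with `k`. -/
theorem ContMDiffAt.eventually_mdifferentiableAt {f : N → N'} {x : N}
    (hf : ContMDiffAt I I' ∞ f x) : ∀ᶠ y in 𝓝 x, MDifferentiableAt I I' f y := by
  have h1 : ContMDiffAt I I' 1 f x := hf.of_le (by simp)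
  filter_upwards [(contMDiffAt_iff_contMDiffAt_nhds (by simp)).1 h1] with y hy
    using hy.mdifferentiableAt (by simp)

end Derivatives

/-- With a basis of the finite-dimensional source, a family of linear maps is the tuple of its
values on the basis vectors. -/
theorem contDiffAt_clm_apply {D E F : Type*} [NormedAddCommGroup D] [NormedSpace ℝ D]
    [NormedAddCommGroup E] [NormedSpace ℝ E] [NormedAddCommGroup F] [NormedSpace ℝ F]
    [FiniteDimensional ℝ E] {f : D → E →L[ℝ] F} {x : D}
    (h : ∀ w, ContDiffAt ℝ ∞ (fun y => f y w) x) :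
    ContDiffAt ℝ ∞ f x := by
  have hd : Module.finrank ℝ E = Module.finrank ℝ (Fin (Module.finrank ℝ E) → ℝ) := by simp
  let e₁ := ContinuousLinearEquiv.ofFinrankEq hd
  let e₂ := (e₁.arrowCongr (1 : F ≃L[ℝ] F)).trans
    (ContinuousLinearEquiv.piRing (Fin (Module.finrank ℝ E)))
  rw [← e₂.comp_contDiffAt_iff, contDiffAt_pi]
  exact fun i => h _

/-! ### Vector fields and one-forms in charts -/

section Charts

variable {E : Type*} [NormedAddCommGroup E] [NormedSpace ℝ E]
  {N : Type*} [TopologicalSpace N] [ChartedSpace E N] [IsManifold 𝓘(ℝ, E) ∞ N]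

theorem smoothVF_iff {U : Set N} (hU : IsOpen U) {X : ∀ x : N, TangentSpace 𝓘(ℝ, E) x} :
    SmoothVF U X ↔ ∀ x ∈ U, ContMDiffAt 𝓘(ℝ, E) 𝓘(ℝ, E).tangent ∞
      (fun x => (⟨x, X x⟩ : TangentBundle 𝓘(ℝ, E) N)) x :=
  ⟨fun h x hx => (h x hx).contMDiffAt (hU.mem_nhds hx), fun h x hx => (h x hx).contMDiffWithinAt⟩

theorem mfderiv_symm_comp_extChartAt (x₀ : N) {y : E} (hy : y ∈ (extChartAt 𝓘(ℝ, E) x₀).target)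
    (w : E) :
    mfderiv 𝓘(ℝ, E) 𝓘(ℝ, E) (extChartAt 𝓘(ℝ, E) x₀) ((extChartAt 𝓘(ℝ, E) x₀).symm y)
      (mfderiv 𝓘(ℝ, E) 𝓘(ℝ, E) (extChartAt 𝓘(ℝ, E) x₀).symm y w) = w := by
  have h := mfderiv_extChartAt_comp_mfderivWithin_extChartAt_symm (I := 𝓘(ℝ, E)) hy
  rw [ModelWithCorners.range_eq_univ, mfderivWithin_univ] at h
  exact DFunLike.congr_fun h w

theorem mfderiv_extChartAt_comp_symm (x₀ : N) {x : N} (hx : x ∈ (extChartAt 𝓘(ℝ, E) x₀).source)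
    (w : TangentSpace 𝓘(ℝ, E) x) :
    mfderiv 𝓘(ℝ, E) 𝓘(ℝ, E) (extChartAt 𝓘(ℝ, E) x₀).symm (extChartAt 𝓘(ℝ, E) x₀ x)
      (mfderiv 𝓘(ℝ, E) 𝓘(ℝ, E) (extChartAt 𝓘(ℝ, E) x₀) x w) = w := by
  have h := mfderivWithin_extChartAt_symm_comp_mfderiv_extChartAt' (I := 𝓘(ℝ, E)) hx
  rw [ModelWithCorners.range_eq_univ, mfderivWithin_univ] at h
  exact DFunLike.congr_fun h w

/-- The pullback is defined by inverting the differential of the inverse chart; on the chart target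
that inverse is the differential of the chart itself, which depends smoothly on the point. -/
theorem vfInChart_eq (x₀ : N) (X : ∀ x : N, TangentSpace 𝓘(ℝ, E) x) {y : E}
    (hy : y ∈ (extChartAt 𝓘(ℝ, E) x₀).target) :
    vfInChart x₀ X y = mfderiv 𝓘(ℝ, E) 𝓘(ℝ, E) (extChartAt 𝓘(ℝ, E) x₀)
      ((extChartAt 𝓘(ℝ, E) x₀).symm y) (X ((extChartAt 𝓘(ℝ, E) x₀).symm y)) := by
  have h := isInvertible_mfderivWithin_extChartAt_symm (I := 𝓘(ℝ, E)) hy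
  rw [ModelWithCorners.range_eq_univ, mfderivWithin_univ] at h
  obtain ⟨e, he⟩ := h
  rw [vfInChart, VectorField.mpullback_apply, ← he, ContinuousLinearMap.inverse_equiv]
  have h1 := mfderiv_symm_comp_extChartAt x₀ hy
    (show E from e.symm (X ((extChartAt 𝓘(ℝ, E) x₀).symm y)))
  rw [← he] at h1
  refine h1.symm.trans ?_
  congr 1
  exact e.apply_symm_apply _

theorem mfderiv_symm_vfInChart (x₀ : N) (X : ∀ x : N, TangentSpace 𝓘(ℝ, E) x) {y : E}
    (hy : y ∈ (extChartAt 𝓘(ℝ, E) x₀).target) :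
    mfderiv 𝓘(ℝ, E) 𝓘(ℝ, E) (extChartAt 𝓘(ℝ, E) x₀).symm y (vfInChart (E := E) x₀ X y) =
      X ((extChartAt 𝓘(ℝ, E) x₀).symm y) := by
  rw [vfInChart_eq x₀ X hy]
  have h := mfderiv_extChartAt_comp_symm x₀ ((extChartAt 𝓘(ℝ, E) x₀).map_target hy)
    (X ((extChartAt 𝓘(ℝ, E) x₀).symm y))
  rw [(extChartAt 𝓘(ℝ, E) x₀).right_inv hy] at h
  exact h

theorem extChartAt_target_mem_nhds_self (x : N) :
    (extChartAt 𝓘(ℝ, E) x).target ∈ 𝓝 (extChartAt 𝓘(ℝ, E) x x) :=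
  extChartAt_target_mem_nhds x

theorem contMDiffAt_symm (x : N) :
    ContMDiffAt 𝓘(ℝ, E) 𝓘(ℝ, E) ∞ (extChartAt 𝓘(ℝ, E) x).symm (extChartAt 𝓘(ℝ, E) x x) :=
  (contMDiffOn_extChartAt_symm x).contMDiffAt (extChartAt_target_mem_nhds_self x)

theorem contDiffAt_vfInChart {X : ∀ x : N, TangentSpace 𝓘(ℝ, E) x} {x : N}
    (hX : ContMDiffAt 𝓘(ℝ, E) 𝓘(ℝ, E).tangent ∞
      (fun x => (⟨x, X x⟩ : TangentBundle 𝓘(ℝ, E) N)) x) :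
    ContDiffAt ℝ ∞ (vfInChart x X) (extChartAt 𝓘(ℝ, E) x x) := by
  have h0 : (extChartAt 𝓘(ℝ, E) x).symm (extChartAt 𝓘(ℝ, E) x x) = x := extChartAt_to_inv x
  have h1 : ContMDiffAt 𝓘(ℝ, E) 𝓘(ℝ, E).tangent ∞
      (fun y => (⟨(extChartAt 𝓘(ℝ, E) x).symm y, X ((extChartAt 𝓘(ℝ, E) x).symm y)⟩ :
        TangentBundle 𝓘(ℝ, E) N)) (extChartAt 𝓘(ℝ, E) x x) :=
    ContMDiffAt.comp (g := fun x => (⟨x, X x⟩ : TangentBundle 𝓘(ℝ, E) N)) _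
      (by rw [h0]; exact hX) (contMDiffAt_symm x)
  have h2 : ContMDiffAt 𝓘(ℝ, E) 𝓘(ℝ, E) ∞ (extChartAt 𝓘(ℝ, E) x)
      ((extChartAt 𝓘(ℝ, E) x).symm (extChartAt 𝓘(ℝ, E) x x)) := by
    rw [h0]; exact contMDiffAt_extChartAt
  have h3 := (contMDiffAt_mfderiv_apply h2 h1).contDiffAt
  refine h3.congr_of_eventuallyEq ?_
  filter_upwards [extChartAt_target_mem_nhds_self x] with y hy using vfInChart_eq x X hy

/-- The vector field which is constant in the preferred chart at `x₀`. -/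
def chartVF (x₀ : N) (w : E) (x : N) : TangentSpace 𝓘(ℝ, E) x :=
  mfderiv 𝓘(ℝ, E) 𝓘(ℝ, E) (extChartAt 𝓘(ℝ, E) x₀).symm (extChartAt 𝓘(ℝ, E) x₀ x) w

theorem isOpen_chartDomain (x₀ : N) : IsOpen (extChartAt 𝓘(ℝ, E) x₀).source :=
  isOpen_extChartAt_source x₀

theorem smoothVF_chartVF (x₀ : N) (w : E) :
    SmoothVF (extChartAt 𝓘(ℝ, E) x₀).source (chartVF x₀ w) := by
  rw [smoothVF_iff (isOpen_chartDomain x₀)]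
  intro x hx
  have h1 : ContMDiffAt 𝓘(ℝ, E) 𝓘(ℝ, E) ∞ (extChartAt 𝓘(ℝ, E) x₀) x :=
    contMDiffAt_extChartAt' (by simpa using hx)
  have h2 : ContMDiffAt 𝓘(ℝ, E) 𝓘(ℝ, E) ∞ (extChartAt 𝓘(ℝ, E) x₀).symm
      (extChartAt 𝓘(ℝ, E) x₀ x) :=
    (contMDiffOn_extChartAt_symm x₀).contMDiffAt
      (extChartAt_target_mem_nhds' ((extChartAt 𝓘(ℝ, E) x₀).map_source hx))
  have h3 := contMDiffAt_tangentMap (v := fun _ => w) h2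
    (contMDiffAt_vectorSpace.2 ⟨h1, contMDiffAt_const⟩)
  refine h3.congr_of_eventuallyEq ?_
  filter_upwards [(isOpen_chartDomain x₀).mem_nhds hx] with y hy
  rw [chartVF]
  -- The vector is the same element of `E` on both sides; only the base points `y` and its image
  -- under chart and inverse chart have to be identified.
  generalize hg : mfderiv 𝓘(ℝ, E) 𝓘(ℝ, E) (extChartAt 𝓘(ℝ, E) x₀).symm
    (extChartAt 𝓘(ℝ, E) x₀ y) w = u
  change (⟨y, u⟩ : TangentBundle 𝓘(ℝ, E) N) = ⟨(extChartAt 𝓘(ℝ, E) x₀).symm _, u⟩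
  congr 1
  exact ((extChartAt 𝓘(ℝ, E) x₀).left_inv hy).symm

/-- Smoothness of a one-form is given only through its values on smooth fields. The fields constant
in the chart turn it into smoothness of each coefficient, which suffices in finite dimension. -/
theorem contDiffAt_formInChart [FiniteDimensional ℝ E] {U : Set N} (hU : IsOpen U)
    {ξ : ∀ x : N, TangentSpace 𝓘(ℝ, E) x →L[ℝ] ℝ}
    (hξ : SmoothDual E (SmoothVF (E := E) (N := N)) U ξ) {x : N} (hx : x ∈ U) :
    ContDiffAt ℝ ∞ (formInChart x ξ) (extChartAt 𝓘(ℝ, E) x x) := by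
  have h0 : (extChartAt 𝓘(ℝ, E) x).symm (extChartAt 𝓘(ℝ, E) x x) = x := extChartAt_to_inv x
  have key : ∀ w : E, ContDiffAt ℝ ∞ (fun y => formInChart x ξ y w)
      (extChartAt 𝓘(ℝ, E) x x) := by
    intro w
    have hV : IsOpen (U ∩ (extChartAt 𝓘(ℝ, E) x).source) := hU.inter (isOpen_chartDomain x)
    have h1 := hξ _ hV inter_subset_left (chartVF x w)
      ((smoothVF_chartVF x w).mono inter_subset_right)
    have h2 : ContMDiffAt 𝓘(ℝ, E) 𝓘(ℝ, ℝ) ∞ (fun x' => ξ x' (chartVF x w x')) x :=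
      h1.contMDiffAt (hV.mem_nhds ⟨hx, mem_extChartAt_source x⟩)
    have h3 := (ContMDiffAt.comp (extChartAt 𝓘(ℝ, E) x x)
      (by rw [h0]; exact h2) (contMDiffAt_symm x)).contDiffAt
    refine h3.congr_of_eventuallyEq ?_
    filter_upwards [extChartAt_target_mem_nhds_self x] with y hy
    change formInChart x ξ y w = ξ ((extChartAt 𝓘(ℝ, E) x).symm y)
      (mfderiv 𝓘(ℝ, E) 𝓘(ℝ, E) (extChartAt 𝓘(ℝ, E) x).symm
      (extChartAt 𝓘(ℝ, E) x ((extChartAt 𝓘(ℝ, E) x).symm y)) w)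
    rw [(extChartAt 𝓘(ℝ, E) x).right_inv hy]
    rfl
  exact contDiffAt_clm_apply key

end Charts

/-! ### The Courant bracket of related sections: vector spaces -/

section RelatedVectorSpace

variable {E E' : Type*} [NormedAddCommGroup E] [NormedSpace ℝ E]
  [NormedAddCommGroup E'] [NormedSpace ℝ E'] {G : E → E'} {y : E}
  {X Y : E → E} {X' Y' : E' → E'} {ξ η : E → E →L[ℝ] ℝ} {ξ' η' : E' → E' →L[ℝ] ℝ}

/-- This is the derivative of the relation `DG · X = X' ∘ G` in the direction `w`. The relation has
to hold near the point, since it is differentiated. -/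
theorem fderiv_related (hG : ContDiffAt ℝ 2 G y) (hX : DifferentiableAt ℝ X y)
    (hX' : DifferentiableAt ℝ X' (G y)) (h : ∀ᶠ z in 𝓝 y, fderiv ℝ G z (X z) = X' (G z)) (w : E) :
    fderiv ℝ (fderiv ℝ G) y w (X y) + fderiv ℝ G y (fderiv ℝ X y w) =
      fderiv ℝ X' (G y) (fderiv ℝ G y w) := by
  have hG1 : DifferentiableAt ℝ G y := hG.differentiableAt (by simp)
  have hG2 : DifferentiableAt ℝ (fderiv ℝ G) y :=
    (hG.fderiv_right (m := 1) (by norm_num [one_add_one_eq_two])).differentiableAt (by simp)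
  have h1 : fderiv ℝ (fun z => fderiv ℝ G z (X z)) y = fderiv ℝ (fun z => X' (G z)) y :=
    EventuallyEq.fderiv_eq h
  have h2 := DFunLike.congr_fun h1 w
  rw [fderiv_clm_apply hG2 hX] at h2
  have h3 : fderiv ℝ (fun z => X' (G z)) y = (fderiv ℝ X' (G y)).comp (fderiv ℝ G y) :=
    fderiv_comp y hX' hG1
  rw [h3] at h2
  simp only [add_apply, ContinuousLinearMap.comp_apply,
    ContinuousLinearMap.flip_apply] at h2
  rw [add_comm]
  exact h2

theorem fderiv_fderiv_symm (hG : ContDiffAt ℝ 2 G y) (v w : E) :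
    fderiv ℝ (fderiv ℝ G) y v w = fderiv ℝ (fderiv ℝ G) y w v :=
  (hG.isSymmSndFDerivAt (by simp)) v w

/-- Two instances of `fderiv_related` are subtracted; the terms in the second derivative of `G`
cancel by its symmetry. -/
theorem lieBracket_related (hG : ContDiffAt ℝ 2 G y) (hX : DifferentiableAt ℝ X y)
    (hY : DifferentiableAt ℝ Y y) (hX' : DifferentiableAt ℝ X' (G y))
    (hY' : DifferentiableAt ℝ Y' (G y)) (h : ∀ᶠ z in 𝓝 y, fderiv ℝ G z (X z) = X' (G z))
    (h' : ∀ᶠ z in 𝓝 y, fderiv ℝ G z (Y z) = Y' (G z)) :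
    fderiv ℝ G y (VectorField.lieBracket ℝ X Y y) = VectorField.lieBracket ℝ X' Y' (G y) := by
  have h1 := fderiv_related hG hX hX' h (Y y)
  have h2 := fderiv_related hG hY hY' h' (X y)
  rw [VectorField.lieBracket, VectorField.lieBracket, map_sub, ← h.self_of_nhds,
    ← h'.self_of_nhds, ← h1, ← h2, fderiv_fderiv_symm hG (Y y) (X y)]
  abel

/-- Differentiating `η = η' ∘ DG` leaves the extra term `η' (D²G (X, w))`. By symmetry of `D²G` it
combines with `η' (DG (DX · w))` to `η' (DX' (DG · w))`, again by `fderiv_related`. -/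
theorem lieForm_related (hG : ContDiffAt ℝ 2 G y) (hX : DifferentiableAt ℝ X y)
    (hX' : DifferentiableAt ℝ X' (G y))
    (hη' : DifferentiableAt ℝ η' (G y)) (h : ∀ᶠ z in 𝓝 y, fderiv ℝ G z (X z) = X' (G z))
    (h' : ∀ᶠ z in 𝓝 y, η z = (η' (G z)).comp (fderiv ℝ G z)) :
    lieForm X η y = (lieForm X' η' (G y)).comp (fderiv ℝ G y) := by
  have hG1 : DifferentiableAt ℝ G y := hG.differentiableAt (by simp)
  have hG2 : DifferentiableAt ℝ (fderiv ℝ G) y :=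
    (hG.fderiv_right (m := 1) (by norm_num [one_add_one_eq_two])).differentiableAt (by simp)
  have h1 : fderiv ℝ η y = fderiv ℝ (fun z => (η' (G z)).comp (fderiv ℝ G z)) y :=
    EventuallyEq.fderiv_eq h'
  have h2 : DifferentiableAt ℝ (fun z => η' (G z)) y := hη'.comp y hG1
  have h3 : fderiv ℝ (fun z => η' (G z)) y = (fderiv ℝ η' (G y)).comp (fderiv ℝ G y) :=
    fderiv_comp y hη' hG1
  ext w
  have h4 := fderiv_related hG hX hX' h w
  rw [fderiv_clm_comp h2 hG2, h3] at h1
  simp only [lieForm, h1, h'.self_of_nhds, ← h.self_of_nhds, add_apply,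
    ContinuousLinearMap.comp_apply, ContinuousLinearMap.compL_apply,
    ContinuousLinearMap.flip_apply, ← h4, map_add, fderiv_fderiv_symm hG (X y) w]
  ring

/-- Beyond the Lie derivatives there is only an exact term, the differential of the function `ι_Y ξ
- ι_X η`, and this function is the pullback of its counterpart on the target. -/
theorem courantForm_related (hG : ContDiffAt ℝ 2 G y) (hX : DifferentiableAt ℝ X y)
    (hY : DifferentiableAt ℝ Y y) (hX' : DifferentiableAt ℝ X' (G y))
    (hY' : DifferentiableAt ℝ Y' (G y)) (hξ' : DifferentiableAt ℝ ξ' (G y))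
    (hη' : DifferentiableAt ℝ η' (G y)) (h1 : ∀ᶠ z in 𝓝 y, fderiv ℝ G z (X z) = X' (G z))
    (h2 : ∀ᶠ z in 𝓝 y, fderiv ℝ G z (Y z) = Y' (G z))
    (h3 : ∀ᶠ z in 𝓝 y, ξ z = (ξ' (G z)).comp (fderiv ℝ G z))
    (h4 : ∀ᶠ z in 𝓝 y, η z = (η' (G z)).comp (fderiv ℝ G z)) :
    courantForm X ξ Y η y = (courantForm X' ξ' Y' η' (G y)).comp (fderiv ℝ G y) := by
  have hG1 : DifferentiableAt ℝ G y := hG.differentiableAt (by simp)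
  have h5 : fderiv ℝ (fun z => ξ z (Y z) - η z (X z)) y =
      (fderiv ℝ (fun z => ξ' z (Y' z) - η' z (X' z)) (G y)).comp (fderiv ℝ G y) := by
    have h6 : (fun z => ξ z (Y z) - η z (X z)) =ᶠ[𝓝 y]
        (fun z => ξ' z (Y' z) - η' z (X' z)) ∘ G := by
      filter_upwards [h1, h2, h3, h4] with z z1 z2 z3 z4
      simp [z3, z4, z1, z2]
    rw [h6.fderiv_eq]
    exact fderiv_comp y ((hξ'.clm_apply hY').sub (hη'.clm_apply hX')) hG1
  rw [courantForm, courantForm, lieForm_related hG hX hX' hη' h1 h4,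
    lieForm_related hG hY hY' hξ' h2 h3, h5]
  ext w
  simp

end RelatedVectorSpace

/-! ### The Courant bracket of related sections: manifolds -/

section Related

variable {E E' : Type*} [NormedAddCommGroup E] [NormedSpace ℝ E]
  [NormedAddCommGroup E'] [NormedSpace ℝ E']
  {N : Type*} [TopologicalSpace N] [ChartedSpace E N] [IsManifold 𝓘(ℝ, E) ∞ N]
  {N' : Type*} [TopologicalSpace N'] [ChartedSpace E' N'] [IsManifold 𝓘(ℝ, E') ∞ N']

theorem mlieBracket_eq (X Y : ∀ x : N, TangentSpace 𝓘(ℝ, E) x) (x : N) :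
    mfderiv 𝓘(ℝ, E) 𝓘(ℝ, E) (extChartAt 𝓘(ℝ, E) x) x (VectorField.mlieBracket 𝓘(ℝ, E) X Y x) =
      VectorField.lieBracket ℝ (vfInChart x X) (vfInChart x Y) (extChartAt 𝓘(ℝ, E) x x) := by
  obtain ⟨e, he⟩ := isInvertible_mfderiv_extChartAt (I := 𝓘(ℝ, E)) (mem_extChartAt_source x)
  rw [VectorField.mlieBracket, VectorField.mlieBracketWithin_apply, ← he,
    ContinuousLinearMap.inverse_equiv]
  refine (e.apply_symm_apply _).trans ?_
  rw [ModelWithCorners.range_eq_univ, preimage_univ, univ_inter,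
    VectorField.mpullbackWithin_univ, VectorField.mpullbackWithin_univ]
  exact congrFun (VectorField.lieBracketWithin_univ (𝕜 := ℝ) (V := vfInChart x X)
    (W := vfInChart x Y)) _

/-! ### Smooth maps and related sections in the preferred charts -/

variable {G : N → N'} {x : N}

/-- A map between manifolds in the preferred charts at a point and its image. -/
def inCharts (G : N → N') (x : N) (y : E) : E' :=
  extChartAt 𝓘(ℝ, E') (G x) (G ((extChartAt 𝓘(ℝ, E) x).symm y))

theorem inCharts_self : inCharts (E := E) (E' := E') G x (extChartAt 𝓘(ℝ, E) x x) =
    extChartAt 𝓘(ℝ, E') (G x) (G x) := by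
  rw [inCharts, extChartAt_to_inv]

theorem eventually_of_symm {p : N → Prop} (h : ∀ᶠ y in 𝓝 x, p y) :
    ∀ᶠ z in 𝓝 (extChartAt 𝓘(ℝ, E) x x), p ((extChartAt 𝓘(ℝ, E) x).symm z) := by
  have hc : ContinuousAt (extChartAt 𝓘(ℝ, E) x).symm (extChartAt 𝓘(ℝ, E) x x) :=
    continuousAt_extChartAt_symm x
  refine hc.eventually ?_
  rw [extChartAt_to_inv]
  exact h

theorem contDiffAt_inCharts (hG : ContMDiffAt 𝓘(ℝ, E) 𝓘(ℝ, E') ∞ G x) :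
    ContDiffAt ℝ ∞ (inCharts (E := E) (E' := E') G x) (extChartAt 𝓘(ℝ, E) x x) := by
  have h := (contMDiffAt_iff.1 hG).2
  rw [ModelWithCorners.range_eq_univ, contDiffWithinAt_univ] at h
  exact h

theorem eventually_mem_chart (hG : ContMDiffAt 𝓘(ℝ, E) 𝓘(ℝ, E') ∞ G x) :
    ∀ᶠ z in 𝓝 (extChartAt 𝓘(ℝ, E) x x),
      G ((extChartAt 𝓘(ℝ, E) x).symm z) ∈ (extChartAt 𝓘(ℝ, E') (G x)).source :=
  eventually_of_symm (E := E) (hG.continuousAt.eventually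
    ((isOpen_chartDomain (E := E') (G x)).mem_nhds (mem_extChartAt_source (G x))))

theorem fderiv_inCharts (hG : ContMDiffAt 𝓘(ℝ, E) 𝓘(ℝ, E') ∞ G x) :
    ∀ᶠ z in 𝓝 (extChartAt 𝓘(ℝ, E) x x), ∀ w : E,
      fderiv ℝ (inCharts (E := E) (E' := E') G x) z w =
        mfderiv 𝓘(ℝ, E') 𝓘(ℝ, E') (extChartAt 𝓘(ℝ, E') (G x))
          (G ((extChartAt 𝓘(ℝ, E) x).symm z))
        (mfderiv 𝓘(ℝ, E) 𝓘(ℝ, E') G ((extChartAt 𝓘(ℝ, E) x).symm z)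
          (mfderiv 𝓘(ℝ, E) 𝓘(ℝ, E) (extChartAt 𝓘(ℝ, E) x).symm z w)) := by
  have h1 := eventually_of_symm (E := E) (ContMDiffAt.eventually_mdifferentiableAt hG)
  filter_upwards [h1, eventually_mem_chart hG, extChartAt_target_mem_nhds_self x]
    with z z1 z2 z3 w
  have d1 : MDifferentiableAt 𝓘(ℝ, E) 𝓘(ℝ, E) (extChartAt 𝓘(ℝ, E) x).symm z := by
    have := mdifferentiableWithinAt_extChartAt_symm (I := 𝓘(ℝ, E)) z3
    rwa [ModelWithCorners.range_eq_univ, mdifferentiableWithinAt_univ] at this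
  have d2 : MDifferentiableAt 𝓘(ℝ, E') 𝓘(ℝ, E') (extChartAt 𝓘(ℝ, E') (G x))
      (G ((extChartAt 𝓘(ℝ, E) x).symm z)) :=
    mdifferentiableAt_extChartAt (by rw [← extChartAt_source 𝓘(ℝ, E')]; exact z2)
  rw [← mfderiv_eq_fderiv]
  have h := (d2.hasMFDerivAt.comp z (z1.hasMFDerivAt.comp z d1.hasMFDerivAt)).mfderiv
  exact DFunLike.congr_fun h w

theorem fderiv_inCharts_vfInChart (hG : ContMDiffAt 𝓘(ℝ, E) 𝓘(ℝ, E') ∞ G x)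
    {X : ∀ x : N, TangentSpace 𝓘(ℝ, E) x} {X' : ∀ x : N', TangentSpace 𝓘(ℝ, E') x}
    (h : ∀ᶠ y in 𝓝 x, mfderiv 𝓘(ℝ, E) 𝓘(ℝ, E') G y (X y) = X' (G y)) :
    ∀ᶠ z in 𝓝 (extChartAt 𝓘(ℝ, E) x x),
      fderiv ℝ (inCharts (E := E) (E' := E') G x) z (vfInChart x X z) =
        vfInChart (G x) X' (inCharts (E := E) (E' := E') G x z) := by
  filter_upwards [fderiv_inCharts hG, eventually_of_symm (E := E) h, eventually_mem_chart hG,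
    extChartAt_target_mem_nhds_self x] with z z1 z2 z3 z4
  have e1 := vfInChart_eq (G x) X' ((extChartAt 𝓘(ℝ, E') (G x)).map_source z3)
  rw [(extChartAt 𝓘(ℝ, E') (G x)).left_inv z3, ← z2, ← mfderiv_symm_vfInChart x X z4] at e1
  exact (z1 _).trans e1.symm

theorem formInChart_apply (x₀ : N) (ξ : ∀ x : N, TangentSpace 𝓘(ℝ, E) x →L[ℝ] ℝ) (y w : E) :
    formInChart x₀ ξ y w = ξ ((extChartAt 𝓘(ℝ, E) x₀).symm y)
      (mfderiv 𝓘(ℝ, E) 𝓘(ℝ, E) (extChartAt 𝓘(ℝ, E) x₀).symm y w) := rfl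

theorem formInChart_inCharts (hG : ContMDiffAt 𝓘(ℝ, E) 𝓘(ℝ, E') ∞ G x)
    {ξ : ∀ x : N, TangentSpace 𝓘(ℝ, E) x →L[ℝ] ℝ} {ξ' : ∀ x : N', TangentSpace 𝓘(ℝ, E') x →L[ℝ] ℝ}
    (h : ∀ᶠ y in 𝓝 x, ∀ u, ξ y u = ξ' (G y) (mfderiv 𝓘(ℝ, E) 𝓘(ℝ, E') G y u)) :
    ∀ᶠ z in 𝓝 (extChartAt 𝓘(ℝ, E) x x), formInChart x ξ z =
      (formInChart (G x) ξ' (inCharts (E := E) (E' := E') G x z)).comp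
        (fderiv ℝ (inCharts (E := E) (E' := E') G x) z) := by
  filter_upwards [fderiv_inCharts hG, eventually_of_symm (E := E) h, eventually_mem_chart hG]
    with z z1 z2 z3
  ext w
  rw [ContinuousLinearMap.comp_apply, formInChart_apply, formInChart_apply, z2, z1]
  have e2 := mfderiv_extChartAt_comp_symm (G x) z3
    (mfderiv 𝓘(ℝ, E) 𝓘(ℝ, E') G ((extChartAt 𝓘(ℝ, E) x).symm z)
        (mfderiv 𝓘(ℝ, E) 𝓘(ℝ, E) (extChartAt 𝓘(ℝ, E) x).symm z w))
  have e3 := (extChartAt 𝓘(ℝ, E') (G x)).left_inv z3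
  -- `e3` identifies the base point at which `formInChart` evaluates `ξ'` with the image of the
  -- source point; `ξ'` is transported along it.
  have e4 : ∀ (m : N') (u : E'), m = G ((extChartAt 𝓘(ℝ, E) x).symm z) →
      ξ' (G ((extChartAt 𝓘(ℝ, E) x).symm z)) u = ξ' m u := by
    rintro m u rfl; rfl
  exact (congrArg (ξ' (G ((extChartAt 𝓘(ℝ, E) x).symm z))) e2).symm.trans (e4 _ _ e3)

theorem mfderiv_extChartAt_injective (x : N) {v w : TangentSpace 𝓘(ℝ, E) x}
    (h : mfderiv 𝓘(ℝ, E) 𝓘(ℝ, E) (extChartAt 𝓘(ℝ, E) x) x v =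
      mfderiv 𝓘(ℝ, E) 𝓘(ℝ, E) (extChartAt 𝓘(ℝ, E) x) x w) : v = w := by
  have h1 := mfderiv_extChartAt_comp_symm x (mem_extChartAt_source x) v
  have h2 := mfderiv_extChartAt_comp_symm x (mem_extChartAt_source x) w
  rw [← h1, ← h2, h]

theorem fderiv_inCharts_self (hG : ContMDiffAt 𝓘(ℝ, E) 𝓘(ℝ, E') ∞ G x)
    (u : TangentSpace 𝓘(ℝ, E) x) :
    fderiv ℝ (inCharts (E := E) (E' := E') G x) (extChartAt 𝓘(ℝ, E) x x)
      (mfderiv 𝓘(ℝ, E) 𝓘(ℝ, E) (extChartAt 𝓘(ℝ, E) x) x u) =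
    mfderiv 𝓘(ℝ, E') 𝓘(ℝ, E') (extChartAt 𝓘(ℝ, E') (G x)) (G x)
      (mfderiv 𝓘(ℝ, E) 𝓘(ℝ, E') G x u) := by
  have h := (fderiv_inCharts hG).self_of_nhds
    (mfderiv 𝓘(ℝ, E) 𝓘(ℝ, E) (extChartAt 𝓘(ℝ, E) x) x u)
  rw [mfderiv_extChartAt_comp_symm x (mem_extChartAt_source x) u, extChartAt_to_inv] at h
  exact h

/-- Sections of `T ⊕ T^∨` on the source and the target of `G` that are related by `G`. -/
def RelatedAt (G : N → N') (x : N) (a : ∀ x : N, TT E x) (a' : ∀ x : N', TT E' x) : Prop :=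
  mfderiv 𝓘(ℝ, E) 𝓘(ℝ, E') G x (a x).1 = (a' (G x)).1 ∧
    ∀ u, (a x).2 u = (a' (G x)).2 (mfderiv 𝓘(ℝ, E) 𝓘(ℝ, E') G x u)

theorem mlieBracket_related (hG : ContMDiffAt 𝓘(ℝ, E) 𝓘(ℝ, E') ∞ G x)
    {X Y : ∀ x : N, TangentSpace 𝓘(ℝ, E) x} {X' Y' : ∀ x : N', TangentSpace 𝓘(ℝ, E') x}
    {U : Set N} (hU : IsOpen U) (hx : x ∈ U) {U' : Set N'} (hU' : IsOpen U') (hx' : G x ∈ U')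
    (hX : SmoothVF U X) (hY : SmoothVF U Y) (hX' : SmoothVF U' X') (hY' : SmoothVF U' Y')
    (h : ∀ᶠ y in 𝓝 x, mfderiv 𝓘(ℝ, E) 𝓘(ℝ, E') G y (X y) = X' (G y))
    (h' : ∀ᶠ y in 𝓝 x, mfderiv 𝓘(ℝ, E) 𝓘(ℝ, E') G y (Y y) = Y' (G y)) :
    mfderiv 𝓘(ℝ, E) 𝓘(ℝ, E') G x (VectorField.mlieBracket 𝓘(ℝ, E) X Y x) =
      VectorField.mlieBracket 𝓘(ℝ, E') X' Y' (G x) := by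
  apply mfderiv_extChartAt_injective
  rw [mlieBracket_eq, ← fderiv_inCharts_self hG, mlieBracket_eq,
    ← inCharts_self (E := E) (E' := E') (G := G) (x := x)]
  have d : ∀ {W}, SmoothVF (E := E') U' W → DifferentiableAt ℝ (vfInChart (G x) W)
      (inCharts (E := E) (E' := E') G x (extChartAt 𝓘(ℝ, E) x x)) := fun hW => by
    rw [inCharts_self]
    exact (contDiffAt_vfInChart ((smoothVF_iff hU').1 hW _ hx')).differentiableAt (by simp)
  have key := lieBracket_related (E := E) (E' := E')
    ((contDiffAt_inCharts hG).of_le ENat.LEInfty.out)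
    ((contDiffAt_vfInChart ((smoothVF_iff hU).1 hX x hx)).differentiableAt (by simp))
    ((contDiffAt_vfInChart ((smoothVF_iff hU).1 hY x hx)).differentiableAt (by simp))
    (d hX') (d hY') (fderiv_inCharts_vfInChart hG h) (fderiv_inCharts_vfInChart hG h')
  exact key

/-- The bracket at a point is computed in the preferred chart there, so the charts at `x` and at `G
x` turn this into the vector space case. Differentiability of one-forms is needed only on the
target, as those on the source are pullbacks; this is where the target has to be finite-dimensional.
-/
theorem courant_related [FiniteDimensional ℝ E'] (hG : ContMDiffAt 𝓘(ℝ, E) 𝓘(ℝ, E') ∞ G x)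
    {a b : ∀ x : N, TT E x} {a' b' : ∀ x : N', TT E' x}
    {U : Set N} (hU : IsOpen U) (hx : x ∈ U) {U' : Set N'} (hU' : IsOpen U') (hx' : G x ∈ U')
    (ha : SmoothTT U a) (hb : SmoothTT U b) (ha' : SmoothTT U' a') (hb' : SmoothTT U' b')
    (h : ∀ᶠ y in 𝓝 x, RelatedAt G y a a') (h' : ∀ᶠ y in 𝓝 x, RelatedAt G y b b') :
    RelatedAt G x (courant a b) (courant a' b') := by
  refine ⟨mlieBracket_related hG hU hx hU' hx' ha.1 hb.1 ha'.1 hb'.1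
    (h.mono fun y hy => hy.1) (h'.mono fun y hy => hy.1), fun u => ?_⟩
  have d : ∀ {W}, SmoothVF (E := E') U' W → DifferentiableAt ℝ (vfInChart (G x) W)
      (inCharts (E := E) (E' := E') G x (extChartAt 𝓘(ℝ, E) x x)) := fun hW => by
    rw [inCharts_self]
    exact (contDiffAt_vfInChart ((smoothVF_iff hU').1 hW _ hx')).differentiableAt (by simp)
  have d' : ∀ {W}, SmoothDual E' (SmoothVF (E := E') (N := N')) U' W →
      DifferentiableAt ℝ (formInChart (G x) W)
      (inCharts (E := E) (E' := E') G x (extChartAt 𝓘(ℝ, E) x x)) := fun hW => by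
    rw [inCharts_self]
    exact (contDiffAt_formInChart hU' hW hx').differentiableAt (by simp)
  have key := courantForm_related
    ((contDiffAt_inCharts hG).of_le ENat.LEInfty.out)
    ((contDiffAt_vfInChart ((smoothVF_iff hU).1 ha.1 x hx)).differentiableAt (by simp))
    ((contDiffAt_vfInChart ((smoothVF_iff hU).1 hb.1 x hx)).differentiableAt (by simp))
    (d ha'.1) (d hb'.1) (d' ha'.2) (d' hb'.2)
    (fderiv_inCharts_vfInChart hG (h.mono fun y hy => hy.1))
    (fderiv_inCharts_vfInChart hG (h'.mono fun y hy => hy.1))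
    (formInChart_inCharts hG (h.mono fun y hy => hy.2))
    (formInChart_inCharts hG (h'.mono fun y hy => hy.2))
  rw [inCharts_self] at key
  have k1 := DFunLike.congr_fun key (mfderiv 𝓘(ℝ, E) 𝓘(ℝ, E) (extChartAt 𝓘(ℝ, E) x) x u)
  exact k1.trans (congrArg (DFunLike.coe (courantForm (E := E') _ _ _ _ _))
    (fderiv_inCharts_self hG u))

/-! ### Courant brackets with the zero section -/

omit [IsManifold 𝓘(ℝ, E) ∞ N] in
theorem formInChart_zero (x : N) :
    formInChart (E := E) x (fun y => (0 : TangentSpace 𝓘(ℝ, E) y →L[ℝ] ℝ)) = 0 := by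
  funext y; ext w; rfl

theorem vfInChart_zero (x : N) :
    vfInChart (E := E) x (fun y => (0 : TangentSpace 𝓘(ℝ, E) y)) = 0 :=
  VectorField.mpullback_zero

theorem courantForm_zero_left (Y : E → E) (η : E → E →L[ℝ] ℝ) (y : E) :
    courantForm 0 0 Y η y = 0 := by
  ext w
  simp [courantForm, lieForm]

theorem courantForm_zero_right (X : E → E) (ξ : E → E →L[ℝ] ℝ) (y : E) :
    courantForm X ξ 0 0 y = 0 := by
  ext w
  simp [courantForm, lieForm]

theorem courant_zero_left (b : ∀ x : N, TT E x) (x : N) :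
    courant (fun x => (0 : TT E x)) b x = 0 := by
  refine Prod.ext (congrFun (VectorField.mlieBracket_zero_left (I := 𝓘(ℝ, E))) x) ?_
  change ContinuousLinearMap.comp (courantForm (vfInChart x fun y => (0 : TangentSpace 𝓘(ℝ, E) y))
    (formInChart x fun y => (0 : TangentSpace 𝓘(ℝ, E) y →L[ℝ] ℝ)) _ _ _) _ = 0
  rw [vfInChart_zero, formInChart_zero, courantForm_zero_left]
  rfl

theorem courant_zero_right (a : ∀ x : N, TT E x) (x : N) :
    courant a (fun x => (0 : TT E x)) x = 0 := by
  refine Prod.ext (congrFun (VectorField.mlieBracket_zero_right (I := 𝓘(ℝ, E))) x) ?_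
  change ContinuousLinearMap.comp (courantForm _ _
    (vfInChart x fun y => (0 : TangentSpace 𝓘(ℝ, E) y))
    (formInChart x fun y => (0 : TangentSpace 𝓘(ℝ, E) y →L[ℝ] ℝ)) _) _ = 0
  rw [vfInChart_zero, formInChart_zero, courantForm_zero_right]
  rfl

/-! ### Derivatives of vector-valued functions along vector fields -/

variable {F : Type*} [NormedAddCommGroup F] [NormedSpace ℝ F]

/-- The derivative of a function with values in a vector space in the direction of a tangent
vector. -/
def dirDeriv (f : N → F) (x : N) (u : TangentSpace 𝓘(ℝ, E) x) : F :=
  mfderiv 𝓘(ℝ, E) 𝓘(ℝ, F) f x u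

omit [IsManifold 𝓘(ℝ, E) ∞ N] in
theorem dirDeriv_congr {f g : N → F} {x : N} (h : f =ᶠ[𝓝 x] g) (u : TangentSpace 𝓘(ℝ, E) x) :
    dirDeriv f x u = dirDeriv g x u := by
  rw [dirDeriv, dirDeriv]
  exact DFunLike.congr_fun h.mfderiv_eq u

omit [IsManifold 𝓘(ℝ, E) ∞ N] in
theorem dirDeriv_linear (f : N → F) (x : N) (s t : ℝ) (u v : TangentSpace 𝓘(ℝ, E) x) :
    dirDeriv f x (s • u + t • v) = s • dirDeriv f x u + t • dirDeriv f x v := by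
  refine (map_add (mfderiv 𝓘(ℝ, E) 𝓘(ℝ, F) f x) _ _).trans ?_
  exact congrArg₂ (fun a b : F => a + b) (map_smul (mfderiv 𝓘(ℝ, E) 𝓘(ℝ, F) f x) s u)
    (map_smul (mfderiv 𝓘(ℝ, E) 𝓘(ℝ, F) f x) t v)

omit [IsManifold 𝓘(ℝ, E) ∞ N] in
theorem dirDeriv_add {f g : N → F} {x : N} (hf : MDifferentiableAt 𝓘(ℝ, E) 𝓘(ℝ, F) f x)
    (hg : MDifferentiableAt 𝓘(ℝ, E) 𝓘(ℝ, F) g x) (u : TangentSpace 𝓘(ℝ, E) x) :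
    dirDeriv (fun y => f y + g y) x u = dirDeriv f x u + dirDeriv g x u :=
  DFunLike.congr_fun (hf.hasMFDerivAt.add hg.hasMFDerivAt).mfderiv u

omit [IsManifold 𝓘(ℝ, E) ∞ N] in
theorem dirDeriv_smul {f : N → ℝ} {g : N → F} {x : N}
    (hf : MDifferentiableAt 𝓘(ℝ, E) 𝓘(ℝ, ℝ) f x)
    (hg : MDifferentiableAt 𝓘(ℝ, E) 𝓘(ℝ, F) g x) (u : TangentSpace 𝓘(ℝ, E) x) :
    dirDeriv (fun y => f y • g y) x u = dirDeriv f x u • g x + f x • dirDeriv g x u := by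
  have h := DFunLike.congr_fun (mvfderiv_smul hf hg) u
  rw [add_comm]
  exact h

theorem dirDeriv_comp_extChartAt {h : E → F} {x y : N} (hy : y ∈ (extChartAt 𝓘(ℝ, E) x).source)
    (hh : DifferentiableAt ℝ h (extChartAt 𝓘(ℝ, E) x y)) (u : TangentSpace 𝓘(ℝ, E) y) :
    dirDeriv (fun y => h (extChartAt 𝓘(ℝ, E) x y)) y u =
      fderiv ℝ h (extChartAt 𝓘(ℝ, E) x y) (mfderiv 𝓘(ℝ, E) 𝓘(ℝ, E) (extChartAt 𝓘(ℝ, E) x) y u) := by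
  have d : MDifferentiableAt 𝓘(ℝ, E) 𝓘(ℝ, E) (extChartAt 𝓘(ℝ, E) x) y :=
    mdifferentiableAt_extChartAt (by rw [← extChartAt_source 𝓘(ℝ, E)]; exact hy)
  have h1 := (hh.hasFDerivAt.hasMFDerivAt.comp y d.hasMFDerivAt).mfderiv
  exact DFunLike.congr_fun h1 u

/-- `X (Y f) - Y (X f) = [X, Y] f`. -/
theorem dirDeriv_dirDeriv_sub {f : N → F}
    {U : Set N} (hU : IsOpen U) (hx : x ∈ U) (hf : ContMDiffOn 𝓘(ℝ, E) 𝓘(ℝ, F) ∞ f U)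
    {X Y : ∀ x : N, TangentSpace 𝓘(ℝ, E) x} (hX : SmoothVF U X) (hY : SmoothVF U Y) :
    dirDeriv (fun y => dirDeriv f y (Y y)) x (X x) -
      dirDeriv (fun y => dirDeriv f y (X y)) x (Y x) =
      dirDeriv f x (VectorField.mlieBracket 𝓘(ℝ, E) X Y x) := by
  have hfx : ContMDiffAt 𝓘(ℝ, E) 𝓘(ℝ, F) ∞ f x := (hf x hx).contMDiffAt (hU.mem_nhds hx)
  set fh : E → F := fun z => f ((extChartAt 𝓘(ℝ, E) x).symm z) with hfh
  have hfh1 : ContDiffAt ℝ ∞ fh (extChartAt 𝓘(ℝ, E) x x) := by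
    refine (ContMDiffAt.comp (g := f) (extChartAt 𝓘(ℝ, E) x x) ?_ (contMDiffAt_symm x)).contDiffAt
    rw [extChartAt_to_inv]; exact hfx
  have hfh2 : ContDiffAt ℝ 2 fh (extChartAt 𝓘(ℝ, E) x x) := hfh1.of_le ENat.LEInfty.out
  have hc : ContinuousAt (extChartAt 𝓘(ℝ, E) x) x := continuousAt_extChartAt x
  have ev : ∀ᶠ y in 𝓝 x, y ∈ (extChartAt 𝓘(ℝ, E) x).source ∧
      DifferentiableAt ℝ fh (extChartAt 𝓘(ℝ, E) x y) := by
    refine Filter.Eventually.and ((isOpen_chartDomain (E := E) x).mem_nhds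
      (mem_extChartAt_source x)) (hc.eventually ?_)
    filter_upwards [hfh2.eventually (by simp)] with z hz using hz.differentiableAt (by simp)
  -- The first derivative of `f` at points near `x` is expressed through the one fixed chart at `x`,
  -- so that it can be differentiated again.
  have step : ∀ {y} (_ : y ∈ (extChartAt 𝓘(ℝ, E) x).source)
      (_ : DifferentiableAt ℝ fh (extChartAt 𝓘(ℝ, E) x y)) (u : TangentSpace 𝓘(ℝ, E) y),
      dirDeriv f y u = fderiv ℝ fh (extChartAt 𝓘(ℝ, E) x y)
        (mfderiv 𝓘(ℝ, E) 𝓘(ℝ, E) (extChartAt 𝓘(ℝ, E) x) y u) := by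
    intro y hy hd u
    rw [← dirDeriv_comp_extChartAt hy hd]
    refine dirDeriv_congr ?_ u
    filter_upwards [(isOpen_chartDomain x).mem_nhds hy] with y' hy'
    rw [hfh]
    exact congrArg f ((extChartAt 𝓘(ℝ, E) x).left_inv hy').symm
  have hfh3 : DifferentiableAt ℝ (fderiv ℝ fh) (extChartAt 𝓘(ℝ, E) x x) :=
    (hfh2.fderiv_right (m := 1) (by norm_num [one_add_one_eq_two])).differentiableAt (by simp)
  -- In the chart, `X (Y f) = D²f (X, Y) + Df (DY · X)`. Antisymmetrizing removes the Hessian and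
  -- leaves `Df` applied to the bracket.
  have second : ∀ {X Y : ∀ x : N, TangentSpace 𝓘(ℝ, E) x} (_ : SmoothVF U X) (_ : SmoothVF U Y),
      dirDeriv (fun y => dirDeriv f y (Y y)) x (X x) =
        fderiv ℝ (fderiv ℝ fh) (extChartAt 𝓘(ℝ, E) x x) (vfInChart x X (extChartAt 𝓘(ℝ, E) x x))
          (vfInChart x Y (extChartAt 𝓘(ℝ, E) x x)) +
        fderiv ℝ fh (extChartAt 𝓘(ℝ, E) x x) (fderiv ℝ (vfInChart x Y) (extChartAt 𝓘(ℝ, E) x x)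
          (vfInChart x X (extChartAt 𝓘(ℝ, E) x x))) := by
    intro X Y hX hY
    have vf : ∀ (W : ∀ x : N, TangentSpace 𝓘(ℝ, E) x) {y}
        (_ : y ∈ (extChartAt 𝓘(ℝ, E) x).source),
        mfderiv 𝓘(ℝ, E) 𝓘(ℝ, E) (extChartAt 𝓘(ℝ, E) x) y (W y) =
          vfInChart (E := E) x W (extChartAt 𝓘(ℝ, E) x y) := by
      intro W y hy
      have := vfInChart_eq x W ((extChartAt 𝓘(ℝ, E) x).map_source hy)
      rw [(extChartAt 𝓘(ℝ, E) x).left_inv hy] at this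
      exact this.symm
    have dY : DifferentiableAt ℝ (vfInChart x Y) (extChartAt 𝓘(ℝ, E) x x) :=
      (contDiffAt_vfInChart ((smoothVF_iff hU).1 hY x hx)).differentiableAt (by simp)
    have e1 : (fun y => dirDeriv f y (Y y)) =ᶠ[𝓝 x] fun y =>
        (fun z => fderiv ℝ fh z (vfInChart x Y z)) (extChartAt 𝓘(ℝ, E) x y) := by
      filter_upwards [ev] with y hy
      exact (step hy.1 hy.2 (Y y)).trans (congrArg _ (vf Y hy.1))
    rw [dirDeriv_congr e1, dirDeriv_comp_extChartAt (mem_extChartAt_source x) (hfh3.clm_apply dY)]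
    refine (congrArg _ (vf X (mem_extChartAt_source x))).trans ?_
    rw [fderiv_clm_apply hfh3 dY]
    simp only [add_apply, ContinuousLinearMap.comp_apply, ContinuousLinearMap.flip_apply]
    rw [add_comm]
  rw [second hX hY, second hY hX, step (mem_extChartAt_source x) ev.self_of_nhds.2]
  refine Eq.trans ?_ (congrArg _ (mlieBracket_eq X Y x)).symm
  rw [VectorField.lieBracket, map_sub, fderiv_fderiv_symm hfh2]
  abel

end Related

/-! ### Pairing one-forms with vector fields along a map -/

section Along

variable {E EP HP : Type*} [NormedAddCommGroup E] [NormedSpace ℝ E] [FiniteDimensional ℝ E]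
  [NormedAddCommGroup EP] [NormedSpace ℝ EP] [TopologicalSpace HP]
  {IP : ModelWithCorners ℝ EP HP}
  {N P : Type*} [TopologicalSpace N] [ChartedSpace E N] [IsManifold 𝓘(ℝ, E) ∞ N]
  [TopologicalSpace P] [ChartedSpace HP P]

/-- Here `w` is a family along `g` and not a vector field, so the definition of a smooth form does
not apply to it directly. It is expanded in the frame of chart-constant fields near `g p₀`; its
coefficients are smooth in `p`, and `ξ` on the frame is a smooth function composed with `g`. -/
theorem contMDiffAt_form_apply {U : Set N} (hU : IsOpen U)
    {ξ : ∀ x : N, TangentSpace 𝓘(ℝ, E) x →L[ℝ] ℝ}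
    (hξ : SmoothDual E (SmoothVF (E := E) (N := N)) U ξ) {g : P → N}
    {w : ∀ p, TangentSpace 𝓘(ℝ, E) (g p)} {p₀ : P} (hp : g p₀ ∈ U)
    (hw : ContMDiffAt IP 𝓘(ℝ, E).tangent ∞ (fun p => (⟨g p, w p⟩ : TangentBundle 𝓘(ℝ, E) N)) p₀) :
    ContMDiffAt IP 𝓘(ℝ, ℝ) ∞ (fun p => ξ (g p) (w p)) p₀ := by
  let b := Module.finBasis ℝ E
  have hg := contMDiffAt_base hw
  let f : P → E := fun p => mfderiv 𝓘(ℝ, E) 𝓘(ℝ, E) (extChartAt 𝓘(ℝ, E) (g p₀)) (g p) (w p)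
  have hf : ContMDiffAt IP 𝓘(ℝ, E) ∞ f p₀ := contMDiffAt_mfderiv_apply contMDiffAt_extChartAt hw
  have hV : IsOpen (U ∩ (extChartAt 𝓘(ℝ, E) (g p₀)).source) := hU.inter (isOpen_chartDomain _)
  have h1 : ∀ i, ContMDiffAt IP 𝓘(ℝ, ℝ) ∞
      (fun p => b.repr (f p) i * ξ (g p) (chartVF (g p₀) (b i) (g p))) p₀ := by
    intro i
    have h2 : ContMDiffAt IP 𝓘(ℝ, ℝ) ∞ (fun p => b.repr (f p) i) p₀ := by
      have : ContDiff ℝ ∞ (fun v => b.repr v i) :=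
        (LinearMap.toContinuousLinearMap (b.coord i)).contDiff
      exact this.contMDiff.contMDiffAt.comp p₀ hf
    have h3 := hξ _ hV inter_subset_left (chartVF (g p₀) (b i))
      ((smoothVF_chartVF (g p₀) (b i)).mono inter_subset_right)
    have h4 : ContMDiffAt 𝓘(ℝ, E) 𝓘(ℝ, ℝ) ∞ (fun x => ξ x (chartVF (g p₀) (b i) x)) (g p₀) :=
      h3.contMDiffAt (hV.mem_nhds ⟨hp, mem_extChartAt_source _⟩)
    exact h2.mul (ContMDiffAt.comp p₀ h4 hg)
  have h5 : ContMDiffAt IP 𝓘(ℝ, ℝ) ∞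
      (fun p => ∑ i, b.repr (f p) i * ξ (g p) (chartVF (g p₀) (b i) (g p))) p₀ :=
    contMDiffAt_finsetSum fun i _ => h1 i
  refine h5.congr_of_eventuallyEq ?_
  filter_upwards [hg.continuousAt.eventually ((isOpen_chartDomain (E := E) (g p₀)).mem_nhds
    (mem_extChartAt_source _))] with p hp
  have e1 := mfderiv_extChartAt_comp_symm (g p₀) hp (w p)
  conv_lhs => rw [← e1]
  let L : E →ₗ[ℝ] ℝ := ((ξ (g p)).comp (mfderiv 𝓘(ℝ, E) 𝓘(ℝ, E)
    (extChartAt 𝓘(ℝ, E) (g p₀)).symm (extChartAt 𝓘(ℝ, E) (g p₀) (g p)))).toLinearMap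
  change L (f p) = ∑ i, b.repr (f p) i * L (b i)
  conv_lhs => rw [← b.sum_repr (f p)]
  rw [map_sum]
  exact Finset.sum_congr rfl fun i _ => by rw [map_smul, smul_eq_mul]

end Along

namespace TorusBundle

variable {n : ℕ} {M : Type*} [TopologicalSpace M] [ChartedSpace (EuclideanSpace ℝ (Fin n)) M]
  {EZ : Type*} [NormedAddCommGroup EZ] [NormedSpace ℝ EZ]
  {Z : Type*} [TopologicalSpace Z] [ChartedSpace EZ Z]
  (T : TorusBundle n M EZ Z)

/-! ### Local trivializations and their differentials -/

/-- The action of an integral matrix on `ℝ^n` as a continuous linear map. -/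
def _root_.TorusMirror.intActL {n : ℕ} (A : Matrix (Fin n) (Fin n) ℤ) : Rn n →L[ℝ] Rn n :=
  LinearMap.toContinuousLinearMap (Matrix.toLin' (A.map (Int.cast : ℤ → ℝ)))

/-- Near points with the same image two trivializations differ by `(m, ξ) ↦ (m, A ξ + k)` with `A`
and `k` constant. The differential is therefore block diagonal: horizontal and vertical directions
do not mix, which makes the splitting independent of the trivialization. -/
theorem exists_transition {c c' m : M} (hm : m ∈ T.U c) (hm' : m ∈ T.U c') {ξ ξ' : Rn n}
    (h : T.φ c (m, ξ) = T.φ c' (m, ξ')) :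
    ∃ A : Matrix (Fin n) (Fin n) ℤ, (∀ v, T.coord c m v = intActL A (T.coord c' m v)) ∧
      ∀ u η, T.dφ c' m ξ' (u, η) = T.dφ c m ξ (u, intActL A η) := by
  obtain ⟨A, hA⟩ := T.trans c c' m ⟨hm, hm'⟩
  refine ⟨A.1, fun v => T.coord_change hm hm' A.1 hA.self_of_nhds v, fun u η => ?_⟩
  rw [hA.self_of_nhds] at h
  obtain ⟨k, hk⟩ := (T.period c m hm _ _).1 h.symm
  -- The integral translation `k` is needed because equality of the two images fixes the fibre
  -- coordinates only modulo `ℤ^n`.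
  let g : M × Rn n → M × Rn n := fun q => (q.1, intActL A.1 q.2 + fun i => (k i : ℝ))
  have hg0 : g (m, ξ') = (m, ξ) := by
    refine Prod.ext rfl ?_
    ext i
    exact (hk i).symm
  have hg : HasMFDerivAt ((𝓡 n).prod 𝓘(ℝ, Rn n)) ((𝓡 n).prod 𝓘(ℝ, Rn n)) g (m, ξ')
      ((ContinuousLinearMap.fst ℝ (EuclideanSpace ℝ (Fin n)) (Rn n)).prod
        ((intActL A.1).comp (ContinuousLinearMap.snd ℝ (EuclideanSpace ℝ (Fin n)) (Rn n)))) := by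
    have h1 := hasMFDerivAt_fst (I := 𝓡 n) (I' := 𝓘(ℝ, Rn n)) (x := ((m, ξ') : M × Rn n))
    have h2 := hasMFDerivAt_snd (I := 𝓡 n) (I' := 𝓘(ℝ, Rn n)) (x := ((m, ξ') : M × Rn n))
    have h3 : HasMFDerivAt 𝓘(ℝ, Rn n) 𝓘(ℝ, Rn n)
        (fun η : Rn n => intActL A.1 η + fun i => (k i : ℝ)) ξ' (intActL A.1) :=
      ((intActL A.1).hasFDerivAt.add_const _).hasMFDerivAt
    exact h1.prodMk (h3.comp (m, ξ') h2)
  have hφ : HasMFDerivAt ((𝓡 n).prod 𝓘(ℝ, Rn n)) 𝓘(ℝ, EZ) (T.φ c) (g (m, ξ')) (T.dφ c m ξ) := by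
    rw [hg0]
    exact (T.mdifferentiableAt_φ c m hm ξ).hasMFDerivAt
  have hev : T.φ c' =ᶠ[𝓝 (m, ξ')] T.φ c ∘ g := by
    have hc : ContinuousAt (Prod.fst : M × Rn n → M) (m, ξ') := continuousAt_fst
    filter_upwards [hc.eventually hA, hc.eventually ((T.isOpen_U c).mem_nhds hm)] with q q1 q2
    have e1 := q1 q.2
    rw [Prod.mk.eta] at e1
    rw [e1]
    exact (T.period c q.1 q2 _ _).2 ⟨k, fun i => rfl⟩
  have h4 := hasMFDerivAt_unique (T.mdifferentiableAt_φ c' m hm' ξ').hasMFDerivAt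
    ((hφ.comp (m, ξ') hg).congr_of_eventuallyEq hev)
  exact DFunLike.congr_fun h4 (u, η)

theorem eventually_coord_change {c c' m : M} (hm : m ∈ T.U c) (hm' : m ∈ T.U c') :
    ∃ A : Matrix (Fin n) (Fin n) ℤ, ∀ᶠ m' in 𝓝 m, ∀ v,
      T.coord c m' v = intActL A (T.coord c' m' v) := by
  obtain ⟨A, hA⟩ := T.trans c c' m ⟨hm, hm'⟩
  refine ⟨A.1, ?_⟩
  filter_upwards [hA, (T.isOpen_U c).mem_nhds hm, (T.isOpen_U c').mem_nhds hm'] with m' h h1 h2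
  exact T.coord_change h1 h2 A.1 h

theorem coord_symm (c m : M) (hm : m ∈ T.U c) (η : Rn n) :
    T.coord c m ((T.coordEquiv c m hm).symm η) = η :=
  (T.coordEquiv c m hm).apply_symm_apply η

theorem coord_injective {c m : M} (hm : m ∈ T.U c) {v w : T.V m}
    (h : T.coord c m v = T.coord c m w) : v = w :=
  (T.coordEquiv c m hm).injective h

theorem coord_inverse (c m : M) (hm : m ∈ T.U c) :
    (T.coord c m).inverse = (T.coordEquiv c m hm).symm :=
  ContinuousLinearMap.inverse_equiv (T.coordEquiv c m hm)

theorem val_eq_dφ (c m : M) (hm : m ∈ T.U c) (v : T.V m) :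
    (v : TangentSpace 𝓘(ℝ, EZ) (T.zero m)) = T.dφ c m 0 (0, T.coord c m v) := by
  have h : (T.coordEquiv c m hm).symm (T.coordEquiv c m hm v) = v :=
    (T.coordEquiv c m hm).symm_apply_apply v
  conv_lhs => rw [← h]
  rfl

/-- Smooth fibre coordinates near a point of the total space. -/
theorem exists_fibreCoord (c m : M) (hm : m ∈ T.U c) (ξ : Rn n) :
    ∃ τ : Z → Rn n, ContMDiffAt 𝓘(ℝ, EZ) 𝓘(ℝ, Rn n) ∞ τ (T.φ c (m, ξ)) ∧
      ContMDiffAt 𝓘(ℝ, EZ) (𝓡 n) ∞ T.proj (T.φ c (m, ξ)) ∧ τ (T.φ c (m, ξ)) = ξ ∧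
      (∀ᶠ z in 𝓝 (T.φ c (m, ξ)), T.proj z ∈ T.U c ∧ T.φ c (T.proj z, τ z) = z) ∧
      ∀ᶠ q in 𝓝 ((m, ξ) : M × Rn n), τ (T.φ c q) = q.2 := by
  have h := T.localDiffeo c ⟨(m, ξ), hm, mem_univ _⟩
  have h1 : ContMDiffAt 𝓘(ℝ, EZ) ((𝓡 n).prod 𝓘(ℝ, Rn n)) ∞ h.localInverse (T.φ c (m, ξ)) :=
    h.localInverse_contMDiffAt
  have h0 : h.localInverse (T.φ c (m, ξ)) = (m, ξ) :=
    h.localInverse_left_inv h.localInverse_mem_target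
  have h2 : ContMDiffAt 𝓘(ℝ, EZ) (𝓡 n) ∞ (fun z => (h.localInverse z).1) (T.φ c (m, ξ)) :=
    contMDiffAt_fst.comp _ h1
  have h3 : ContMDiffAt 𝓘(ℝ, EZ) 𝓘(ℝ, Rn n) ∞ (fun z => (h.localInverse z).2) (T.φ c (m, ξ)) :=
    contMDiffAt_snd.comp _ h1
  have hc : ∀ᶠ z in 𝓝 (T.φ c (m, ξ)), (h.localInverse z).1 ∈ T.U c := by
    refine h2.continuousAt.eventually ((T.isOpen_U c).mem_nhds ?_)
    simpa only [h0] using hm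
  have hp : ∀ᶠ z in 𝓝 (T.φ c (m, ξ)), T.proj z = (h.localInverse z).1 ∧ T.proj z ∈ T.U c ∧
      T.φ c (T.proj z, (h.localInverse z).2) = z := by
    filter_upwards [hc, h.localInverse_eventuallyEq_right] with z hz hz'
    have e : T.φ c (h.localInverse z) = z := hz'
    have e1 : T.proj z = (h.localInverse z).1 := by
      conv_lhs => rw [← e]
      exact T.proj_φ c _ hz _
    refine ⟨e1, e1 ▸ hz, ?_⟩
    rw [e1]
    exact e
  refine ⟨fun z => (h.localInverse z).2, h3,
    h2.congr_of_eventuallyEq (hp.mono fun z hz => hz.1), congrArg Prod.snd h0,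
    hp.mono fun z hz => hz.2, ?_⟩
  filter_upwards [h.localInverse_eventuallyEq_left] with q hq
  exact congrArg Prod.snd hq

theorem contMDiffAt_φ (c m : M) (hm : m ∈ T.U c) (ξ : Rn n) :
    ContMDiffAt ((𝓡 n).prod 𝓘(ℝ, Rn n)) 𝓘(ℝ, EZ) ∞ (T.φ c) (m, ξ) :=
  IsLocalDiffeomorphAt.contMDiffAt (T.localDiffeo c ⟨(m, ξ), hm, mem_univ _⟩)

theorem contMDiff_proj : ContMDiff 𝓘(ℝ, EZ) (𝓡 n) ∞ T.proj := by
  intro z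
  obtain ⟨τ, -, h, -⟩ := T.exists_fibreCoord (T.proj z) (T.proj z) (T.mem_U _) (T.fib z)
  rwa [T.φ_fib] at h

theorem contMDiffAt_section (c m : M) (hm : m ∈ T.U c) (ξ : Rn n) :
    ContMDiffAt (𝓡 n) 𝓘(ℝ, EZ) ∞ (fun m => T.φ c (m, ξ)) m :=
  ContMDiffAt.comp (f := fun m => ((m, ξ) : M × Rn n)) m (T.contMDiffAt_φ c m hm ξ)
    (contMDiffAt_id.prodMk contMDiffAt_const)

theorem mfderiv_section (c m : M) (hm : m ∈ T.U c) (ξ : Rn n) (u : TangentSpace (𝓡 n) m) :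
    mfderiv (𝓡 n) 𝓘(ℝ, EZ) (fun m => T.φ c (m, ξ)) m u = T.dφ c m ξ (u, 0) := by
  have h1 := (T.mdifferentiableAt_φ c m hm ξ).hasMFDerivAt
  have h2 := (hasMFDerivAt_id (I := 𝓡 n) m).prodMk
    (hasMFDerivAt_const (I := 𝓡 n) (I' := 𝓘(ℝ, Rn n)) ξ m)
  have h3 : HasMFDerivAt (𝓡 n) 𝓘(ℝ, EZ) (fun m => T.φ c (m, ξ)) m _ := HasMFDerivAt.comp m h1 h2
  rw [h3.mfderiv]
  rfl

/-- The differential of the fibre coordinates. -/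
theorem mfderiv_fibreCoord [IsManifold 𝓘(ℝ, EZ) ∞ Z] {c m : M} (hm : m ∈ T.U c) {ξ : Rn n}
    {τ : Z → Rn n}
    (hτ : ContMDiffAt 𝓘(ℝ, EZ) 𝓘(ℝ, Rn n) ∞ τ (T.φ c (m, ξ)))
    (h : ∀ᶠ q in 𝓝 ((m, ξ) : M × Rn n), τ (T.φ c q) = q.2) :
    ∀ᶠ q in 𝓝 ((m, ξ) : M × Rn n), ∀ w,
      dirDeriv τ (T.φ c q) (T.dφ c q.1 q.2 w) = w.2 := by
  have h1 := (T.contMDiffAt_φ c m hm ξ).continuousAt.eventually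
    (ContMDiffAt.eventually_mdifferentiableAt hτ)
  have hc : ContinuousAt (Prod.fst : M × Rn n → M) (m, ξ) := continuousAt_fst
  filter_upwards [h1, eventually_eventually_nhds.2 h,
    hc.eventually ((T.isOpen_U c).mem_nhds hm)] with q q1 q2 q3 w
  have h2 := q1.hasMFDerivAt.comp q (T.mdifferentiableAt_φ c q.1 q3 q.2).hasMFDerivAt
  have h3 := hasMFDerivAt_snd (I := 𝓡 n) (I' := 𝓘(ℝ, Rn n)) (x := q)
  have h4 := hasMFDerivAt_unique h2 (h3.congr_of_eventuallyEq q2)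
  exact DFunLike.congr_fun h4 w

/-! ### The splitting of the tangent sequence -/

/-- The definitions of `horLift`, `j` and `D` use the trivialization around `proj z` and a chosen
coordinate `fib z`, neither of which need vary continuously with `z`. By `exists_transition` any
trivialization and any coordinate of `z` give the same lift, so one trivialization with smooth fibre
coordinates serves for a whole neighbourhood. -/
theorem horLift_eq {c : M} {z : Z} (hz : T.proj z ∈ T.U c) {ξ : Rn n}
    (h : T.φ c (T.proj z, ξ) = z) (u : TangentSpace (𝓡 n) (T.proj z)) :
    T.horLift z u = T.dφ c (T.proj z) ξ (u, 0) := by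
  obtain ⟨A, -, hA⟩ := T.exists_transition hz (T.mem_U _) (h.trans (T.φ_fib z).symm)
  refine (hA u 0).trans ?_
  rw [map_zero]

theorem j_eq {c : M} {z : Z} (hz : T.proj z ∈ T.U c) {ξ : Rn n}
    (h : T.φ c (T.proj z, ξ) = z) (v : T.V (T.proj z)) :
    T.j z v = T.dφ c (T.proj z) ξ (0, T.coord c (T.proj z) v) := by
  obtain ⟨A, hA', hA⟩ := T.exists_transition hz (T.mem_U _) (h.trans (T.φ_fib z).symm)
  refine (hA 0 (T.coord (T.proj z) (T.proj z) v)).trans ?_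
  rw [← hA']

theorem dproj_dTriv (z : Z) (w : EuclideanSpace ℝ (Fin n) × Rn n) :
    T.dproj z (T.dTriv z w) = w.1 := by
  have h := T.dproj_dφ (T.proj z) (T.proj z) (T.mem_U _) (T.fib z) w
  rw [T.φ_fib z] at h
  exact h

theorem exists_dTriv (z : Z) :
    ∃ e : (EuclideanSpace ℝ (Fin n) × Rn n) ≃L[ℝ] EZ, T.dTriv z = e :=
  T.dφ_equiv _ _ (T.mem_U _) _

theorem coord_D_dTriv (z : Z) (w : EuclideanSpace ℝ (Fin n) × Rn n) :
    T.coord (T.proj z) (T.proj z) (T.D z (T.dTriv z w)) = w.2 := by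
  obtain ⟨e, he⟩ := T.exists_dTriv z
  refine (T.coord_symm _ _ (T.mem_U _) _).trans ?_
  change ((T.dTriv z).inverse (T.dTriv z w)).2 = w.2
  rw [he, ContinuousLinearMap.inverse_equiv]
  exact congrArg Prod.snd (e.symm_apply_apply w)

theorem dproj_horLift (z : Z) (u : TangentSpace (𝓡 n) (T.proj z)) :
    T.dproj z (T.horLift z u) = u := T.dproj_dTriv z (u, 0)

theorem dproj_j (z : Z) (v : T.V (T.proj z)) : T.dproj z (T.j z v) = 0 :=
  T.dproj_dTriv z (0, _)

theorem D_horLift (z : Z) (u : TangentSpace (𝓡 n) (T.proj z)) : T.D z (T.horLift z u) = 0 := by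
  apply T.coord_injective (T.mem_U _)
  rw [map_zero]
  exact T.coord_D_dTriv z (u, 0)

theorem D_j (z : Z) (v : T.V (T.proj z)) : T.D z (T.j z v) = v := by
  apply T.coord_injective (T.mem_U _)
  exact T.coord_D_dTriv z (0, _)

/-- The four relations between `j`, `horLift`, `D` and `dproj` say that these split the tangent
sequence. This one-sided inverse is all that is used about `F`: it moves `J = Finv ∘ Jb ∘ F` across
lifted sections. -/
theorem F_Finv (z : Z) (a : Dbl (T.VT (T.proj z))) : T.F z (T.Finv z a) = a := by
  refine Prod.ext (Prod.ext ?_ ?_) ?_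
  · change T.D z (T.j z a.1.1 + T.horLift z a.1.2) = a.1.1
    rw [map_add, T.D_j, T.D_horLift, add_zero]
  · change T.dproj z (T.j z a.1.1 + T.horLift z a.1.2) = a.1.2
    rw [map_add, T.dproj_j, T.dproj_horLift, zero_add]
  · ext b
    · change a.2 (T.D z (T.j z b + T.horLift z 0), T.dproj z (T.j z b + T.horLift z 0)) = a.2 (b, 0)
      rw [map_zero, add_zero, T.D_j, T.dproj_j]
    · change a.2 (T.D z (T.j z 0 + T.horLift z b), T.dproj z (T.j z 0 + T.horLift z b)) = a.2 (0, b)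
      rw [map_zero, zero_add, T.D_horLift, T.dproj_horLift]

/-- The vertical projection in fibre coordinates. -/
theorem coord_D_dφ {c : M} {z : Z} (hz : T.proj z ∈ T.U c) {ξ : Rn n}
    (h : T.φ c (T.proj z, ξ) = z) (w : EuclideanSpace ℝ (Fin n) × Rn n) :
    T.coord c (T.proj z) (T.D z (T.dφ c (T.proj z) ξ w)) = w.2 := by
  let u : TangentSpace (𝓡 n) (T.proj z) := w.1
  have h1 : T.dφ c (T.proj z) ξ w =
      T.j z ((T.coordEquiv c (T.proj z) hz).symm w.2) + T.horLift z u := by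
    rw [T.horLift_eq hz h, T.j_eq hz h, T.coord_symm]
    refine Eq.trans ?_ (map_add (T.dφ c (T.proj z) ξ) (0, w.2) (w.1, 0))
    simp
  have h2 : T.D z (T.dφ c (T.proj z) ξ w) = (T.coordEquiv c (T.proj z) hz).symm w.2 := by
    rw [h1, map_add, T.D_j, T.D_horLift, add_zero]
  rw [h2, T.coord_symm]

end TorusBundle

namespace TorusBundle

variable {n : ℕ} {M : Type*} [TopologicalSpace M] [ChartedSpace (EuclideanSpace ℝ (Fin n)) M]
  [IsManifold (𝓡 n) ∞ M]
  {EZ : Type*} [NormedAddCommGroup EZ] [NormedSpace ℝ EZ]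
  {Z : Type*} [TopologicalSpace Z] [ChartedSpace EZ Z] [IsManifold 𝓘(ℝ, EZ) ∞ Z]
  (T : TorusBundle n M EZ Z)

/-! ### Smooth sections in local coordinates -/

/-- Base point, fibre coordinate and both components of the vector may all vary; the fibre
coordinate is constant along the zero section and moves for lifts to the total space. -/
theorem contMDiffAt_dφ {EP HP P : Type*} [NormedAddCommGroup EP] [NormedSpace ℝ EP]
    [TopologicalSpace HP] {IP : ModelWithCorners ℝ EP HP} [TopologicalSpace P] [ChartedSpace HP P]
    {c : M} {g : P → M} {q : P → Rn n} {X : ∀ p, TangentSpace (𝓡 n) (g p)} {η : P → Rn n} {p₀ : P}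
    (hc : g p₀ ∈ T.U c)
    (hX : ContMDiffAt IP (𝓡 n).tangent ∞ (fun p => (⟨g p, X p⟩ : TangentBundle (𝓡 n) M)) p₀)
    (hq : ContMDiffAt IP 𝓘(ℝ, Rn n) ∞ q p₀) (hη : ContMDiffAt IP 𝓘(ℝ, Rn n) ∞ η p₀) :
    ContMDiffAt IP 𝓘(ℝ, EZ).tangent ∞
      (fun p => (⟨T.φ c (g p, q p), T.dφ c (g p) (q p) (X p, η p)⟩ : TangentBundle 𝓘(ℝ, EZ) Z))
      p₀ := by
  have h1 : ContMDiffAt IP 𝓘(ℝ, Rn n).tangent ∞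
      (fun p => (⟨q p, η p⟩ : TangentBundle 𝓘(ℝ, Rn n) (Rn n))) p₀ :=
    contMDiffAt_vectorSpace.2 ⟨hq, hη⟩
  have h2 : ContMDiffAt IP ((𝓡 n).prod 𝓘(ℝ, Rn n)).tangent ∞
      (fun p => (⟨(g p, q p), (X p, η p)⟩ : TangentBundle ((𝓡 n).prod 𝓘(ℝ, Rn n)) (M × Rn n)))
      p₀ :=
    (contMDiff_equivTangentBundleProd_symm (I := 𝓡 n) (I' := 𝓘(ℝ, Rn n)) (M := M) (M' := Rn n)
      (n := ∞)).contMDiffAt.comp p₀ (hX.prodMk h1)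
  exact contMDiffAt_tangentMap (T.contMDiffAt_φ c _ hc _) h2

omit [IsManifold 𝓘(ℝ, EZ) ∞ Z] in
theorem tangentBundle_mk_eq {z z' : Z} (h : z = z') (u : EZ) :
    (⟨z, u⟩ : TangentBundle 𝓘(ℝ, EZ) Z) = ⟨z', u⟩ := by
  rw [h]

/-- `V` as a subset of the tangent bundle of the total space: the point given by a family of
vertical vectors along the zero section. -/
abbrev toTangent (σ : ∀ m, T.V m) (m : M) : TangentBundle 𝓘(ℝ, EZ) Z :=
  ⟨T.zero m, ((σ m : T.V m) : TangentSpace 𝓘(ℝ, EZ) (T.zero m))⟩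

/-- From left to right, the coordinates of a vertical vector are its image under the differential of
a smooth fibre coordinate `τ`. From right to left, the vector is the image of smooth data under the
differential of the trivialization. -/
theorem contMDiffAt_toTangent_iff {c m : M} (hm : m ∈ T.U c) (σ : ∀ m, T.V m) :
    ContMDiffAt (𝓡 n) 𝓘(ℝ, EZ).tangent ∞ (T.toTangent σ) m ↔
      ContMDiffAt (𝓡 n) 𝓘(ℝ, Rn n) ∞ (fun m' => T.coord c m' (σ m')) m := by
  constructor
  · intro h
    obtain ⟨τ, h1, -, -, -, h2⟩ := T.exists_fibreCoord c m hm 0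
    have h3 := T.mfderiv_fibreCoord hm h1 h2
    rw [T.φ_zero c m hm] at h1
    have h4 := contMDiffAt_mfderiv_apply (g := T.zero) h1 h
    refine h4.congr_of_eventuallyEq ?_
    have hc : ContinuousAt (fun m' : M => ((m', 0) : M × Rn n)) m := by fun_prop
    filter_upwards [hc.eventually h3, (T.isOpen_U c).mem_nhds hm] with m' k1 k2
    have k3 := k1 (0, T.coord c m' (σ m'))
    rw [← T.val_eq_dφ c m' k2 (σ m')] at k3
    simp only at k3
    rw [T.φ_zero c m' k2] at k3
    exact k3.symm
  · intro h
    have h0 : ContMDiffAt (𝓡 n) (𝓡 n).tangent ∞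
        (fun m' => (⟨m', 0⟩ : TangentBundle (𝓡 n) M)) m :=
      (Bundle.contMDiff_zeroSection ℝ (TangentSpace (𝓡 n) (M := M))).contMDiffAt
    have h1 := T.contMDiffAt_dφ hm (g := fun m' => m') h0 (q := fun _ => 0) contMDiffAt_const h
    refine h1.congr_of_eventuallyEq ?_
    filter_upwards [(T.isOpen_U c).mem_nhds hm] with m' k2
    have k3 := T.val_eq_dφ c m' k2 (σ m')
    rw [toTangent, k3]
    exact tangentBundle_mk_eq (T.φ_zero c m' k2).symm _

theorem coordDual_apply (c m : M) (α : T.V m →L[ℝ] ℝ) (k : Fin n) :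
    T.coordDual c m α k = α ((T.coord c m).inverse (Pi.single k 1)) := rfl

theorem apply_eq_coordDual {c m : M} (hm : m ∈ T.U c) (α : T.V m →L[ℝ] ℝ) (v : T.V m) :
    α v = ∑ k, T.coordDual c m α k * T.coord c m v k := by
  have h1 : v = (T.coordEquiv c m hm).symm (T.coord c m v) :=
    ((T.coordEquiv c m hm).symm_apply_apply v).symm
  have h2 : T.coord c m v = ∑ k, T.coord c m v k • (Pi.single k 1 : Rn n) := by
    ext i
    simp [Finset.sum_apply, Pi.single_apply]
  conv_lhs => rw [h1, h2]
  rw [map_sum, map_sum]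
  refine Finset.sum_congr rfl fun k _ => ?_
  rw [map_smul, map_smul, smul_eq_mul, mul_comm, coordDual_apply, T.coord_inverse c m hm]
  rfl

theorem smoothVT_iff {U : Set M} (hU : IsOpen U) (σ : ∀ m, T.VT m) :
    T.SmoothVT U σ ↔ (∀ m ∈ U, ContMDiffAt (𝓡 n) 𝓘(ℝ, Rn n) ∞
      (fun m' => T.coord m m' (σ m').1) m) ∧ SmoothVF U (fun m => (σ m).2) := by
  refine and_congr_left fun _ => ?_
  constructor
  · intro h m hm
    exact (T.contMDiffAt_toTangent_iff (T.mem_U m) _).1 ((h m hm).contMDiffAt (hU.mem_nhds hm))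
  · intro h m hm
    exact ((T.contMDiffAt_toTangent_iff (T.mem_U m) (fun m => (σ m).1)).2
      (h m hm)).contMDiffWithinAt

/-- The `k`-th vector field of the local frame of `V` given by a local trivialization. -/
def frame (c : M) (k : Fin n) (m : M) : T.V m := (T.coord c m).inverse (Pi.single k 1)

theorem coord_frame {c m : M} (hm : m ∈ T.U c) (k : Fin n) :
    T.coord c m (T.frame c k m) = Pi.single k 1 := by
  rw [frame, T.coord_inverse c m hm]
  exact T.coord_symm c m hm _

theorem coord_contMDiffAt_change {c c' m : M} (hm : m ∈ T.U c) (hm' : m ∈ T.U c')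
    {σ : ∀ m, T.V m}
    (h : ContMDiffAt (𝓡 n) 𝓘(ℝ, Rn n) ∞ (fun m' => T.coord c m' (σ m')) m) :
    ContMDiffAt (𝓡 n) 𝓘(ℝ, Rn n) ∞ (fun m' => T.coord c' m' (σ m')) m :=
  (T.contMDiffAt_toTangent_iff hm' σ).1 ((T.contMDiffAt_toTangent_iff hm σ).2 h)

theorem contMDiffAt_coord_frame {c c' m : M} (hm : m ∈ T.U c) (hm' : m ∈ T.U c') (k : Fin n) :
    ContMDiffAt (𝓡 n) 𝓘(ℝ, Rn n) ∞ (fun m' => T.coord c' m' (T.frame c k m')) m := by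
  refine T.coord_contMDiffAt_change hm hm' ?_
  refine (contMDiffAt_const (c := (Pi.single k 1 : Rn n))).congr_of_eventuallyEq ?_
  filter_upwards [(T.isOpen_U c).mem_nhds hm] with m' h
  exact T.coord_frame h k

theorem smoothVF_zero (U : Set M) : SmoothVF U (fun m => (0 : TangentSpace (𝓡 n) m)) :=
  (Bundle.contMDiff_zeroSection ℝ (TangentSpace (𝓡 n) (M := M))).contMDiffOn

theorem smoothVT_inr {U : Set M} (hU : IsOpen U) {X : ∀ m : M, TangentSpace (𝓡 n) m}
    (hX : SmoothVF U X) : T.SmoothVT U (fun m => (0, X m)) := by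
  refine (T.smoothVT_iff hU _).2 ⟨fun m _ => ?_, hX⟩
  simp only [map_zero]
  exact contMDiffAt_const

/-- A form on `V ⊕ T_M` evaluates to the product of dual coordinates with coordinates plus the value
of its `T_M^∨` part. At each point only the trivialization around that point is required, which is
the form in which the criterion is easiest to verify. -/
theorem smoothDbl_of {U : Set M} (hU : IsOpen U) (a : ∀ m, Dbl (T.VT m))
    (h1 : ∀ m ∈ U,
      ContMDiffAt (𝓡 n) 𝓘(ℝ, Rn n) ∞ (fun m' => T.coord m m' (projFst _ _ (a m')).1) m ∧
      ContMDiffAt (𝓡 n) 𝓘(ℝ, Rn n) ∞ (fun m' => T.coordDual m m' (projFst _ _ (a m')).2) m)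
    (h2 : SmoothTT U (fun m => projSnd _ _ (a m))) :
    SmoothDbl (EuclideanSpace ℝ (Fin n)) T.SmoothVT U a := by
  obtain ⟨h2, h3⟩ := h2
  refine ⟨(T.smoothVT_iff hU _).2 ⟨fun m hm => (h1 m hm).1, h2⟩, ?_⟩
  intro U' hU' hUU w hw m hm
  have hw' := (T.smoothVT_iff hU' _).1 hw
  have k1 := contMDiffAt_pi_space.1 (hw'.1 m hm)
  have k2 := contMDiffAt_pi_space.1 (h1 m (hUU hm)).2
  have k3 := (h3 U' hU' hUU _ hw'.2).contMDiffAt (hU'.mem_nhds hm)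
  have k4 : ContMDiffAt (𝓡 n) 𝓘(ℝ, ℝ) ∞ (fun m' => (∑ k, T.coordDual m m'
      (projFst _ _ (a m')).2 k * T.coord m m' (w m').1 k) +
      (projSnd _ _ (a m')).2 (w m').2) m :=
    (contMDiffAt_finsetSum fun k _ => (k2 k).mul (k1 k)).add k3
  refine (k4.congr_of_eventuallyEq ?_).contMDiffWithinAt
  filter_upwards [(T.isOpen_U m).mem_nhds (T.mem_U m)] with m' hm'
  rw [← T.apply_eq_coordDual hm']
  change (a m').2 (w m') = (a m').2 ((w m').1, 0) + (a m').2 (0, (w m').2)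
  rw [← map_add]
  simp

/-- Smoothness of sections of `V ⊕ T_M ⊕ V^∨ ⊕ T_M^∨` in the coordinates on `V` and `V^∨`. -/
theorem smoothDbl_iff {U : Set M} (hU : IsOpen U) (a : ∀ m, Dbl (T.VT m)) :
    SmoothDbl (EuclideanSpace ℝ (Fin n)) T.SmoothVT U a ↔
      (∀ c, ∀ m ∈ U ∩ T.U c,
        ContMDiffAt (𝓡 n) 𝓘(ℝ, Rn n) ∞ (fun m' => T.coord c m' (projFst _ _ (a m')).1) m ∧
        ContMDiffAt (𝓡 n) 𝓘(ℝ, Rn n) ∞ (fun m' => T.coordDual c m' (projFst _ _ (a m')).2) m) ∧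
      SmoothTT U (fun m => projSnd _ _ (a m)) := by
  constructor
  · rintro ⟨h1, h2⟩
    have h1' := (T.smoothVT_iff hU _).1 h1
    refine ⟨fun c m hm => ⟨T.coord_contMDiffAt_change (T.mem_U m) hm.2 (h1'.1 m hm.1), ?_⟩,
      h1'.2, ?_⟩
    · refine contMDiffAt_pi_space.2 fun k => ?_
      have hV : IsOpen (U ∩ T.U c) := hU.inter (T.isOpen_U c)
      -- Evaluation on the `k`-th vector of the local frame isolates the `k`-th dual coordinate.
      have h3 := h2 _ hV inter_subset_left (fun m => (T.frame c k m, 0))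
        ((T.smoothVT_iff hV _).2 ⟨fun m hm => T.contMDiffAt_coord_frame hm.2 (T.mem_U m) k,
          smoothVF_zero _⟩)
      exact h3.contMDiffAt (hV.mem_nhds hm)
    · intro U' hU' hUU w hw
      exact h2 U' hU' hUU _ (T.smoothVT_inr hU' hw)
  · rintro ⟨h1, h2⟩
    exact T.smoothDbl_of hU a (fun m hm => h1 m m ⟨hm, T.mem_U m⟩) h2

theorem smooth_inclSnd {U : Set M} (hU : IsOpen U)
    {a : ∀ m : M, TT (EuclideanSpace ℝ (Fin n)) m} (ha : SmoothTT U a) :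
    SmoothDbl (EuclideanSpace ℝ (Fin n)) T.SmoothVT U (fun m => inclSnd _ _ (a m)) :=
  ⟨T.smoothVT_inr hU ha.1, fun U' hU' hUU _ hw => ha.2 U' hU' hUU _ hw.2⟩

theorem smoothDual_zero {E : Type*} [NormedAddCommGroup E] [NormedSpace ℝ E]
    {N : Type*} [TopologicalSpace N] [ChartedSpace E N]
    {W : N → Type*} [∀ x, AddCommGroup (W x)] [∀ x, Module ℝ (W x)] [∀ x, TopologicalSpace (W x)]
    (S : Set N → (∀ x, W x) → Prop) (U : Set N) :
    SmoothDual E S U (fun x => (0 : W x →L[ℝ] ℝ)) :=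
  fun _ _ _ _ _ => contMDiffOn_const

theorem smooth_inclFst {U : Set M} (hU : IsOpen U) {σ : ∀ m, T.V m}
    (hσ : ∀ m ∈ U, ContMDiffAt (𝓡 n) 𝓘(ℝ, Rn n) ∞ (fun m' => T.coord m m' (σ m')) m) :
    SmoothDbl (EuclideanSpace ℝ (Fin n)) T.SmoothVT U
      (fun m => inclFst _ (TangentSpace (𝓡 n) m) (σ m, 0)) := by
  refine ⟨(T.smoothVT_iff hU _).2 ⟨hσ, smoothVF_zero _⟩, ?_⟩
  intro _ _ _ _ _
  exact contMDiffOn_const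

/-! ### The connection -/

/-- The definition of `nabla` at `m` uses the trivialization around `m` and so changes with the
point. Since transition matrices are locally constant, the derivative may be taken in any fixed
trivialization; this is what allows `∇` to be differentiated a second time. -/
theorem coord_nabla {c m : M} (hm : m ∈ T.U c) {σ : ∀ m, T.V m}
    (hσ : MDifferentiableAt (𝓡 n) 𝓘(ℝ, Rn n) (fun m' => T.coord c m' (σ m')) m)
    (u : TangentSpace (𝓡 n) m) :
    T.coord c m (T.nabla σ m u) = dirDeriv (fun m' => T.coord c m' (σ m')) m u := by
  obtain ⟨A, hA⟩ := T.eventually_coord_change (T.mem_U m) hm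
  have h1 : (fun m' => T.coord m m' (σ m')) =ᶠ[𝓝 m] fun m' => intActL A (T.coord c m' (σ m')) :=
    hA.mono fun m' h => h _
  have h2 : dirDeriv (fun m' => T.coord m m' (σ m')) m u =
      intActL A (dirDeriv (fun m' => T.coord c m' (σ m')) m u) := by
    rw [dirDeriv_congr h1]
    have h3 : HasMFDerivAt 𝓘(ℝ, Rn n) 𝓘(ℝ, Rn n) (intActL A) (T.coord c m (σ m)) (intActL A) :=
      (intActL A).hasFDerivAt.hasMFDerivAt
    exact DFunLike.congr_fun (h3.comp m hσ.hasMFDerivAt).mfderiv u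
  have h4 : T.coord m m (T.nabla σ m u) = dirDeriv (fun m' => T.coord m m' (σ m')) m u :=
    T.coord_symm m m (T.mem_U m) _
  have h5 : T.coord m m ((T.coordEquiv c m hm).symm
      (dirDeriv (fun m' => T.coord c m' (σ m')) m u)) =
      intActL A (dirDeriv (fun m' => T.coord c m' (σ m')) m u) := by
    rw [hA.self_of_nhds, T.coord_symm]
  rw [T.coord_injective (T.mem_U m) (h4.trans (h2.trans h5.symm)), T.coord_symm]

theorem coord_nabla_self (σ : ∀ m, T.V m) (m : M) (u : TangentSpace (𝓡 n) m) :
    T.coord m m (T.nabla σ m u) = dirDeriv (fun m' => T.coord m m' (σ m')) m u :=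
  T.coord_symm m m (T.mem_U m) _

theorem nabla_congr {σ σ' : ∀ m, T.V m} {m : M} (h : ∀ᶠ m' in 𝓝 m, σ m' = σ' m')
    (u : TangentSpace (𝓡 n) m) : T.nabla σ m u = T.nabla σ' m u := by
  apply T.coord_injective (T.mem_U m)
  rw [T.coord_nabla_self, T.coord_nabla_self]
  exact dirDeriv_congr (h.mono fun m' h => congrArg _ h) u

end TorusBundle

namespace TorusBundle

variable {n : ℕ} {M : Type*} [TopologicalSpace M] [ChartedSpace (EuclideanSpace ℝ (Fin n)) M]
  [IsManifold (𝓡 n) ∞ M]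
  {EZ : Type*} [NormedAddCommGroup EZ] [NormedSpace ℝ EZ]
  {Z : Type*} [TopologicalSpace Z] [ChartedSpace EZ Z] [IsManifold 𝓘(ℝ, EZ) ∞ Z]
  (T : TorusBundle n M EZ Z) {J : ∀ z : Z, TT EZ z →ₗ[ℝ] TT EZ z}
  {Jb : ∀ m, Dbl (T.VT m) →ₗ[ℝ] Dbl (T.VT m)}

/-! ### The isomorphism `V ⊕ V^∨ ≅ T_M ⊕ T_M^∨` -/

/-- The map `V ⊕ V^∨ → T_M ⊕ T_M^∨` given by `J̲`. -/
def toTM (Jb : ∀ m, Dbl (T.VT m) →ₗ[ℝ] Dbl (T.VT m)) (m : M) :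
    Dbl (T.V m) →ₗ[ℝ] TT (EuclideanSpace ℝ (Fin n)) m :=
  (projSnd (T.V m) (TangentSpace (𝓡 n) m)).comp ((Jb m).comp (inclFst _ _))

/-- The map `T_M ⊕ T_M^∨ → V ⊕ V^∨` given by `-J̲`. -/
def ofTM (Jb : ∀ m, Dbl (T.VT m) →ₗ[ℝ] Dbl (T.VT m)) (m : M) :
    TT (EuclideanSpace ℝ (Fin n)) m →ₗ[ℝ] Dbl (T.V m) :=
  (projFst (T.V m) (TangentSpace (𝓡 n) m)).comp ((-Jb m).comp (inclSnd _ _))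

theorem _root_.TorusMirror.projSnd_inclSnd {A B : Type*} [AddCommGroup A] [Module ℝ A]
    [TopologicalSpace A] [AddCommGroup B] [Module ℝ B] [TopologicalSpace B] (b : Dbl B) :
    projSnd A B (inclSnd A B b) = b := by
  refine Prod.ext rfl ?_
  ext w; rfl

theorem _root_.TorusMirror.projFst_inclFst {A B : Type*} [AddCommGroup A] [Module ℝ A]
    [TopologicalSpace A] [AddCommGroup B] [Module ℝ B] [TopologicalSpace B] (a : Dbl A) :
    projFst A B (inclFst A B a) = a := by
  refine Prod.ext rfl ?_
  ext w; rfl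

theorem _root_.TorusMirror.pairing_inclFst {A B : Type*} [AddCommGroup A] [Module ℝ A]
    [TopologicalSpace A] [AddCommGroup B] [Module ℝ B] [TopologicalSpace B] (a b : Dbl A) :
    pairing (inclFst A B a) (inclFst A B b) = pairing a b := rfl

theorem _root_.TorusMirror.pairing_inclSnd {A B : Type*} [AddCommGroup A] [Module ℝ A]
    [TopologicalSpace A] [AddCommGroup B] [Module ℝ B] [TopologicalSpace B] (a b : Dbl B) :
    pairing (inclSnd A B a) (inclSnd A B b) = pairing a b := rfl

namespace IsSemiFlat

variable {T}
variable (hJ : T.IsSemiFlat J Jb)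

include hJ

/-- Because `Jb` is adapted, the image already lies in `T_M ⊕ T_M^∨`, so the projection in `toTM`
loses nothing. -/
theorem map_inclFst (m : M) (x : Dbl (T.V m)) :
    Jb m (inclFst _ _ x) = inclSnd _ _ (T.toTM Jb m x) := by
  have h : Jb m (inclFst _ _ x) ∈ LinearMap.range (inclSnd (T.V m) (TangentSpace (𝓡 n) m)) := by
    rw [← hJ.adapted m]
    exact ⟨_, ⟨x, rfl⟩, rfl⟩
  obtain ⟨b, hb⟩ := h
  have : T.toTM Jb m x = b := by
    change projSnd _ _ (Jb m (inclFst _ _ x)) = b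
    rw [← hb, projSnd_inclSnd]
  rw [this, hb]

/-- Every element of `T_M ⊕ T_M^∨` is the image under `Jb` of some `x` in `V ⊕ V^∨`; applying `Jb`
once more gives `-x`. -/
theorem map_inclSnd (m : M) (a : TT (EuclideanSpace ℝ (Fin n)) m) :
    Jb m (inclSnd _ _ a) = -inclFst _ _ (T.ofTM Jb m a) := by
  have h : inclSnd _ _ a ∈ (LinearMap.range (inclFst (T.V m) (TangentSpace (𝓡 n) m))).map
      (Jb m) := by
    rw [hJ.adapted m]
    exact ⟨a, rfl⟩
  obtain ⟨_, ⟨x, rfl⟩, hx⟩ := h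
  have h1 : Jb m (inclSnd _ _ a) = -inclFst _ _ x := by
    rw [← hx, hJ.genAlmostComplex.sq]
  have : T.ofTM Jb m a = x := by
    change projFst _ _ (-(Jb m (inclSnd _ _ a))) = x
    rw [h1, neg_neg, projFst_inclFst]
  rw [this, h1]

theorem ofTM_toTM (m : M) (x : Dbl (T.V m)) : T.ofTM Jb m (T.toTM Jb m x) = x := by
  change projFst _ _ (-(Jb m (inclSnd _ _ (T.toTM Jb m x)))) = x
  rw [← hJ.map_inclFst, hJ.genAlmostComplex.sq, neg_neg, projFst_inclFst]

theorem toTM_ofTM (m : M) (a : TT (EuclideanSpace ℝ (Fin n)) m) :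
    T.toTM Jb m (T.ofTM Jb m a) = a := by
  have h := congrArg (Jb m) (hJ.map_inclSnd m a)
  rw [hJ.genAlmostComplex.sq, map_neg, neg_inj] at h
  change projSnd _ _ (Jb m (inclFst _ _ (T.ofTM Jb m a))) = a
  rw [← h, projSnd_inclSnd]

theorem pairing_toTM (m : M) (x y : Dbl (T.V m)) :
    pairing (T.toTM Jb m x) (T.toTM Jb m y) = pairing x y := by
  rw [← pairing_inclSnd (A := T.V m), ← hJ.map_inclFst, ← hJ.map_inclFst,
    hJ.genAlmostComplex.orth, pairing_inclFst]

theorem pairing_ofTM (m : M) (a b : TT (EuclideanSpace ℝ (Fin n)) m) :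
    pairing (T.ofTM Jb m a) (T.ofTM Jb m b) = pairing a b := by
  rw [← hJ.pairing_toTM, hJ.toTM_ofTM, hJ.toTM_ofTM]

theorem mem_Delta_iff {m : M} {a : TT (EuclideanSpace ℝ (Fin n)) m} :
    a ∈ T.Delta Jb m ↔ (T.ofTM Jb m a).2 = 0 := by
  constructor
  · rintro ⟨_, ⟨v, rfl⟩, hv⟩
    have hv' : Jb m (inclFst _ _ (v, 0)) = inclSnd _ _ a := hv
    rw [hJ.map_inclFst] at hv'
    have h := congrArg (projSnd _ _) hv'
    rw [projSnd_inclSnd, projSnd_inclSnd] at h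
    rw [← h, hJ.ofTM_toTM]
  · intro h
    refine ⟨_, ⟨(T.ofTM Jb m a).1, rfl⟩, ?_⟩
    change Jb m (inclFst _ _ ((T.ofTM Jb m a).1, 0)) = inclSnd _ _ a
    rw [← h, Prod.mk.eta, hJ.map_inclFst, hJ.toTM_ofTM]

theorem mem_DeltaHat_iff {m : M} {a : TT (EuclideanSpace ℝ (Fin n)) m} :
    a ∈ T.DeltaHat Jb m ↔ (T.ofTM Jb m a).1 = 0 := by
  constructor
  · rintro ⟨_, ⟨v, rfl⟩, hv⟩
    have hv' : Jb m (inclFst _ _ (0, v)) = inclSnd _ _ a := hv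
    rw [hJ.map_inclFst] at hv'
    have h := congrArg (projSnd _ _) hv'
    rw [projSnd_inclSnd, projSnd_inclSnd] at h
    rw [← h, hJ.ofTM_toTM]
  · intro h
    refine ⟨_, ⟨(T.ofTM Jb m a).2, rfl⟩, ?_⟩
    change Jb m (inclFst _ _ (0, (T.ofTM Jb m a).2)) = inclSnd _ _ a
    rw [← h, Prod.mk.eta, hJ.map_inclFst, hJ.toTM_ofTM]

theorem toTM_mem_Delta (m : M) (v : T.V m) : T.toTM Jb m (v, 0) ∈ T.Delta Jb m := by
  rw [hJ.mem_Delta_iff, hJ.ofTM_toTM]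

theorem toTM_of_mem_Delta {m : M} {a : TT (EuclideanSpace ℝ (Fin n)) m}
    (ha : a ∈ T.Delta Jb m) : T.toTM Jb m ((T.ofTM Jb m a).1, 0) = a := by
  rw [← hJ.mem_Delta_iff.1 ha, Prod.mk.eta, hJ.toTM_ofTM]

theorem smooth_toTM {U : Set M} (hU : IsOpen U) {σ : ∀ m, T.V m}
    (hσ : ∀ m ∈ U, ContMDiffAt (𝓡 n) 𝓘(ℝ, Rn n) ∞ (fun m' => T.coord m m' (σ m')) m) :
    SmoothTT U (fun m => T.toTM Jb m (σ m, 0)) :=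
  ((T.smoothDbl_iff hU _).1
    (hJ.genAlmostComplex.smooth U hU _ (T.smooth_inclFst hU hσ))).2

theorem smooth_inclFst_ofTM {U : Set M} (hU : IsOpen U)
    {a : ∀ m : M, TT (EuclideanSpace ℝ (Fin n)) m} (ha : SmoothTT U a) :
    SmoothDbl (EuclideanSpace ℝ (Fin n)) T.SmoothVT U
      (fun m => inclFst _ (TangentSpace (𝓡 n) m) (T.ofTM Jb m (a m))) := by
  have h := hJ.genAlmostComplex.smooth U hU _ (T.smooth_inclSnd hU ha)
  have h1 := (T.smoothDbl_iff hU _).1 h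
  refine (T.smoothDbl_iff hU _).2 ⟨fun c m hm => ?_, ?_⟩
  · obtain ⟨h2, h3⟩ := h1.1 c m hm
    -- `h2` and `h3` concern `Jb`, while `ofTM` is its negative; the sign is moved through the
    -- coordinates.
    simp only [hJ.map_inclSnd, map_neg, projFst_inclFst] at h2 h3
    simp only [projFst_inclFst]
    constructor
    · refine (h2.neg).congr_of_eventuallyEq (Eventually.of_forall fun m' => ?_)
      change _ = - T.coord c m' (-(T.ofTM Jb m' (a m')).1)
      rw [map_neg, neg_neg]
    · refine (h3.neg).congr_of_eventuallyEq (Eventually.of_forall fun m' => ?_)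
      ext k
      change _ = - (-((T.ofTM Jb m' (a m')).2) _)
      rw [neg_neg]
      rfl
  · refine ⟨smoothVF_zero _, ?_⟩
    have : (fun m => (projSnd (T.V m) (TangentSpace (𝓡 n) m)
        (inclFst _ _ (T.ofTM Jb m (a m)))).2) = fun m => 0 := by
      funext m; ext w
      exact map_zero (T.ofTM Jb m (a m)).2
    rw [this]
    exact smoothDual_zero _ _

theorem smooth_ofTM_fst {U : Set M} (hU : IsOpen U)
    {a : ∀ m : M, TT (EuclideanSpace ℝ (Fin n)) m} (ha : SmoothTT U a) {c m : M}
    (hm : m ∈ U ∩ T.U c) :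
    ContMDiffAt (𝓡 n) 𝓘(ℝ, Rn n) ∞ (fun m' => T.coord c m' (T.ofTM Jb m' (a m')).1) m := by
  have h := (((T.smoothDbl_iff hU _).1 (hJ.smooth_inclFst_ofTM hU ha)).1 c m hm).1
  simpa only [projFst_inclFst] using h

/-! ### `Δ` is an almost Dirac structure -/

/-- Under the isometry `ofTM` all three properties become properties of `V` inside `V ⊕ V^∨`: it is
isotropic, it is its own orthogonal complement, and it has smooth local frames. -/
theorem isAlmostDirac_Delta : IsAlmostDirac (T.Delta Jb) where
  isotropic m a ha b hb := by
    rw [← hJ.pairing_ofTM, pairing, hJ.mem_Delta_iff.1 ha, hJ.mem_Delta_iff.1 hb]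
    simp
  maximal m K hK hle := by
    refine le_antisymm (fun a ha => ?_) hle
    rw [hJ.mem_Delta_iff]
    ext v
    -- An element of an isotropic `K` containing `Δ` is orthogonal to the image of every `v` in `V`;
    -- this says that its `V^∨` component kills `v`.
    have h := hK a ha _ (hle (hJ.toTM_mem_Delta m v))
    rw [← hJ.pairing_ofTM, hJ.ofTM_toTM, pairing] at h
    have h0 : (0 : T.V m →L[ℝ] ℝ) (T.ofTM Jb m a).1 = 0 := rfl
    simp only [h0, add_zero] at h
    have h1 : (T.ofTM Jb m a).2 v = 0 := by linarith
    exact h1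
  subbundle c := by
    refine ⟨T.U c, T.isOpen_U c, T.mem_U c, n, fun k m => T.toTM Jb m (T.frame c k m, 0),
      fun k => hJ.smooth_toTM (T.isOpen_U c) fun m hm =>
        T.contMDiffAt_coord_frame hm (T.mem_U m) k, fun m hm => ?_⟩
    let b : Module.Basis (Fin n) ℝ (T.V m) :=
      (Pi.basisFun ℝ (Fin n)).map (T.coordEquiv c m hm).symm.toLinearEquiv
    let L : T.V m →ₗ[ℝ] TT (EuclideanSpace ℝ (Fin n)) m :=
      (T.toTM Jb m).comp (LinearMap.inl ℝ _ _)
    have hb : (fun k => T.toTM Jb m (T.frame c k m, 0)) = L ∘ b := by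
      funext k
      have : T.frame c k m = b k := by
        rw [frame, T.coord_inverse c m hm]
        simp [b]
      rw [this]; rfl
    have hL : Function.Injective L := by
      intro v w h
      have h1 := congrArg (T.ofTM Jb m) h
      change T.ofTM Jb m (T.toTM Jb m (v, 0)) = T.ofTM Jb m (T.toTM Jb m (w, 0)) at h1
      rw [hJ.ofTM_toTM, hJ.ofTM_toTM] at h1
      exact congrArg Prod.fst h1
    rw [hb]
    refine ⟨b.linearIndependent.map' L (LinearMap.ker_eq_bot.2 hL), ?_⟩
    rw [range_comp, ← Submodule.map_span, b.span_eq, Submodule.map_top]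
    refine le_antisymm ?_ fun a ha => ⟨_, hJ.toTM_of_mem_Delta ha⟩
    rintro _ ⟨v, rfl⟩
    exact hJ.toTM_mem_Delta m v

/-! ### The flat connection on `Δ` -/

omit hJ in
theorem connDelta_eq (a : ∀ m : M, TT (EuclideanSpace ℝ (Fin n)) m) (m : M)
    (u : TangentSpace (𝓡 n) m) : T.connDelta Jb a m u =
      T.toTM Jb m (T.nabla (fun m' => (T.ofTM Jb m' (a m')).1) m u, 0) := rfl

omit hJ in
theorem toTM_inl_eq {m : M} {v w : T.V m} (h : v = w) :
    T.toTM Jb m (v, 0) = T.toTM Jb m (w, 0) := by rw [h]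

omit hJ in
theorem toTM_inl_add (m : M) (v w : T.V m) :
    T.toTM Jb m (v + w, 0) = T.toTM Jb m (v, 0) + T.toTM Jb m (w, 0) := by
  rw [← map_add]; simp

omit hJ in
theorem toTM_inl_smul (m : M) (r : ℝ) (v : T.V m) :
    T.toTM Jb m (r • v, 0) = r • T.toTM Jb m (v, 0) := by
  rw [← map_smul]; simp

theorem mdifferentiableAt_ofTM {U : Set M} (hU : IsOpen U)
    {a : ∀ m : M, TT (EuclideanSpace ℝ (Fin n)) m} (ha : SmoothTT U a) {c m : M}
    (hm : m ∈ U ∩ T.U c) : MDifferentiableAt (𝓡 n) 𝓘(ℝ, Rn n)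
      (fun m' => T.coord c m' (T.ofTM Jb m' (a m')).1) m :=
  (hJ.smooth_ofTM_fst hU ha hm).mdifferentiableAt (by simp)

theorem smooth_nabla {U : Set M} (hU : IsOpen U)
    {a : ∀ m : M, TT (EuclideanSpace ℝ (Fin n)) m} (ha : SmoothTT U a)
    {X : ∀ m : M, TangentSpace (𝓡 n) m} (hX : SmoothVF U X) {c m : M} (hm : m ∈ U ∩ T.U c) :
    ContMDiffAt (𝓡 n) 𝓘(ℝ, Rn n) ∞ (fun m' => T.coord c m'
      (T.nabla (fun m' => (T.ofTM Jb m' (a m')).1) m' (X m'))) m := by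
  have h := contMDiffAt_mfderiv_apply (g := fun m : M => m) (hJ.smooth_ofTM_fst hU ha hm)
    ((smoothVF_iff hU).1 hX m hm.1)
  refine h.congr_of_eventuallyEq ?_
  filter_upwards [(hU.inter (T.isOpen_U c)).mem_nhds hm] with m' hm'
  exact T.coord_nabla hm'.2 (hJ.mdifferentiableAt_ofTM hU ha hm') _

theorem isSection_connDelta {U : Set M} (hU : IsOpen U)
    {a : ∀ m : M, TT (EuclideanSpace ℝ (Fin n)) m} (ha : IsSection (T.Delta Jb) U a)
    {X : ∀ m : M, TangentSpace (𝓡 n) m} (hX : SmoothVF U X) :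
    IsSection (T.Delta Jb) U (fun m => T.connDelta Jb a m (X m)) :=
  ⟨hJ.smooth_toTM hU fun m hm => hJ.smooth_nabla hU ha.1 hX ⟨hm, T.mem_U m⟩,
    fun m _ => hJ.toTM_mem_Delta m _⟩

/-- In coordinates on `V` the connection is `dirDeriv`, applied to the `ℝ^n`-valued function that
represents the section, so each axiom is a rule for derivatives of functions. -/
theorem isFlatConnection_Delta : IsFlatConnection (T.Delta Jb) (T.connDelta Jb) where
  congr U hU a b _ _ hab m hm u := by
    rw [connDelta_eq, connDelta_eq]
    refine toTM_inl_eq (T.nabla_congr ?_ u)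
    filter_upwards [hU.mem_nhds hm] with m' hm'
    rw [hab m' hm']
  isSection U hU a X ha hX := hJ.isSection_connDelta hU ha hX
  linear U hU a _ m _ s t u v := by
    simp only [connDelta_eq]
    rw [← toTM_inl_smul, ← toTM_inl_smul, ← toTM_inl_add]
    refine toTM_inl_eq ?_
    apply T.coord_injective (T.mem_U m)
    rw [map_add, map_smul, map_smul]
    simp only [coord_nabla_self]
    exact dirDeriv_linear _ _ _ _ _ _
  add U hU a b ha hb m hm u := by
    simp only [connDelta_eq]
    rw [← toTM_inl_add]
    refine toTM_inl_eq ?_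
    apply T.coord_injective (T.mem_U m)
    rw [map_add]
    simp only [coord_nabla_self]
    have h3 : (fun m' => T.coord m m' (T.ofTM Jb m' (a m' + b m')).1) =
        fun m' => T.coord m m' (T.ofTM Jb m' (a m')).1 +
          T.coord m m' (T.ofTM Jb m' (b m')).1 := by
      funext m'
      rw [map_add]
      exact map_add _ _ _
    rw [h3]
    exact dirDeriv_add (hJ.mdifferentiableAt_ofTM hU ha.1 ⟨hm, T.mem_U m⟩)
      (hJ.mdifferentiableAt_ofTM hU hb.1 ⟨hm, T.mem_U m⟩) u
  leibniz U hU f a hf ha m hm u := by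
    -- Membership in `Δ` enters here: the undifferentiated term `a m` must be the image of its `V`
    -- component alone.
    have h0 := hJ.toTM_of_mem_Delta (ha.2 m hm)
    change _ = dirDeriv f m u • a m + _
    conv_rhs => rw [← h0]
    simp only [connDelta_eq]
    rw [← toTM_inl_smul, ← toTM_inl_smul, ← toTM_inl_add]
    refine toTM_inl_eq ?_
    apply T.coord_injective (T.mem_U m)
    rw [map_add, map_smul, map_smul]
    simp only [coord_nabla_self]
    have h3 : (fun m' => T.coord m m' (T.ofTM Jb m' (f m' • a m')).1) =
        fun m' => f m' • T.coord m m' (T.ofTM Jb m' (a m')).1 := by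
      funext m'
      rw [map_smul]
      exact map_smul _ _ _
    rw [h3]
    exact dirDeriv_smul (((hf m hm).contMDiffAt (hU.mem_nhds hm)).mdifferentiableAt (by simp))
      (hJ.mdifferentiableAt_ofTM hU ha.1 ⟨hm, T.mem_U m⟩) u
  flat U hU a X Y ha hX hY m hm := by
    simp only [connDelta_eq, hJ.ofTM_toTM]
    have h1 := dirDeriv_dirDeriv_sub (hU.inter (T.isOpen_U m)) ⟨hm, T.mem_U m⟩
      (fun m' hm' => (hJ.smooth_ofTM_fst hU ha.1 hm').contMDiffWithinAt)
      (hX.mono inter_subset_left) (hY.mono inter_subset_left)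
    -- The inner covariant derivative at `m'` is defined by the trivialization around `m'`; it is
    -- rewritten in the fixed one around `m` before the outer derivative is taken.
    have key : ∀ {W : ∀ m : M, TangentSpace (𝓡 n) m} (u : TangentSpace (𝓡 n) m),
        T.coord m m (T.nabla
          (fun m' => T.nabla (fun m' => (T.ofTM Jb m' (a m')).1) m' (W m')) m u) =
        dirDeriv (fun m' => dirDeriv (fun m'' => T.coord m m'' (T.ofTM Jb m'' (a m'')).1) m' (W m'))
          m u := by
      intro W u
      rw [coord_nabla_self]
      refine dirDeriv_congr ?_ u
      filter_upwards [(hU.inter (T.isOpen_U m)).mem_nhds ⟨hm, T.mem_U m⟩] with m' hm'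
      exact T.coord_nabla hm'.2 (hJ.mdifferentiableAt_ofTM hU ha.1 hm') _
    rw [← key, ← key, ← coord_nabla_self, ← map_sub, sub_eq_zero.symm] at h1
    have h2 := T.coord_injective (T.mem_U m) (sub_eq_zero.1 h1)
    rw [← h2, sub_eq_zero, sub_eq_iff_eq_add, ← toTM_inl_add, sub_add_cancel]

end IsSemiFlat

end TorusBundle

namespace TorusBundle

/-! ### Torus bundles in duality -/

section Duality

variable {n : ℕ} {M : Type*} [TopologicalSpace M] [ChartedSpace (EuclideanSpace ℝ (Fin n)) M]
  {EZ : Type*} [NormedAddCommGroup EZ] [NormedSpace ℝ EZ]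
  {Z : Type*} [TopologicalSpace Z] [ChartedSpace EZ Z]
  {EZ' : Type*} [NormedAddCommGroup EZ'] [NormedSpace ℝ EZ']
  {Z' : Type*} [TopologicalSpace Z'] [ChartedSpace EZ' Z']
  [IsManifold (𝓡 n) ∞ M] [IsManifold 𝓘(ℝ, EZ) ∞ Z] [IsManifold 𝓘(ℝ, EZ') ∞ Z']
  (T : TorusBundle n M EZ Z) (T' : TorusBundle n M EZ' Z')

/-- The coordinates given by the local trivializations of the two bundles pair to a bilinear form
that does not depend on the local trivialization. -/
def InDuality : Prop :=
  ∀ c c' m, m ∈ T.U c → m ∈ T'.U c → m ∈ T.U c' → m ∈ T'.U c' → ∀ v w,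
    T.coord c m v ⬝ᵥ T'.coord c m w = T.coord c' m v ⬝ᵥ T'.coord c' m w

/-- The duality transformation at `m`. -/
abbrev shuffleAt (m : M) : Dbl (T.VT m) →ₗ[ℝ] Dbl (T'.VT m) :=
  shuffle (T.coordEquiv m m (T.mem_U m)) (T'.coordEquiv m m (T'.mem_U m))

variable {T T'}

/-- The relation is symmetric in the two bundles, so the transformation from the dual bundle back to
`T` obeys the same lemmas and no identification of the double dual is needed. -/
theorem InDuality.symm (h : InDuality T T') : InDuality T' T := by
  intro c c' m h1 h2 h3 h4 v w
  rw [dotProduct_comm, h c c' m h2 h1 h4 h3, dotProduct_comm]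

theorem projSnd_shuffleAt (m : M) (a : Dbl (T.VT m)) :
    projSnd _ _ (shuffleAt T T' m a) = projSnd _ _ a := by
  refine Prod.ext rfl ?_
  ext w
  change dotL (T.coord m m a.1.1) (T'.coord m m 0) + a.2 (0, w) = a.2 (0, w)
  rw [map_zero, map_zero, zero_add]

theorem coord_shuffleAt_self (m : M) (a : Dbl (T.VT m)) :
    T'.coord m m (projFst _ _ (shuffleAt T T' m a)).1 = T.coordDual m m (projFst _ _ a).2 := by
  refine (T'.coord_symm m m (T'.mem_U m) _).trans ?_
  funext k
  rw [coordDual_apply, T.coord_inverse m m (T.mem_U m)]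
  rfl

theorem shuffleAt_snd_apply (m : M) (a : Dbl (T.VT m)) (w : T'.V m) :
    (projFst _ _ (shuffleAt T T' m a)).2 w = T.coord m m (projFst _ _ a).1 ⬝ᵥ T'.coord m m w := by
  change dotL (T.coord m m a.1.1) (T'.coord m m w) + a.2 (0, 0) = _
  rw [dotL_apply]
  have : a.2 ((0 : T.V m), (0 : TangentSpace (𝓡 n) m)) = 0 := map_zero a.2
  rw [this, add_zero]
  rfl

theorem apply_eq_dotProduct {c m : M} (hm : m ∈ T.U c) (α : T.V m →L[ℝ] ℝ) (v : T.V m) :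
    α v = T.coord c m v ⬝ᵥ T.coordDual c m α := by
  rw [T.apply_eq_coordDual hm, dotProduct]
  exact Finset.sum_congr rfl fun k _ => mul_comm _ _

theorem coordDual_eq_of {c m : M} (hm : m ∈ T.U c) {α : T.V m →L[ℝ] ℝ} {η : Rn n}
    (h : ∀ v, α v = T.coord c m v ⬝ᵥ η) : T.coordDual c m α = η := by
  funext k
  rw [coordDual_apply]
  have h1 := h (T.frame c k m)
  rw [T.coord_frame hm, single_one_dotProduct] at h1
  exact h1

/-- The transformation at `m` is defined by the trivializations around `m`. Invariance of the
pairing gives the same formula in every trivialization `c`, and hence on a neighbourhood with `c`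
fixed, as smoothness and derivatives require. -/
theorem InDuality.coord_shuffleAt (h : InDuality T T') {c m : M} (hm : m ∈ T.U c)
    (hm' : m ∈ T'.U c) (a : Dbl (T.VT m)) :
    T'.coord c m (projFst _ _ (shuffleAt T T' m a)).1 = T.coordDual c m (projFst _ _ a).2 := by
  refine (coordDual_eq_of hm fun v => ?_).symm
  rw [h c m m hm hm' (T.mem_U m) (T'.mem_U m), coord_shuffleAt_self,
    apply_eq_dotProduct (T.mem_U m)]

theorem InDuality.coordDual_shuffleAt (h : InDuality T T') {c m : M} (hm : m ∈ T.U c)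
    (hm' : m ∈ T'.U c) (a : Dbl (T.VT m)) :
    T'.coordDual c m (projFst _ _ (shuffleAt T T' m a)).2 = T.coord c m (projFst _ _ a).1 := by
  refine coordDual_eq_of hm' fun w => ?_
  rw [shuffleAt_snd_apply, h m c m (T.mem_U m) (T'.mem_U m) hm hm', dotProduct_comm]

/-- Elements of `V ⊕ T_M ⊕ V^∨ ⊕ T_M^∨` are determined by their coordinates. -/
theorem dbl_ext {c m : M} (hm : m ∈ T.U c) {a b : Dbl (T.VT m)}
    (h1 : T.coord c m (projFst _ _ a).1 = T.coord c m (projFst _ _ b).1)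
    (h2 : T.coordDual c m (projFst _ _ a).2 = T.coordDual c m (projFst _ _ b).2)
    (h3 : projSnd _ _ a = projSnd _ _ b) : a = b := by
  have k1 : a.1.1 = b.1.1 := T.coord_injective hm h1
  have k2 : (projFst _ _ a).2 = (projFst _ _ b).2 := by
    ext v
    rw [apply_eq_dotProduct hm, h2, ← apply_eq_dotProduct hm]
  refine Prod.ext (Prod.ext k1 (congrArg Prod.fst h3)) ?_
  ext v
  · exact DFunLike.congr_fun k2 v
  · exact DFunLike.congr_fun (congrArg Prod.snd h3) v

theorem InDuality.shuffleAt_shuffleAt (h : InDuality T T') (m : M) (a : Dbl (T.VT m)) :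
    shuffleAt T' T m (shuffleAt T T' m a) = a := by
  refine dbl_ext (T.mem_U m) ?_ ?_ ?_
  · rw [h.symm.coord_shuffleAt (T'.mem_U m) (T.mem_U m),
      h.coordDual_shuffleAt (T.mem_U m) (T'.mem_U m)]
  · rw [h.symm.coordDual_shuffleAt (T'.mem_U m) (T.mem_U m),
      h.coord_shuffleAt (T.mem_U m) (T'.mem_U m)]
  · rw [projSnd_shuffleAt, projSnd_shuffleAt]

theorem dbl_apply (m : M) (a : Dbl (T.VT m)) (v : T.VT m) :
    a.2 v = T.coord m m v.1 ⬝ᵥ T.coordDual m m (projFst _ _ a).2 + (projSnd _ _ a).2 v.2 := by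
  rw [← apply_eq_dotProduct (T.mem_U m)]
  change a.2 v = a.2 (v.1, 0) + a.2 (0, v.2)
  rw [← map_add]
  simp

/-- Exchanging `V` and `V^∨` interchanges the two `V`-terms of the symmetric pairing and leaves
those from `T_M` unchanged. -/
theorem InDuality.pairing_shuffleAt (h : InDuality T T') (m : M) (a b : Dbl (T.VT m)) :
    pairing (shuffleAt T T' m a) (shuffleAt T T' m b) = pairing a b := by
  have e : ∀ a b : Dbl (T.VT m), (shuffleAt T T' m a).2 (shuffleAt T T' m b).1 =
      T.coord m m (projFst _ _ a).1 ⬝ᵥ T.coordDual m m (projFst _ _ b).2 +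
        (projSnd _ _ a).2 (projSnd _ _ b).1 := by
    intro a b
    rw [dbl_apply, h.coordDual_shuffleAt (T.mem_U m) (T'.mem_U m), projSnd_shuffleAt,
      dotProduct_comm]
    congr 1
    exact congrArg _ (h.coord_shuffleAt (T.mem_U m) (T'.mem_U m) b)
  rw [pairing, pairing, e, e, dbl_apply m a, dbl_apply m b]
  change _ = -(1 / 2) * (T.coord m m (projFst _ _ b).1 ⬝ᵥ _ + (projSnd _ _ a).2 (projSnd _ _ b).1 +
    (T.coord m m (projFst _ _ a).1 ⬝ᵥ _ + (projSnd _ _ b).2 (projSnd _ _ a).1))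
  ring

theorem shuffleAt_inclSnd (m : M) (b : TT (EuclideanSpace ℝ (Fin n)) m) :
    shuffleAt T T' m (inclSnd _ _ b) = inclSnd _ _ b := by
  refine Prod.ext (Prod.ext ?_ rfl) ?_
  · change (T'.coordEquiv m m _).symm (fun k => b.2 0) = 0
    rw [map_zero]
    exact map_zero _
  · ext w
    · change dotL (T.coord m m 0) (T'.coord m m w) + b.2 0 = b.2 0
      rw [map_zero, dotL_apply, zero_dotProduct, zero_add]
    · change dotL (T.coord m m 0) (T'.coord m m 0) + b.2 w = b.2 w
      rw [map_zero, map_zero, map_zero, zero_add]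

/-- The duality transformation on `V ⊕ V^∨`. -/
def swapAt (T : TorusBundle n M EZ Z) (T' : TorusBundle n M EZ' Z') (m : M) (x : Dbl (T.V m)) :
    Dbl (T'.V m) :=
  projFst _ (TangentSpace (𝓡 n) m) (shuffleAt T T' m (inclFst _ _ x))

/-- Together with `shuffleAt_inclSnd`, this says that the duality transformation respects the
splitting into `V ⊕ V^∨` and `T_M ⊕ T_M^∨`, and so preserves adaptedness. -/
theorem shuffleAt_inclFst (m : M) (x : Dbl (T.V m)) :
    shuffleAt T T' m (inclFst _ _ x) = inclFst _ _ (swapAt T T' m x) := by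
  refine dbl_ext (T'.mem_U m) ?_ ?_ ?_
  · rw [projFst_inclFst]; rfl
  · rw [projFst_inclFst]; rfl
  · rw [projSnd_shuffleAt]
    refine Prod.ext rfl ?_
    ext w
    exact (map_zero x.2).trans (map_zero (swapAt T T' m x).2).symm

theorem InDuality.coord_swapAt (h : InDuality T T') {c m : M} (hm : m ∈ T.U c)
    (hm' : m ∈ T'.U c) (x : Dbl (T.V m)) :
    T'.coord c m (swapAt T T' m x).1 = T.coordDual c m x.2 := by
  refine (h.coord_shuffleAt hm hm' _).trans ?_
  rw [projFst_inclFst]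

theorem InDuality.coordDual_swapAt (h : InDuality T T') {c m : M} (hm : m ∈ T.U c)
    (hm' : m ∈ T'.U c) (x : Dbl (T.V m)) :
    T'.coordDual c m (swapAt T T' m x).2 = T.coord c m x.1 := by
  refine (h.coordDual_shuffleAt hm hm' _).trans ?_
  rw [projFst_inclFst]

theorem coordDual_zero (c m : M) : T.coordDual c m 0 = 0 := rfl

theorem coordDual_injective {c m : M} (hm : m ∈ T.U c) {α β : T.V m →L[ℝ] ℝ}
    (h : T.coordDual c m α = T.coordDual c m β) : α = β := by
  ext v
  rw [apply_eq_dotProduct hm, h, ← apply_eq_dotProduct hm]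

theorem InDuality.swapAt_fst_eq_zero (h : InDuality T T') {m : M} (x : Dbl (T.V m)) :
    (swapAt T T' m x).1 = 0 ↔ x.2 = 0 := by
  have h1 := h.coord_swapAt (T.mem_U m) (T'.mem_U m) x
  constructor
  · intro h2
    rw [h2, map_zero] at h1
    exact coordDual_injective (T.mem_U m) h1.symm
  · intro h2
    rw [h2, coordDual_zero, ← map_zero (T'.coord m m)] at h1
    exact T'.coord_injective (T'.mem_U m) h1

theorem InDuality.swapAt_snd_eq_zero (h : InDuality T T') {m : M} (x : Dbl (T.V m)) :
    (swapAt T T' m x).2 = 0 ↔ x.1 = 0 := by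
  have h1 := h.coordDual_swapAt (T.mem_U m) (T'.mem_U m) x
  constructor
  · intro h2
    rw [h2, coordDual_zero, ← map_zero (T.coord m m)] at h1
    exact T.coord_injective (T.mem_U m) h1.symm
  · intro h2
    rw [h2, map_zero] at h1
    exact coordDual_injective (T'.mem_U m) h1

/-- The counterpart of `coord_nabla_self`: in dual coordinates `∇^∨` is also plain differentiation.
Since the transformation matches dual coordinates with coordinates on the dual bundle, `∇^∨` is the
Gauss–Manin connection there. -/
theorem coordDual_nablaDual (α : ∀ m, T.V m →L[ℝ] ℝ) (m : M) (u : TangentSpace (𝓡 n) m) :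
    T.coordDual m m (T.nablaDual α m u) = dirDeriv (fun m' => T.coordDual m m' (α m')) m u := by
  refine coordDual_eq_of (T.mem_U m) fun v => ?_
  refine (dotL_apply _ _).trans ?_
  rw [dotProduct_comm]
  rfl

theorem InDuality.smooth_shuffleAt (h : InDuality T T') {U : Set M} (hU : IsOpen U)
    {a : ∀ m, Dbl (T.VT m)} (ha : SmoothDbl (EuclideanSpace ℝ (Fin n)) T.SmoothVT U a) :
    SmoothDbl (EuclideanSpace ℝ (Fin n)) T'.SmoothVT U (fun m => shuffleAt T T' m (a m)) := by
  have ha' := (T.smoothDbl_iff hU a).1 ha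
  refine T'.smoothDbl_of hU _ (fun m hm => ?_) ?_
  · obtain ⟨h1, h2⟩ := ha'.1 m m ⟨hm, T.mem_U m⟩
    have ev := ((T.isOpen_U m).inter (T'.isOpen_U m)).mem_nhds ⟨T.mem_U m, T'.mem_U m⟩
    constructor
    · refine h2.congr_of_eventuallyEq ?_
      filter_upwards [ev] with m' hm' using h.coord_shuffleAt hm'.1 hm'.2 _
    · refine h1.congr_of_eventuallyEq ?_
      filter_upwards [ev] with m' hm' using h.coordDual_shuffleAt hm'.1 hm'.2 _
  · simp only [projSnd_shuffleAt]
    exact ha'.2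

end Duality

/-! ### The mirror -/

section Mirror

variable {n : ℕ} {M : Type*} [TopologicalSpace M] [ChartedSpace (EuclideanSpace ℝ (Fin n)) M]
  [IsManifold (𝓡 n) ∞ M]
  {EZ : Type*} [NormedAddCommGroup EZ] [NormedSpace ℝ EZ]
  {Z : Type*} [TopologicalSpace Z] [ChartedSpace EZ Z]

/-- If coordinates on `V` change by `A`, those on the dual bundle change by the inverse transpose,
and `(A⁻¹)ᵀ ξ · A η = ξ · η`. -/
theorem inDuality_dual (T : TorusBundle n M EZ Z) : InDuality T T.dual := by
  intro c c' m h1 _ h2 _ v w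
  obtain ⟨A, hA⟩ := T.trans c c' m ⟨h1, h2⟩
  have h3 : ((A⁻¹).1.map (Int.cast : ℤ → ℝ)) * (A.1.map (Int.cast : ℤ → ℝ)) = 1 := by
    have h4 : ((A⁻¹).1 * A.1).map (Int.castRingHom ℝ) = 1 := by
      rw [Units.inv_mul]
      exact Matrix.map_one _ (map_zero _) (map_one _)
    rw [Matrix.map_mul] at h4
    exact h4
  have h5 : ∀ ξ η : Rn n, intAct (A⁻¹).1.transpose ξ ⬝ᵥ intAct A.1 η = ξ ⬝ᵥ η := by
    intro ξ η
    rw [intAct, intAct, Matrix.transpose_map, Matrix.mulVec_transpose, Matrix.dotProduct_mulVec,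
      Matrix.vecMul_vecMul, h3, Matrix.vecMul_one]
  have h6 : ∀ ξ, T.dual.φ c' (m, ξ) = T.dual.φ c (m, intAct (A⁻¹).1.transpose ξ) := by
    intro ξ
    have : (dotL ξ).comp (T.coord c' m) =
        (dotL (intAct (A⁻¹).1.transpose ξ)).comp (T.coord c m) := by
      ext v
      simp only [ContinuousLinearMap.comp_apply, dotL_apply,
        T.coord_change h1 h2 A.1 hA.self_of_nhds v, h5]
    change T.dualφ c' (m, ξ) = T.dualφ c (m, _)
    simp only [dualφ]
    rw [this]
  rw [T.coord_change h1 h2 A.1 hA.self_of_nhds v, T.dual.coord_change h1 h2 _ h6 w,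
    dotProduct_comm, h5, dotProduct_comm]

variable [IsManifold 𝓘(ℝ, EZ) ∞ Z] {T : TorusBundle n M EZ Z}
  {J : ∀ z : Z, TT EZ z →ₗ[ℝ] TT EZ z} {Jb : ∀ m, Dbl (T.VT m) →ₗ[ℝ] Dbl (T.VT m)}

theorem mirrorBase_apply (m : M) (a : Dbl (T.dual.VT m)) :
    T.mirrorBase Jb m a = shuffleAt T T.dual m (Jb m (shuffleAt T.dual T m a)) := rfl

namespace IsSemiFlat

variable (hJ : T.IsSemiFlat J Jb)

include hJ

theorem mirrorBase_inclFst (m : M) (x : Dbl (T.dual.V m)) :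
    T.mirrorBase Jb m (inclFst _ _ x) = inclSnd _ _ (T.toTM Jb m (swapAt T.dual T m x)) := by
  rw [mirrorBase_apply, shuffleAt_inclFst, hJ.map_inclFst, shuffleAt_inclSnd]

theorem mirrorBase_inclSnd (m : M) (a : TT (EuclideanSpace ℝ (Fin n)) m) :
    T.mirrorBase Jb m (inclSnd _ _ a) = -inclFst _ _ (swapAt T T.dual m (T.ofTM Jb m a)) := by
  rw [mirrorBase_apply, shuffleAt_inclSnd, hJ.map_inclSnd, map_neg, shuffleAt_inclFst]

/-- The mirror structure is semi-flat. -/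
theorem mirror : T.dual.IsSemiFlat (T.mirror Jb) (T.mirrorBase Jb) where
  genAlmostComplex :=
    { sq := fun m a => by
        rw [mirrorBase_apply, mirrorBase_apply, T.inDuality_dual.shuffleAt_shuffleAt,
          hJ.genAlmostComplex.sq, map_neg, T.inDuality_dual.symm.shuffleAt_shuffleAt]
      orth := fun m a b => by
        rw [mirrorBase_apply, mirrorBase_apply, T.inDuality_dual.pairing_shuffleAt,
          hJ.genAlmostComplex.orth, T.inDuality_dual.symm.pairing_shuffleAt]
      smooth := fun U hU a ha => T.inDuality_dual.smooth_shuffleAt hU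
        (hJ.genAlmostComplex.smooth U hU _ (T.inDuality_dual.symm.smooth_shuffleAt hU ha)) }
  adapted m := by
    refine le_antisymm ?_ ?_
    · rintro _ ⟨_, ⟨x, rfl⟩, rfl⟩
      exact ⟨_, (hJ.mirrorBase_inclFst m x).symm⟩
    · rintro _ ⟨b, rfl⟩
      -- The witness is the element of `V ⊕ V^∨` that `Jb` maps to `b`, carried over to the dual
      -- bundle.
      refine ⟨_, ⟨swapAt T T.dual m (T.ofTM Jb m b), rfl⟩, ?_⟩
      rw [← shuffleAt_inclFst, mirrorBase_apply, T.inDuality_dual.shuffleAt_shuffleAt,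
        hJ.map_inclFst, hJ.toTM_ofTM, shuffleAt_inclSnd]
  eq_lift _ := rfl

theorem toTM_mirror (m : M) (x : Dbl (T.dual.V m)) :
    T.dual.toTM (T.mirrorBase Jb) m x = T.toTM Jb m (swapAt T.dual T m x) := by
  change projSnd _ _ (T.mirrorBase Jb m (inclFst _ _ x)) = _
  rw [hJ.mirrorBase_inclFst, projSnd_inclSnd]

theorem ofTM_mirror (m : M) (a : TT (EuclideanSpace ℝ (Fin n)) m) :
    T.dual.ofTM (T.mirrorBase Jb) m a = swapAt T T.dual m (T.ofTM Jb m a) := by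
  change projFst _ _ (-(T.mirrorBase Jb m (inclSnd _ _ a))) = _
  rw [hJ.mirrorBase_inclSnd, neg_neg, projFst_inclFst]

/-- `Δ` and `Δ^` are where the `V^∨` component, respectively the `V` component, of `ofTM` vanishes,
and passing to the mirror swaps these components. -/
theorem Delta_mirror : T.dual.Delta (T.mirrorBase Jb) = T.DeltaHat Jb := by
  funext m
  ext a
  rw [hJ.mirror.mem_Delta_iff, hJ.mem_DeltaHat_iff, hJ.ofTM_mirror,
    T.inDuality_dual.swapAt_snd_eq_zero]

theorem DeltaHat_mirror : T.dual.DeltaHat (T.mirrorBase Jb) = T.Delta Jb := by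
  funext m
  ext a
  rw [hJ.mirror.mem_DeltaHat_iff, hJ.mem_Delta_iff, hJ.ofTM_mirror,
    T.inDuality_dual.swapAt_fst_eq_zero]

/-- Both sides differentiate the same `ℝ^n`-valued function near `m`, so the equality holds for
arbitrary families `a`, without smoothness or membership. -/
theorem connDelta_mirror : T.dual.connDelta (T.mirrorBase Jb) = T.connDeltaHat Jb := by
  funext a m u
  rw [connDelta_eq, hJ.toTM_mirror]
  change _ = T.toTM Jb m (0, T.nablaDual (fun m' => (T.ofTM Jb m' (a m')).2) m u)
  congr 1
  refine Prod.ext ((T.inDuality_dual.symm.swapAt_fst_eq_zero _).2 rfl) ?_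
  apply coordDual_injective (T.mem_U m)
  rw [T.inDuality_dual.symm.coordDual_swapAt (T.mem_U m) (T.mem_U m), coord_nabla_self,
    coordDual_nablaDual]
  refine dirDeriv_congr ?_ u
  filter_upwards [(T.isOpen_U m).mem_nhds (T.mem_U m)] with m' hm'
  rw [hJ.ofTM_mirror, T.inDuality_dual.coord_swapAt hm' hm']

theorem connDeltaHat_mirror : T.dual.connDeltaHat (T.mirrorBase Jb) = T.connDelta Jb := by
  funext a m u
  rw [connDelta_eq]
  change T.dual.toTM (T.mirrorBase Jb) m
    (0, T.dual.nablaDual (fun m' => (T.dual.ofTM (T.mirrorBase Jb) m' (a m')).2) m u) = _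
  rw [hJ.toTM_mirror]
  congr 1
  refine Prod.ext ?_ ((T.inDuality_dual.symm.swapAt_snd_eq_zero _).2 rfl)
  apply T.coord_injective (T.mem_U m)
  rw [T.inDuality_dual.symm.coord_swapAt (T.mem_U m) (T.mem_U m), coord_nabla_self,
    coordDual_nablaDual]
  refine dirDeriv_congr ?_ u
  filter_upwards [(T.isOpen_U m).mem_nhds (T.mem_U m)] with m' hm'
  rw [hJ.ofTM_mirror, T.inDuality_dual.coordDual_swapAt hm' hm']

end IsSemiFlat

end Mirror

end TorusBundle

namespace TorusBundle

variable {n : ℕ} {M : Type*} [TopologicalSpace M] [ChartedSpace (EuclideanSpace ℝ (Fin n)) M]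
  [IsManifold (𝓡 n) ∞ M]
  {EZ : Type*} [NormedAddCommGroup EZ] [NormedSpace ℝ EZ]
  {Z : Type*} [TopologicalSpace Z] [ChartedSpace EZ Z] [IsManifold 𝓘(ℝ, EZ) ∞ Z]
  (T : TorusBundle n M EZ Z)

/-! ### Lifting sections to the total space -/

/-- The section of `T_Z ⊕ T_Z^∨` corresponding to the pullback of a section of
`V ⊕ T_M ⊕ V^∨ ⊕ T_M^∨`. -/
def liftSec (a : ∀ m, Dbl (T.VT m)) (z : Z) : TT EZ z := T.Finv z (a (T.proj z))

theorem isOpen_preimage_proj {U : Set M} (hU : IsOpen U) : IsOpen (T.proj ⁻¹' U) :=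
  hU.preimage T.contMDiff_proj.continuous

/-- Near `z` one trivialization and smooth fibre coordinates `τ` are fixed. The vector part is then
the image of smooth data under `dφ`. The one-form part, evaluated on a field `w`, is the product of
the dual coordinates with `dτ (w)` plus a form on `M` evaluated on `dp (w)`. -/
theorem smooth_liftSec {U : Set M} (hU : IsOpen U) {a : ∀ m, Dbl (T.VT m)}
    (ha : SmoothDbl (EuclideanSpace ℝ (Fin n)) T.SmoothVT U a) :
    SmoothTT (T.proj ⁻¹' U) (T.liftSec a) := by
  have ha' := (T.smoothDbl_iff hU a).1 ha
  constructor
  · intro z hz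
    obtain ⟨τ, h1, h2, -, h3, -⟩ :=
      T.exists_fibreCoord (T.proj z) (T.proj z) (T.mem_U _) (T.fib z)
    rw [T.φ_fib] at h1 h2 h3
    have hX := ((smoothVF_iff hU).1 ha'.2.1 _ hz).comp z h2
    have hη := (ha'.1 (T.proj z) (T.proj z) ⟨hz, T.mem_U _⟩).1.comp z h2
    have h4 := T.contMDiffAt_dφ (g := T.proj) (T.mem_U (T.proj z)) hX h1 hη
    refine (h4.congr_of_eventuallyEq ?_).contMDiffWithinAt
    filter_upwards [h3] with z' hz'
    have e : (T.liftSec a z').1 = T.dφ (T.proj z) (T.proj z') (τ z')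
        ((a (T.proj z')).1.2, T.coord (T.proj z) (T.proj z') (a (T.proj z')).1.1) := by
      change T.j z' (a (T.proj z')).1.1 + T.horLift z' (a (T.proj z')).1.2 = _
      rw [T.horLift_eq hz'.1 hz'.2, T.j_eq hz'.1 hz'.2]
      refine (map_add (T.dφ (T.proj z) (T.proj z') (τ z')) _ _).symm.trans ?_
      congr 1
      exact Prod.ext (zero_add _) (add_zero _)
    rw [e]
    exact tangentBundle_mk_eq hz'.2.symm _
  · intro U' hU' hUU w hw z hz
    obtain ⟨τ, h1, h2, h0, h3, h5⟩ :=
      T.exists_fibreCoord (T.proj z) (T.proj z) (T.mem_U _) (T.fib z)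
    have h6 := T.mfderiv_fibreCoord (T.mem_U _) h1 h5
    rw [T.φ_fib] at h1 h2 h3 h0
    have hw' := (smoothVF_iff hU').1 hw z hz
    have k1 := (ha'.1 (T.proj z) (T.proj z) ⟨hUU hz, T.mem_U _⟩).2.comp z h2
    have k2 : ContMDiffAt 𝓘(ℝ, EZ) 𝓘(ℝ, Rn n) ∞ (fun z' => dirDeriv τ z' (w z')) z :=
      contMDiffAt_mfderiv_apply (g := fun z : Z => z) h1 hw'
    have k3 := contMDiffAt_form_apply hU ha'.2.2 (g := T.proj) (hUU hz)
      (contMDiffAt_tangentMap (g := fun z : Z => z) h2 hw')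
    have k4 := (contMDiffAt_finsetSum (t := Finset.univ) fun k _ =>
      (contMDiffAt_pi_space.1 k1 k).mul (contMDiffAt_pi_space.1 k2 k)).add k3
    refine (k4.congr_of_eventuallyEq ?_).contMDiffWithinAt
    have hc : ContinuousAt (fun z' => (T.proj z', τ z')) z := h2.continuousAt.prodMk h1.continuousAt
    -- `h6` holds near the coordinates of `z`; these are rewritten as the value at `z` of `(proj,
    -- τ)`, so that continuity of that map pulls `h6` back to `Z`.
    rw [← h0] at h6
    filter_upwards [h3, hc.eventually h6] with z' hz' k6
    obtain ⟨e, he⟩ := T.dφ_equiv (T.proj z) (T.proj z') hz'.1 (τ z')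
    -- Writing `w z'` as the image of a vector under `dφ` shows that `dτ (w)` and the coordinates of
    -- `D (w)` are the same fibre component.
    have k7 : (w z' : EZ) = T.dφ (T.proj z) (T.proj z') (τ z') (e.symm (w z')) := by
      rw [he]; exact (e.apply_symm_apply _).symm
    have k8 : dirDeriv τ (T.φ (T.proj z) (T.proj z', τ z'))
        (T.dφ (T.proj z) (T.proj z') (τ z') (e.symm (w z'))) = (e.symm (w z')).2 :=
      k6 (e.symm (w z'))
    rw [← k7, hz'.2] at k8
    have k9 := T.coord_D_dφ hz'.1 hz'.2 (e.symm (w z'))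
    rw [← k7, ← k8] at k9
    change (a (T.proj z')).2 (T.D z' (w z'), T.dproj z' (w z')) = _
    have k10 : (a (T.proj z')).2 (T.D z' (w z'), T.dproj z' (w z')) =
        (projFst _ _ (a (T.proj z'))).2 (T.D z' (w z')) +
          (projSnd _ _ (a (T.proj z'))).2 (T.dproj z' (w z')) := by
      change _ = (a (T.proj z')).2 (_, 0) + (a (T.proj z')).2 (0, _)
      rw [← map_add]
      simp
    rw [k10, T.apply_eq_coordDual hz'.1, k9]
    rfl

/-! ### Lifts related to sections on the base, through the projection and through flat local
sections of `Z` -/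

theorem related_proj_inclSnd (a : ∀ m : M, TT (EuclideanSpace ℝ (Fin n)) m) (z : Z) :
    RelatedAt T.proj z (T.liftSec fun m => inclSnd _ _ (a m)) a := by
  refine ⟨?_, fun u => rfl⟩
  change T.dproj z (T.j z 0 + T.horLift z (a (T.proj z)).1) = _
  rw [map_add, T.dproj_j, T.dproj_horLift, zero_add]

theorem related_proj_inclFst {x : ∀ m : M, Dbl (T.V m)} {z : Z} (hx : (x (T.proj z)).2 = 0) :
    RelatedAt T.proj z (T.liftSec fun m => inclFst _ (TangentSpace (𝓡 n) m) (x m))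
      (fun m => (0 : TT (EuclideanSpace ℝ (Fin n)) m)) := by
  constructor
  · change T.dproj z (T.j z (x (T.proj z)).1 + T.horLift z 0) = 0
    rw [map_add, T.dproj_j, T.dproj_horLift, zero_add]
  · intro u
    change (x (T.proj z)).2 (T.D z u) = 0
    rw [hx]
    rfl

/-- A local section constant in a trivialization is tangent to the horizontal distribution, so its
differential is the horizontal lift, and pulling back along it undoes the pullback of forms by the
projection. -/
theorem related_section_inclSnd (a : ∀ m : M, TT (EuclideanSpace ℝ (Fin n)) m) {c m : M}
    (hm : m ∈ T.U c) (ξ : Rn n) :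
    RelatedAt (fun m => T.φ c (m, ξ)) m a (T.liftSec fun m => inclSnd _ _ (a m)) := by
  have hp := T.proj_φ c m hm ξ
  have hz : T.proj (T.φ c (m, ξ)) ∈ T.U c := by rwa [hp]
  have h : T.φ c (T.proj (T.φ c (m, ξ)), ξ) = T.φ c (m, ξ) := by rw [hp]
  constructor
  · rw [T.mfderiv_section c m hm]
    change _ = T.j (T.φ c (m, ξ)) 0 + T.horLift (T.φ c (m, ξ)) (a (T.proj (T.φ c (m, ξ)))).1
    rw [T.horLift_eq hz h, map_zero]
    refine Eq.trans ?_ (zero_add _).symm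
    exact (congrArg (fun m' : M => (T.dφ c m' ξ ((a m').1, 0) : EZ)) hp).symm
  · intro u
    rw [T.mfderiv_section c m hm]
    change (a m).2 u = (a (T.proj (T.φ c (m, ξ)))).2
      (T.dproj (T.φ c (m, ξ)) (T.dφ c m ξ (u, 0)))
    rw [T.dproj_dφ c m hm]
    exact (congrArg (fun m' : M => (a m').2 u) hp).symm

theorem D_dφ_eq_zero {c m : M} (hm : m ∈ T.U c) (ξ : Rn n) (u : EuclideanSpace ℝ (Fin n)) :
    T.D (T.φ c (m, ξ)) (T.dφ c m ξ (u, 0)) = 0 := by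
  have hp := T.proj_φ c m hm ξ
  have hz : T.proj (T.φ c (m, ξ)) ∈ T.U c := by rwa [hp]
  have h : T.φ c (T.proj (T.φ c (m, ξ)), ξ) = T.φ c (m, ξ) := by rw [hp]
  apply T.coord_injective hz
  rw [map_zero]
  have h1 := T.coord_D_dφ hz h (u, 0)
  have e : T.dφ c (T.proj (T.φ c (m, ξ))) ξ (u, 0) = T.dφ c m ξ (u, 0) :=
    congrArg (fun m' : M => (T.dφ c m' ξ (u, 0) : EZ)) hp
  rwa [e] at h1

theorem liftSec_inclFst_fst {x : ∀ m : M, Dbl (T.V m)} {z : Z} (hx : (x (T.proj z)).1 = 0) :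
    (T.liftSec (fun m => inclFst _ (TangentSpace (𝓡 n) m) (x m)) z).1 = 0 := by
  change T.j z (x (T.proj z)).1 + T.horLift z 0 = 0
  rw [hx, map_zero, map_zero, zero_add]

/-- The lift of an element of `V^∨` has no vector part, and its form factors through `D`, which
vanishes on vectors tangent to the section. -/
theorem related_section_inclFst {x : ∀ m : M, Dbl (T.V m)} {c m : M}
    (hm : m ∈ T.U c) (ξ : Rn n) (hx : (x m).1 = 0) :
    RelatedAt (fun m => T.φ c (m, ξ)) m (fun m => (0 : TT (EuclideanSpace ℝ (Fin n)) m))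
      (T.liftSec fun m => inclFst _ (TangentSpace (𝓡 n) m) (x m)) := by
  have hp := T.proj_φ c m hm ξ
  have hx' : (x (T.proj (T.φ c (m, ξ)))).1 = 0 := by rw [hp]; exact hx
  constructor
  · refine Eq.trans ?_ (T.liftSec_inclFst_fst hx').symm
    exact map_zero _
  · intro u
    rw [T.mfderiv_section c m hm]
    change 0 = (x (T.proj (T.φ c (m, ξ)))).2 (T.D (T.φ c (m, ξ)) (T.dφ c m ξ (u, 0)))
    exact ((congrArg _ (T.D_dφ_eq_zero hm ξ u)).trans (map_zero _)).symm

/-! ### Integrability -/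

theorem related_of_eq {E E' : Type*} [NormedAddCommGroup E] [NormedSpace ℝ E]
    [NormedAddCommGroup E'] [NormedSpace ℝ E'] {N N' : Type*} [TopologicalSpace N]
    [ChartedSpace E N] [IsManifold 𝓘(ℝ, E) ∞ N] [TopologicalSpace N'] [ChartedSpace E' N']
    [IsManifold 𝓘(ℝ, E') ∞ N'] {G : N → N'} {x : N} {y : N'} {a : ∀ x : N, TT E x}
    {b : ∀ y : N', TT E' y} (h : RelatedAt G x a b) (hy : G x = y) (u : E) :
    (a x).2 u = (b y).2 (mfderiv 𝓘(ℝ, E) 𝓘(ℝ, E') G x u : E') := by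
  subst hy
  exact h.2 u

theorem smoothTT_zero {E : Type*} [NormedAddCommGroup E] [NormedSpace ℝ E] {N : Type*}
    [TopologicalSpace N] [ChartedSpace E N] [IsManifold 𝓘(ℝ, E) ∞ N] (U : Set N) :
    SmoothTT U (fun x => (0 : TT E x)) :=
  ⟨(Bundle.contMDiff_zeroSection ℝ (TangentSpace 𝓘(ℝ, E) (M := N))).contMDiffOn,
    smoothDual_zero _ _⟩

/-- The criterion that recognizes `V` in `T_Z ⊕ T_Z^∨`: vertical vectors without a form part. The
next lemma does the same for `V^∨`: forms that annihilate the horizontal vectors. -/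
theorem F_eq_inclFst_inl {z : Z} {a : TT EZ z} (h1 : T.dproj z a.1 = 0) (h2 : a.2 = 0) :
    T.F z a = inclFst _ _ (T.D z a.1, 0) := by
  refine Prod.ext (Prod.ext rfl h1) ?_
  change a.2.comp _ = 0
  rw [h2]
  rfl

theorem F_eq_inclFst_inr {z : Z} {a : TT EZ z} (h1 : a.1 = 0)
    (h2 : ∀ u, a.2 (T.horLift z u) = 0) :
    T.F z a = inclFst _ _ (0, a.2.comp (T.j z)) := by
  refine Prod.ext (Prod.ext ?_ ?_) ?_
  · exact (congrArg (T.D z) h1).trans (map_zero _)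
  · exact (congrArg (T.dproj z) h1).trans (map_zero _)
  · ext v
    · change a.2 (T.j z v + T.horLift z 0) = a.2 (T.j z v)
      rw [map_zero, add_zero]
    · change a.2 (T.j z 0 + T.horLift z v) = a.2 (T.j z 0)
      rw [map_add, h2, add_zero]

namespace IsSemiFlat

variable {T} {J : ∀ z : Z, TT EZ z →ₗ[ℝ] TT EZ z}
  {Jb : ∀ m, Dbl (T.VT m) →ₗ[ℝ] Dbl (T.VT m)} (hJ : T.IsSemiFlat J Jb)

include hJ

/-- For every `a`, the element `a - i J a` lies in the `+i`-eigenspace, and for `a` in `T_M ⊕ T_M^∨`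
the part `-J a` is `ofTM a`. -/
theorem isEigenSection_lift {U : Set M} (hU : IsOpen U)
    {a : ∀ m : M, TT (EuclideanSpace ℝ (Fin n)) m} (ha : SmoothTT U a) :
    IsEigenSection J (T.proj ⁻¹' U) (T.liftSec fun m => inclSnd _ _ (a m))
      (T.liftSec fun m => inclFst _ _ (T.ofTM Jb m (a m))) := by
  refine ⟨T.smooth_liftSec hU (T.smooth_inclSnd hU ha),
    T.smooth_liftSec hU (hJ.smooth_inclFst_ofTM hU ha), fun z _ => ⟨?_, ?_⟩⟩
  · rw [hJ.eq_lift]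
    change T.Finv z (Jb _ (T.F z (T.Finv z (inclSnd _ _ (a (T.proj z)))))) =
      -T.Finv z (inclFst _ _ (T.ofTM Jb _ (a (T.proj z))))
    rw [T.F_Finv, hJ.map_inclSnd, map_neg]
  · rw [hJ.eq_lift]
    change T.Finv z (Jb _ (T.F z (T.Finv z (inclFst _ _ (T.ofTM Jb _ (a (T.proj z))))))) =
      T.Finv z (inclSnd _ _ (a (T.proj z)))
    rw [T.F_Finv, hJ.map_inclFst, hJ.toTM_ofTM]

/-- The consequence of integrability for the sections of the `+i`-eigenbundle given by two sections
of `T_M ⊕ T_M^∨`. -/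
theorem map_F_courant (hi : Integrable J) {U : Set M} (hU : IsOpen U)
    {a b : ∀ m : M, TT (EuclideanSpace ℝ (Fin n)) m} (ha : SmoothTT U a) (hb : SmoothTT U b)
    {z : Z} (hz : T.proj z ∈ U) {x : Dbl (T.V (T.proj z))}
    (h : T.F z (courant (T.liftSec fun m => inclSnd _ _ (a m))
        (T.liftSec fun m => inclFst _ _ (T.ofTM Jb m (b m))) z +
      courant (T.liftSec fun m => inclFst _ _ (T.ofTM Jb m (a m)))
        (T.liftSec fun m => inclSnd _ _ (b m)) z) = inclFst _ _ x) :
    T.toTM Jb (T.proj z) x = projSnd _ _ (T.F z (courant (T.liftSec fun m => inclSnd _ _ (a m))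
        (T.liftSec fun m => inclSnd _ _ (b m)) z -
      courant (T.liftSec fun m => inclFst _ _ (T.ofTM Jb m (a m)))
        (T.liftSec fun m => inclFst _ _ (T.ofTM Jb m (b m))) z)) := by
  -- The second component of integrability says that `J` maps the imaginary part of the bracket to
  -- its real part.
  have h1 := (hi _ (T.isOpen_preimage_proj hU) _ _ _ _ (hJ.isEigenSection_lift hU ha)
    (hJ.isEigenSection_lift hU hb) z hz).2
  rw [← h1, hJ.eq_lift]
  change _ = projSnd _ _ (T.F z (T.Finv z (Jb _ (T.F z _))))
  rw [T.F_Finv, h, hJ.map_inclFst, projSnd_inclSnd]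

/-- For sections of `Δ` the imaginary parts of the eigensections are vertical fields without form
part. They are related to `0` by the projection, so every bracket needed can be computed on `M`. -/
theorem diracIntegrable_Delta (hi : Integrable J) : DiracIntegrable (T.Delta Jb) := by
  intro U hU a b ha hb m hm
  obtain ⟨z, rfl⟩ : ∃ z, T.proj z = m := ⟨T.φ m (m, 0), T.proj_φ m m (T.mem_U m) 0⟩
  have hp : ContMDiffAt 𝓘(ℝ, EZ) (𝓡 n) ∞ T.proj z := T.contMDiff_proj z
  have hU' := T.isOpen_preimage_proj hU
  have sm := fun {a} (ha : SmoothTT U a) => (hJ.isEigenSection_lift hU ha).1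
  have sm' := fun {a} (ha : SmoothTT U a) => (hJ.isEigenSection_lift hU ha).2.1
  have r := fun a => Eventually.of_forall (f := 𝓝 z) fun z' => T.related_proj_inclSnd a z'
  have r' : ∀ {a}, IsSection (T.Delta Jb) U a → ∀ᶠ z' in 𝓝 z, RelatedAt T.proj z'
      (T.liftSec fun m => inclFst _ _ (T.ofTM Jb m (a m))) _ := fun ha => by
    filter_upwards [hU'.mem_nhds hm] with z' hz'
    exact T.related_proj_inclFst (hJ.mem_Delta_iff.1 (ha.2 _ hz'))
  have z0 := smoothTT_zero (E := EuclideanSpace ℝ (Fin n)) U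
  -- Through the projection the two mixed brackets are related to `[a, 0]` and `[0, b]`, both zero;
  -- the bracket of the real parts is related to `[a, b]`, and that of the imaginary parts to `[0,
  -- 0] = 0`.
  have q1 := courant_related hp hU' hm hU hm (sm ha.1) (sm' hb.1) ha.1 z0 (r a) (r' hb)
  have q2 := courant_related hp hU' hm hU hm (sm' ha.1) (sm hb.1) z0 hb.1 (r' ha) (r b)
  have q3 := courant_related hp hU' hm hU hm (sm ha.1) (sm hb.1) ha.1 hb.1 (r a) (r b)
  have q4 := courant_related hp hU' hm hU hm (sm' ha.1) (sm' hb.1) z0 z0 (r' ha) (r' hb)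
  rw [RelatedAt, courant_zero_right] at q1
  rw [RelatedAt, courant_zero_left] at q2 q4
  -- The sum of the mixed brackets is vertical with zero form, hence lies in `V`; its image under
  -- `J` therefore lies in `Δ`.
  have h1 := hJ.map_F_courant hi hU ha.1 hb.1 hm (T.F_eq_inclFst_inl
    ((map_add (T.dproj z) _ _).trans ((congrArg₂ (fun v w => v + w) q1.1 q2.1).trans (add_zero _)))
    (by
      ext u
      exact (congrArg₂ (fun v w : ℝ => v + w) (q1.2 u) (q2.2 u)).trans (add_zero _)))
  have h2 : courant a b (T.proj z) = _ := Eq.trans ?_ h1.symm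
  · rw [h2]
    exact hJ.toTM_mem_Delta _ _
  · refine Prod.ext ?_ ?_
    · exact ((map_sub (T.dproj z) _ _).trans
        ((congrArg₂ (fun v w => v - w) q3.1 q4.1).trans (sub_zero _))).symm
    · ext u
      change _ = (courant _ _ z).2 (T.j z 0 + T.horLift z u) -
        (courant _ _ z).2 (T.j z 0 + T.horLift z u)
      rw [map_zero, zero_add]
      refine Eq.trans ?_ (congrArg₂ (fun v w : ℝ => v - w) (q3.2 _) (q4.2 _)).symm
      refine Eq.trans ?_ (sub_zero _).symm
      exact congrArg _ (T.dproj_horLift z u).symm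

theorem toTM_mem_DeltaHat (m : M) (α : T.V m →L[ℝ] ℝ) :
    T.toTM Jb m (0, α) ∈ T.DeltaHat Jb m := by
  rw [hJ.mem_DeltaHat_iff, hJ.ofTM_toTM]

/-- For `Δ^` the imaginary parts are forms along the fibres, which need not be pullbacks from `M`,
so the projection no longer relates them to `0`. Forms are compared along the flat local section
through `z` instead. Its target is `Z`, which is why `EZ` has to be finite-dimensional. -/
theorem diracIntegrable_DeltaHat [FiniteDimensional ℝ EZ] (hi : Integrable J) :
    DiracIntegrable (T.DeltaHat Jb) := by
  intro U hU a b ha hb m hm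
  obtain ⟨z, rfl⟩ : ∃ z, T.proj z = m := ⟨T.φ m (m, 0), T.proj_φ m m (T.mem_U m) 0⟩
  have hp : ContMDiffAt 𝓘(ℝ, EZ) (𝓡 n) ∞ T.proj z := T.contMDiff_proj z
  have hU' := T.isOpen_preimage_proj hU
  have hc := T.mem_U (T.proj z)
  have hG := T.contMDiffAt_section _ _ hc (T.fib z)
  have hz : T.φ (T.proj z) (T.proj z, T.fib z) = z := T.φ_fib z
  have hm' : T.φ (T.proj z) (T.proj z, T.fib z) ∈ T.proj ⁻¹' U := by rw [hz]; exact hm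
  have sm := fun {a} (ha : SmoothTT U a) => (hJ.isEigenSection_lift hU ha).1
  have sm' := fun {a} (ha : SmoothTT U a) => (hJ.isEigenSection_lift hU ha).2.1
  have ev := (hU.inter (T.isOpen_U (T.proj z))).mem_nhds ⟨hm, hc⟩
  have r : ∀ a, ∀ᶠ m' in 𝓝 (T.proj z), RelatedAt (fun m => T.φ (T.proj z) (m, T.fib z)) m' a
      (T.liftSec fun m => inclSnd _ _ (a m)) := fun a => by
    filter_upwards [ev] with m' h' using T.related_section_inclSnd a h'.2 _
  have r' : ∀ {a}, IsSection (T.DeltaHat Jb) U a → ∀ᶠ m' in 𝓝 (T.proj z),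
      RelatedAt (fun m => T.φ (T.proj z) (m, T.fib z)) m' _
      (T.liftSec fun m => inclFst _ _ (T.ofTM Jb m (a m))) := fun ha => by
    filter_upwards [ev] with m' h'
    exact T.related_section_inclFst h'.2 _ (hJ.mem_DeltaHat_iff.1 (ha.2 _ h'.1))
  have v : ∀ {a}, IsSection (T.DeltaHat Jb) U a → (fun z' =>
      (T.liftSec (fun m => inclFst _ (TangentSpace (𝓡 n) m) (T.ofTM Jb m (a m))) z').1) =ᶠ[𝓝 z]
        0 := fun ha => by
    filter_upwards [hU'.mem_nhds hm] with z' hz'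
    exact T.liftSec_inclFst_fst (hJ.mem_DeltaHat_iff.1 (ha.2 _ hz'))
  have z0 := smoothTT_zero (E := EuclideanSpace ℝ (Fin n)) U
  have q1 := courant_related hG hU hm hU' hm' ha.1 z0 (sm ha.1) (sm' hb.1) (r a) (r' hb)
  have q2 := courant_related hG hU hm hU' hm' z0 hb.1 (sm' ha.1) (sm hb.1) (r' ha) (r b)
  have q3 := courant_related hG hU hm hU' hm' ha.1 hb.1 (sm ha.1) (sm hb.1) (r a) (r b)
  have q4 := courant_related hG hU hm hU' hm' z0 z0 (sm' ha.1) (sm' hb.1) (r' ha) (r' hb)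
  -- The flat section serves for the form parts on horizontal vectors; the vector part of the
  -- bracket of the real parts is read off through the projection.
  have p3 := (courant_related hp hU' hm hU hm (sm ha.1) (sm hb.1) ha.1 hb.1
    (Eventually.of_forall fun z' => T.related_proj_inclSnd a z')
    (Eventually.of_forall fun z' => T.related_proj_inclSnd b z')).1
  -- Horizontal vectors at `z` are exactly the tangent vectors of the flat section, so relatedness
  -- determines a form on them.
  have fm : ∀ {A : ∀ m : M, TT (EuclideanSpace ℝ (Fin n)) m} {B : ∀ z : Z, TT EZ z},
      RelatedAt (fun m => T.φ (T.proj z) (m, T.fib z)) (T.proj z) A B →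
      ∀ u, (B z).2 (T.horLift z u) = (A (T.proj z)).2 u := fun h u => by
    rw [related_of_eq h hz u, T.mfderiv_section _ _ hc]
    rfl
  -- A Lie bracket depends only on germs, and the imaginary parts have no vector part near `z`;
  -- every bracket that contains one of them has zero vector part.
  have l1 : ∀ {A B : ∀ z : Z, TT EZ z}, (fun z' => (B z').1) =ᶠ[𝓝 z] 0 →
      (courant A B z).1 = 0 := fun h =>
    ((EventuallyEq.refl _ _).mlieBracket_vectorField_eq h).trans
      (congrFun (VectorField.mlieBracket_zero_right (I := 𝓘(ℝ, EZ))) z)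
  have l2 : ∀ {A B : ∀ z : Z, TT EZ z}, (fun z' => (A z').1) =ᶠ[𝓝 z] 0 →
      (courant A B z).1 = 0 := fun h =>
    (h.mlieBracket_vectorField_eq (EventuallyEq.refl _ _)).trans
      (congrFun (VectorField.mlieBracket_zero_left (I := 𝓘(ℝ, EZ))) z)
  have f1 := fm q1
  have f2 := fm q2
  have f3 := fm q3
  have f4 := fm q4
  rw [courant_zero_right] at f1
  rw [courant_zero_left] at f2 f4
  -- The sum of the mixed brackets has no vector part and annihilates horizontal vectors, hence lies
  -- in `V^∨`.
  have h1 := hJ.map_F_courant hi hU ha.1 hb.1 hm (T.F_eq_inclFst_inr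
    ((congrArg₂ (fun v w => v + w) (l1 (v hb)) (l2 (v ha))).trans (add_zero _))
    (fun u => (congrArg₂ (fun v w : ℝ => v + w) (f1 u) (f2 u)).trans (add_zero _)))
  have h2 : courant a b (T.proj z) = _ := Eq.trans ?_ h1.symm
  · rw [h2]
    exact hJ.toTM_mem_DeltaHat _ _
  · refine Prod.ext ?_ ?_
    · exact ((map_sub (T.dproj z) _ _).trans ((congrArg₂ (fun v w => v - w) p3
        ((congrArg (T.dproj z) (l1 (v hb))).trans (map_zero _))).trans (sub_zero _))).symm
    · ext u
      change _ = (courant _ _ z).2 (T.j z 0 + T.horLift z u) -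
        (courant _ _ z).2 (T.j z 0 + T.horLift z u)
      rw [map_zero, zero_add, f3, f4]
      exact (sub_zero _).symm

end IsSemiFlat

end TorusBundle

end TorusMirror

end

open TorusMirror in
theorem mainTheorem7 {n : ℕ} {M : Type*} [TopologicalSpace M]
    [ChartedSpace (EuclideanSpace ℝ (Fin n)) M] [IsManifold (𝓡 n) ∞ M]
    {EZ : Type*} [NormedAddCommGroup EZ] [NormedSpace ℝ EZ] [FiniteDimensional ℝ EZ]
    {Z : Type*} [TopologicalSpace Z] [ChartedSpace EZ Z] [IsManifold 𝓘(ℝ, EZ) ∞ Z]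
    (T : TorusBundle n M EZ Z)
    (J : ∀ z : Z, TT EZ z →ₗ[ℝ] TT EZ z)
    (Jb : ∀ m : M, Dbl (T.VT m) →ₗ[ℝ] Dbl (T.VT m))
    (hJ : T.IsSemiFlat J Jb) :
    -- a pair of almost Dirac structures
    (IsAlmostDirac (T.Delta Jb) ∧ IsAlmostDirac (T.DeltaHat Jb)) ∧
    -- each carries its own flat connection
    (IsFlatConnection (T.Delta Jb) (T.connDelta Jb) ∧
      IsFlatConnection (T.DeltaHat Jb) (T.connDeltaHat Jb)) ∧
    -- they are exchanged, with their connections, under mirror symmetry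
    (T.dual.IsSemiFlat (T.mirror Jb) (T.mirrorBase Jb) ∧
      T.dual.Delta (T.mirrorBase Jb) = T.DeltaHat Jb ∧
      T.dual.DeltaHat (T.mirrorBase Jb) = T.Delta Jb ∧
      (∀ U : Set M, IsOpen U → ∀ a, IsSection (T.DeltaHat Jb) U a → ∀ m ∈ U, ∀ u,
        T.dual.connDelta (T.mirrorBase Jb) a m u = T.connDeltaHat Jb a m u) ∧
      (∀ U : Set M, IsOpen U → ∀ a, IsSection (T.Delta Jb) U a → ∀ m ∈ U, ∀ u,
        T.dual.connDeltaHat (T.mirrorBase Jb) a m u = T.connDelta Jb a m u)) ∧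
    -- integrability
    (Integrable J → DiracIntegrable (T.Delta Jb) ∧ DiracIntegrable (T.DeltaHat Jb)) := by
  refine ⟨⟨hJ.isAlmostDirac_Delta, ?_⟩, ⟨hJ.isFlatConnection_Delta, ?_⟩,
    ⟨hJ.mirror, hJ.Delta_mirror, hJ.DeltaHat_mirror, fun _ _ a _ m _ u => ?_,
      fun _ _ a _ m _ u => ?_⟩,
    fun hi => ⟨hJ.diracIntegrable_Delta hi, hJ.diracIntegrable_DeltaHat hi⟩⟩
  -- The statements on `Δ^` and its connection are those on `Δ` applied to the mirror, which is
  -- semi-flat.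
  · rw [← hJ.Delta_mirror]
    exact hJ.mirror.isAlmostDirac_Delta
  · rw [← hJ.Delta_mirror, ← hJ.connDelta_mirror]
    exact hJ.mirror.isFlatConnection_Delta
  · rw [hJ.connDelta_mirror]
  · rw [hJ.connDeltaHat_mirror]
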